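/- Let $\Omega\subset\mathbb R^2$ be a convex open set with $0\in\Omega$, put $\dot\Omega=\Omega\setminus\{0\}$, and assume that $\dot\Omega$ is invariant under $(x,y)\mapsto(-x,y)$ and $(x,y)\mapsto(x,-y)$, and that for some $a,b\in\mathbb R$ one has $\Omega\cap\{y=0\}=]-\tfrac a2,\tfrac a2[\times\{0\}$ and $\Omega\cap\{x=0\}=\{0\}\times]-\tfrac b2,\tfrac b2[$ (so $\Omega$ is bounded). Write $x+iy=re^{i\theta}$ with $\theta\in]-\pi,\pi]$, let $\mathbf A=(A_1,A_2)=\frac12\left(-\frac y{r^2},\frac x{r^2}\right)$, and let $-\Delta_{\mathbf A}$ be the Aharonov–Bohm operator on $L^2(\dot\Omega)$, i.e. the Friedrichs extension of $(-i\partial_x-A_1)^2+(-i\partial_y-A_2)^2$ defined on $C_c^\infty(\dot\Omega)$. A function $u$ on $\dot\Omega$ is called $K$-real if $e^{i\theta}\overline{u}=u$, and $\Sigma_2^c$-invariant if $\overline{u(x,-y)}=u(x,y)$ (almost everywhere). Let $\Omega^{uh}=\Omega\cap\{y>0\}$, and let the DN problem be the eigenvalue problem for the realization of $-\Delta$ in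 $L^2(\Omega^{uh})$ with the Neumann condition on $N=]0,\tfrac a2]\times\{0\}$ and the Dirichlet condition on $\partial\Omega^{uh}\setminus N$, i.e. the self-adjoint operator associated with the form $\int_{\Omega^{uh}}\nabla w\cdot\overline{\nabla\psi}$ on the closure in $H^1(\Omega^{uh})$ of the restrictions to $\Omega^{uh}$ of the functions in $C_c^\infty(\mathbb R^2)$ whose support is disjoint from $\overline{\partial\Omega^{uh}\setminus N}$. Then, for every $\lambda\in\mathbb R$: 1. If $u$ is a $K$-real, $\Sigma_2^c$-invariant eigenfunction of $-\Delta_{\mathbf A}$ for the eigenvalue $\lambda$, then the restriction of $e^{-i\theta/2}u$ to $\Omega^{uh}$ is a real-valued eigenfunction of the DN problem for the eigenvalue $\lambda$. 2. If $\lambda$ is an eigenvalue of $-\Delta_{\mathbf A}$, then $\lambda$ is an eigenvalue of the DN problem. 3. Conversely, if $w$ is an eigenfunction of the DN problem for the eigenvalue $\lambda$ and $w^{ext}(x,y)=w(x,|y|)$ is its extension by symmetry, then $v=e^{i\theta/2}w^{ext}$ is an eigenfunction of $-\Delta_{\mathbf A}$ for the eigenvalue $\lambda$; if moreover $w$ is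 real-valued, then $v$ is $K$-real and $\Sigma_2^c$-invariant. 4. If $\lambda$ is an eigenvalue of the DN problem, then $\lambda$ is an eigenvalue of $-\Delta_{\mathbf A}$. -/

import Mathlib

open MeasureTheory Filter Topology
open scoped ContDiff ComplexConjugate

noncomputable section

namespace AharonovBohm

/-! The plane is identified with `ℂ` through `z = x + i y`; the measure is Lebesgue measure. -/

/-- The `L²` scalar product, linear in the first argument. -/
def l2inner (μ : Measure ℂ) (f g : ℂ → ℂ) : ℂ := ∫ z, f z * conj (g z) ∂μ

/-- The partial derivative with respect to `x`. -/
def partialX (φ : ℂ → ℂ) (z : ℂ) : ℂ := fderiv ℝ φ z 1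

/-- The partial derivative with respect to `y`. -/
def partialY (φ : ℂ → ℂ) (z : ℂ) : ℂ := fderiv ℝ φ z Complex.I

/-! ### Friedrichs extension -/

/-- The form domain of the operator `T` defined on the core `C`: the completion of `C` inside
`L²(μ)` for the norm `‖φ‖² + ⟨T φ, φ⟩`. -/
def InFormDomain (μ : Measure ℂ) (C : Set (ℂ → ℂ)) (T : (ℂ → ℂ) → ℂ → ℂ) (u : ℂ → ℂ) : Prop :=
  MemLp u 2 μ ∧ ∃ φ : ℕ → ℂ → ℂ, (∀ n, φ n ∈ C) ∧
    Tendsto (fun n => eLpNorm (φ n - u) 2 μ) atTop (𝓝 0) ∧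
    Tendsto (fun p : ℕ × ℕ => l2inner μ (T (φ p.1 - φ p.2)) (φ p.1 - φ p.2)) atTop (𝓝 0)

/-- `FriedrichsGraph μ C T u f`: the function `u` belongs to the domain of the Friedrichs extension
of the symmetric nonnegative operator `T` with domain `C`, which maps `u` to `f`.
The Friedrichs extension is the restriction of the adjoint of `T` to the form domain. -/
def FriedrichsGraph (μ : Measure ℂ) (C : Set (ℂ → ℂ)) (T : (ℂ → ℂ) → ℂ → ℂ)
    (u f : ℂ → ℂ) : Prop :=
  InFormDomain μ C T u ∧ MemLp f 2 μ ∧ ∀ ψ ∈ C, l2inner μ u (T ψ) = l2inner μ f ψ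

/-! ### The Aharonov-Bohm operator with flux `1/2` -/

/-- `C_c^∞(U)`. -/
def testFunctions (U : Set ℂ) : Set (ℂ → ℂ) :=
  {φ | ContDiff ℝ ∞ φ ∧ HasCompactSupport φ ∧ tsupport φ ⊆ U}

/-- First component `A₁ = -(1/2) y / r²` of the magnetic potential. -/
def potential₁ (z : ℂ) : ℝ := (1 / 2) * (-z.im / ‖z‖ ^ 2)

/-- Second component `A₂ = (1/2) x / r²` of the magnetic potential. -/
def potential₂ (z : ℂ) : ℝ := (1 / 2) * (z.re / ‖z‖ ^ 2)

/-- `D_x - A₁`, where `D_x = -i ∂_x`. -/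
def magneticX (φ : ℂ → ℂ) (z : ℂ) : ℂ := -Complex.I * partialX φ z - potential₁ z * φ z

/-- `D_y - A₂`, where `D_y = -i ∂_y`. -/
def magneticY (φ : ℂ → ℂ) (z : ℂ) : ℂ := -Complex.I * partialY φ z - potential₂ z * φ z

/-- The differential expression `-Δ_A = (D_x - A₁)² + (D_y - A₂)²`. -/
def magneticLaplacian (φ : ℂ → ℂ) (z : ℂ) : ℂ :=
  magneticX (magneticX φ) z + magneticY (magneticY φ) z

/-- The punctured domain. -/
def punctured (Ω : Set ℂ) : Set ℂ := Ω \ {0}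

/-- `u` is an eigenfunction, for the eigenvalue `lam`, of the Aharonov-Bohm operator on the
punctured domain (the Friedrichs extension of `-Δ_A` on `C_c^∞(Ω \ {0})`). -/
def IsABEigenfunction (Ω : Set ℂ) (lam : ℝ) (u : ℂ → ℂ) : Prop :=
  FriedrichsGraph (volume.restrict (punctured Ω)) (testFunctions (punctured Ω)) magneticLaplacian
      u (fun z => (lam : ℂ) * u z) ∧
    ¬ u =ᵐ[volume.restrict (punctured Ω)] 0

/-- `lam` is an eigenvalue of the Aharonov-Bohm operator. -/
def IsABEigenvalue (Ω : Set ℂ) (lam : ℝ) : Prop := ∃ u, IsABEigenfunction Ω lam u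

/-! ### Symmetries -/

/-- `σ₁ (x, y) = (-x, y)`. -/
def sigma₁ (z : ℂ) : ℂ := ⟨-z.re, z.im⟩

/-- `σ₂ (x, y) = (x, -y)`. -/
def sigma₂ (z : ℂ) : ℂ := ⟨z.re, -z.im⟩

/-- The antilinear operator `K = e^{iθ} Γ`, with `Γ` the complex conjugation. -/
def opK (u : ℂ → ℂ) (z : ℂ) : ℂ := Complex.exp (Complex.I * z.arg) * conj (u z)

/-- The antilinear operator `Σ₂ᶜ = Γ Σ₂`, where `Σ₂ u = u ∘ σ₂`. -/
def opSigma₂c (u : ℂ → ℂ) (z : ℂ) : ℂ := conj (u (sigma₂ z))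

/-- `K u = u` in `L²`. -/
def IsKReal (Ω : Set ℂ) (u : ℂ → ℂ) : Prop := opK u =ᵐ[volume.restrict (punctured Ω)] u

/-- `Σ₂ᶜ u = u` in `L²`. -/
def IsSigma₂cInvariant (Ω : Set ℂ) (u : ℂ → ℂ) : Prop :=
  opSigma₂c u =ᵐ[volume.restrict (punctured Ω)] u

/-! ### The mixed Dirichlet-Neumann Laplacian -/

/-- Smooth compactly supported functions on the plane vanishing near the set `D`. -/
def vanishingNear (D : Set ℂ) : Set (ℂ → ℂ) :=
  {φ | ContDiff ℝ ∞ φ ∧ HasCompactSupport φ ∧ Disjoint (tsupport φ) (closure D)}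

/-- `w` lies in the closure, in `H¹(U)`, of the (restrictions to `U` of the) smooth functions
vanishing near `D`, and `(g₁, g₂)` is its weak gradient. -/
def InH1Closure (U D : Set ℂ) (w g₁ g₂ : ℂ → ℂ) : Prop :=
  MemLp w 2 (volume.restrict U) ∧ MemLp g₁ 2 (volume.restrict U) ∧
    MemLp g₂ 2 (volume.restrict U) ∧
    ∃ φ : ℕ → ℂ → ℂ, (∀ n, φ n ∈ vanishingNear D) ∧
      Tendsto (fun n => eLpNorm (φ n - w) 2 (volume.restrict U)) atTop (𝓝 0) ∧
      Tendsto (fun n => eLpNorm (partialX (φ n) - g₁) 2 (volume.restrict U)) atTop (𝓝 0) ∧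
      Tendsto (fun n => eLpNorm (partialY (φ n) - g₂) 2 (volume.restrict U)) atTop (𝓝 0)

/-- `MixedLaplacianGraph U N w f`: the function `w` is in the domain of the realization of `-Δ` in
`U` with Neumann condition on the part `N` of the boundary and Dirichlet condition on the rest of
the boundary, and this operator maps `w` to `f`. It is the self-adjoint operator associated with
the Dirichlet form `∫_U ∇w · conj ∇ψ` on the closure in `H¹(U)` of the smooth functions vanishing
near the Dirichlet part. -/
def MixedLaplacianGraph (U N : Set ℂ) (w f : ℂ → ℂ) : Prop :=
  MemLp f 2 (volume.restrict U) ∧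
    ∃ g₁ g₂ : ℂ → ℂ, InH1Closure U (frontier U \ N) w g₁ g₂ ∧
      ∀ ψ ∈ vanishingNear (frontier U \ N),
        l2inner (volume.restrict U) g₁ (partialX ψ) + l2inner (volume.restrict U) g₂ (partialY ψ)
          = l2inner (volume.restrict U) f ψ

/-- The upper half-domain `Ω ∩ {y > 0}`. -/
def upperHalf (Ω : Set ℂ) : Set ℂ := Ω ∩ {z | 0 < z.im}

/-- The segment `]0, a/2] × {0}`. -/
def neumannPart (a : ℝ) : Set ℂ := {z | 0 < z.re ∧ z.re ≤ a / 2 ∧ z.im = 0}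

/-- `w` is an eigenfunction, for the eigenvalue `lam`, of the Laplacian in the upper half-domain
with Neumann condition on `]0, a/2] × {0}` and Dirichlet condition elsewhere. -/
def IsDNEigenfunction (Ω : Set ℂ) (a lam : ℝ) (w : ℂ → ℂ) : Prop :=
  MixedLaplacianGraph (upperHalf Ω) (neumannPart a) w (fun z => (lam : ℂ) * w z) ∧
    ¬ w =ᵐ[volume.restrict (upperHalf Ω)] 0

/-- `lam` is an eigenvalue of the mixed Dirichlet-Neumann problem. -/
def IsDNEigenvalue (Ω : Set ℂ) (a lam : ℝ) : Prop := ∃ w, IsDNEigenfunction Ω a lam w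

/-- The function is real-valued almost everywhere in `U`. -/
def IsRealValued (U : Set ℂ) (w : ℂ → ℂ) : Prop :=
  ∀ᵐ z ∂(volume.restrict U), (w z).im = 0

/-- Multiplication by `e^{-iθ/2}`, with `θ ∈ ]-π, π]` the argument. -/
def gaugeDown (u : ℂ → ℂ) (z : ℂ) : ℂ := Complex.exp (-(Complex.I * z.arg / 2)) * u z

/-- Multiplication by `e^{iθ/2}`, with `θ ∈ ]-π, π]` the argument. -/
def gaugeUp (u : ℂ → ℂ) (z : ℂ) : ℂ := Complex.exp (Complex.I * z.arg / 2) * u z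

/-- Extension by symmetry with respect to the axis `y = 0`: `(x, y) ↦ w (x, |y|)`. -/
def symmExtension (w : ℂ → ℂ) (z : ℂ) : ℂ := w ⟨z.re, |z.im|⟩

end AharonovBohm

end

/-!
Off the half-axis `θ = π` the magnetic potential is the gradient of `θ / 2`, so multiplication by
`e^{-iθ/2}` (`gaugeDown`) turns the magnetic gradient into the ordinary one
(`magneticX_gaugeUp`, `partialX_gaugeDown`). The price is a jump: the gauge transform of a smooth
function changes sign across the half-axis.

The operator `S = K Σ₂ᶜ`, `S u = e^{iθ} (u ∘ σ₂)` (`twistedReflection`), is a linear unitary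
involution which commutes with the Aharonov-Bohm operator, and in the gauge it is the reflection
with respect to `y = 0`. A function fixed by `S` therefore has an even gauge transform; evenness
turns the sign change across `θ = π` into a Dirichlet condition there, while on `θ = 0` it gives the
Neumann condition. All quadratic expressions of such functions over the punctured domain are twice
those over the upper half-domain (`l2inner_punctured`).

To make this rigorous both form domains are compared with a common core: the even test functions of
the domain slit along `θ = π`. Two approximation results show that this class is dense on both
sides.

* A smooth function which vanishes near the Dirichlet part agrees, on the half-domain, with a test
  function of the slit domain (`exists_testFunction_eqOn`, where convexity enters through
  `corner_mem_closure`), and composing with `(x, y) ↦ (x, √(y² + ε²))` makes it even and smooth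
  (`exists_even_approximation`).
* A test function of the punctured domain fixed by `S` vanishes on `θ = π`, hence is `O(|y|)` there,
  which pays for the gradient of a cutoff at distance `1/k` from the slit
  (`exists_slit_approximation`).

With these, eigenfunctions fixed by `S` correspond to eigenfunctions of the mixed problem
(`isDNEigenfunction_gaugeDown`, `isABEigenfunction_gaugeUp`). A function which is `K`-real and
`Σ₂ᶜ`-invariant is fixed by `S`. For an arbitrary eigenfunction `u`, either `u + S u` is a nonzero
eigenfunction fixed by `S`, or `S u = -u`; in the latter case the antilinear reflection
`Σ₁ᶜ u = conj (u ∘ σ₁)`, which also commutes with the operator, is fixed by `S`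
(`exists_fixed_eigenfunction`).
-/

noncomputable section

namespace AharonovBohm

/-! ### The scalar product of `L²` -/

variable {μ : Measure ℂ} {f g h f₁ f₂ g₁ g₂ : ℂ → ℂ}

theorem l2inner_eq_inner (hf : MemLp f 2 μ) (hg : MemLp g 2 μ) :
    l2inner μ f g = inner ℂ (hg.toLp g) (hf.toLp f) := by
  rw [L2.inner_def]
  refine integral_congr_ae ?_
  filter_upwards [hf.coeFn_toLp, hg.coeFn_toLp] with z h1 h2
  rw [h1, h2, RCLike.inner_apply]

theorem l2inner_congr (hf : f₁ =ᵐ[μ] f₂) (hg : g₁ =ᵐ[μ] g₂) :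
    l2inner μ f₁ g₁ = l2inner μ f₂ g₂ := by
  refine integral_congr_ae ?_
  filter_upwards [hf, hg] with z h1 h2
  rw [h1, h2]

theorem conj_l2inner (f g : ℂ → ℂ) : conj (l2inner μ f g) = l2inner μ g f := by
  unfold l2inner
  rw [← integral_conj]
  simp [mul_comm]

theorem integrable_mul_conj (hf : MemLp f 2 μ) (hg : MemLp g 2 μ) :
    Integrable (fun z => f z * conj (g z)) μ := by
  have h2 : MemLp (fun z => conj (g z)) 2 μ :=
    ⟨Complex.continuous_conj.comp_aestronglyMeasurable hg.1, by
      rw [eLpNorm_congr_norm_ae (g := g) (by simp)]; exact hg.2⟩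
  exact hf.integrable_mul h2

theorem l2inner_add_right (hf : MemLp f 2 μ) (hg : MemLp g 2 μ) (hh : MemLp h 2 μ) :
    l2inner μ f (g + h) = l2inner μ f g + l2inner μ f h := by
  unfold l2inner
  rw [← integral_add (integrable_mul_conj hf hg) (integrable_mul_conj hf hh)]
  simp [mul_add]

theorem l2inner_add_left (hf : MemLp f 2 μ) (hg : MemLp g 2 μ) (hh : MemLp h 2 μ) :
    l2inner μ (f + g) h = l2inner μ f h + l2inner μ g h := by
  unfold l2inner
  rw [← integral_add (integrable_mul_conj hf hh) (integrable_mul_conj hg hh)]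
  simp [add_mul]

theorem l2inner_const_mul_left (c : ℂ) (f g : ℂ → ℂ) :
    l2inner μ (fun z => c * f z) g = c * l2inner μ f g := by
  unfold l2inner
  rw [← integral_const_mul]
  simp [mul_assoc]

theorem l2inner_self (hf : MemLp f 2 μ) :
    l2inner μ f f = (((eLpNorm f 2 μ).toReal ^ 2 : ℝ) : ℂ) := by
  rw [l2inner_eq_inner hf hf, inner_self_eq_norm_sq_to_K, Lp.norm_toLp]
  simp

theorem tendsto_l2inner_left {f : ℕ → ℂ → ℂ} {F : ℂ → ℂ} (hf : ∀ n, MemLp (f n) 2 μ)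
    (hF : MemLp F 2 μ) (hg : MemLp g 2 μ)
    (hlim : Tendsto (fun n => eLpNorm (f n - F) 2 μ) atTop (𝓝 0)) :
    Tendsto (fun n => l2inner μ (f n) g) atTop (𝓝 (l2inner μ F g)) := by
  simp_rw [fun n => l2inner_eq_inner (hf n) hg, l2inner_eq_inner hF hg]
  exact tendsto_const_nhds.inner ((Lp.tendsto_Lp_iff_tendsto_eLpNorm'' f hf F hF).2 hlim)

theorem tendsto_l2inner_right {f : ℕ → ℂ → ℂ} {F : ℂ → ℂ} (hf : ∀ n, MemLp (f n) 2 μ)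
    (hF : MemLp F 2 μ) (hg : MemLp g 2 μ)
    (hlim : Tendsto (fun n => eLpNorm (f n - F) 2 μ) atTop (𝓝 0)) :
    Tendsto (fun n => l2inner μ g (f n)) atTop (𝓝 (l2inner μ g F)) := by
  have := (Complex.continuous_conj.tendsto _).comp (tendsto_l2inner_left hf hF hg hlim)
  simpa only [Function.comp_def, conj_l2inner] using this

/-- Completeness of `L²`, for sequences of functions. -/
theorem exists_tendsto_of_cauchy {f : ℕ → ℂ → ℂ} (hf : ∀ n, MemLp (f n) 2 μ)
    (hc : Tendsto (fun p : ℕ × ℕ => eLpNorm (f p.1 - f p.2) 2 μ) atTop (𝓝 0)) :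
    ∃ F, MemLp F 2 μ ∧ Tendsto (fun n => eLpNorm (f n - F) 2 μ) atTop (𝓝 0) := by
  have h1 : CauchySeq fun n => (hf n).toLp (f n) := by
    rw [Lp.cauchySeq_Lp_iff_cauchySeq_eLpNorm]
    refine hc.congr fun p => eLpNorm_congr_ae ?_
    filter_upwards [(hf p.1).coeFn_toLp, (hf p.2).coeFn_toLp] with z h1 h2
    simp [h1, h2]
  obtain ⟨F, hF⟩ := cauchySeq_tendsto_of_complete h1
  refine ⟨F, Lp.memLp F, ?_⟩
  rw [← Lp.tendsto_Lp_iff_tendsto_eLpNorm'' f hf F (Lp.memLp F)]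
  simpa using hF

theorem tendsto_cauchy_of_tendsto {f : ℕ → ℂ → ℂ} {F : ℂ → ℂ} (hf : ∀ n, MemLp (f n) 2 μ)
    (hF : MemLp F 2 μ) (h : Tendsto (fun n => eLpNorm (f n - F) 2 μ) atTop (𝓝 0)) :
    Tendsto (fun p : ℕ × ℕ => eLpNorm (f p.1 - f p.2) 2 μ) atTop (𝓝 0) := by
  have h1 : Tendsto (fun p : ℕ × ℕ => eLpNorm (f p.1 - F) 2 μ + eLpNorm (f p.2 - F) 2 μ)
      atTop (𝓝 0) := by
    rw [← prod_atTop_atTop_eq]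
    simpa using (h.comp tendsto_fst).add (h.comp tendsto_snd)
  refine tendsto_of_tendsto_of_tendsto_of_le_of_le tendsto_const_nhds h1 (fun _ => zero_le) ?_
  intro p
  have : f p.1 - f p.2 = (f p.1 - F) - (f p.2 - F) := by abel
  simp only [this]
  exact eLpNorm_sub_le ((hf _).sub hF).1 ((hf _).sub hF).1 (by norm_num)

/-- Dominated convergence in `L²` of a finite measure, with a constant as the bound. -/
theorem tendsto_eLpNorm_of_bounded [IsFiniteMeasure μ] {f : ℕ → ℂ → ℂ} {F : ℂ → ℂ} {C : ℝ}
    (hf : ∀ n, AEStronglyMeasurable (f n) μ) (hF : AEStronglyMeasurable F μ)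
    (hb : ∀ n, ∀ᵐ z ∂μ, ‖f n z - F z‖ ≤ C)
    (hlim : ∀ᵐ z ∂μ, Tendsto (fun n => f n z) atTop (𝓝 (F z))) :
    Tendsto (fun n => eLpNorm (f n - F) 2 μ) atTop (𝓝 0) := by
  have h1 : Tendsto (fun n => ∫⁻ z, ‖(f n - F) z‖ₑ ^ (2 : ℝ) ∂μ) atTop (𝓝 (∫⁻ _, 0 ∂μ)) := by
    refine tendsto_lintegral_of_dominated_convergence' (fun _ => ENNReal.ofReal C ^ (2 : ℝ))
      (fun n => (((hf n).sub hF).enorm).pow_const _) ?_ ?_ ?_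
    · intro n
      filter_upwards [hb n] with z hz
      refine ENNReal.rpow_le_rpow ?_ (by norm_num)
      rw [← ofReal_norm]
      exact ENNReal.ofReal_le_ofReal hz
    · rw [lintegral_const]
      exact ENNReal.mul_ne_top (by simp) (measure_ne_top μ _)
    · filter_upwards [hlim] with z hz
      have h2 : Tendsto (fun n => ‖f n z - F z‖ₑ) atTop (𝓝 0) := by
        have := (hz.sub_const (F z)).enorm
        simpa using this
      have := (ENNReal.continuous_rpow_const (y := 2)).tendsto 0 |>.comp h2
      simpa [Function.comp_def] using this
  have h3 := (ENNReal.continuous_rpow_const (y := 1 / 2)).tendsto _ |>.comp h1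
  simp only [lintegral_zero] at h3
  rw [ENNReal.zero_rpow_of_pos (by norm_num)] at h3
  refine h3.congr fun n => ?_
  rw [eLpNorm_eq_lintegral_rpow_enorm_toReal (by norm_num) (by norm_num)]
  simp

/-- The closure of the closure is the closure: a limit of limits is approached by a sequence of
the original approximants, simultaneously in three seminorms. The predicate `P` stands for any
property of the approximants that makes them and their derivatives `D₁`, `D₂` measurable. -/
theorem exists_diagonal {C : Set (ℂ → ℂ)} {D₁ D₂ : (ℂ → ℂ) → ℂ → ℂ} {φ : ℕ → ℂ → ℂ}
    {w g₁ g₂ : ℂ → ℂ} (P : (ℂ → ℂ) → Prop)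
    (hP : ∀ η, P η → AEStronglyMeasurable η μ ∧ AEStronglyMeasurable (D₁ η) μ ∧
      AEStronglyMeasurable (D₂ η) μ) (hC : ∀ η ∈ C, P η) (hφ : ∀ n, P (φ n))
    (hw : AEStronglyMeasurable w μ) (hg₁ : AEStronglyMeasurable g₁ μ)
    (hg₂ : AEStronglyMeasurable g₂ μ)
    (h0 : Tendsto (fun n => eLpNorm (φ n - w) 2 μ) atTop (𝓝 0))
    (h1 : Tendsto (fun n => eLpNorm (D₁ (φ n) - g₁) 2 μ) atTop (𝓝 0))
    (h2 : Tendsto (fun n => eLpNorm (D₂ (φ n) - g₂) 2 μ) atTop (𝓝 0))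
    (happ : ∀ n, ∃ η : ℕ → ℂ → ℂ, (∀ k, η k ∈ C) ∧
      Tendsto (fun k => eLpNorm (η k - φ n) 2 μ) atTop (𝓝 0) ∧
      Tendsto (fun k => eLpNorm (D₁ (η k) - D₁ (φ n)) 2 μ) atTop (𝓝 0) ∧
      Tendsto (fun k => eLpNorm (D₂ (η k) - D₂ (φ n)) 2 μ) atTop (𝓝 0)) :
    ∃ η : ℕ → ℂ → ℂ, (∀ k, η k ∈ C) ∧
      Tendsto (fun k => eLpNorm (η k - w) 2 μ) atTop (𝓝 0) ∧
      Tendsto (fun k => eLpNorm (D₁ (η k) - g₁) 2 μ) atTop (𝓝 0) ∧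
      Tendsto (fun k => eLpNorm (D₂ (η k) - g₂) 2 μ) atTop (𝓝 0) := by
  have key : ∀ n : ℕ, ∃ η ∈ C, eLpNorm (η - φ n) 2 μ < ((n : ENNReal) + 1)⁻¹ ∧
      eLpNorm (D₁ η - D₁ (φ n)) 2 μ < ((n : ENNReal) + 1)⁻¹ ∧
      eLpNorm (D₂ η - D₂ (φ n)) 2 μ < ((n : ENNReal) + 1)⁻¹ := by
    intro n
    obtain ⟨η, hη, e0, e1, e2⟩ := happ n
    have hpos : (0 : ENNReal) < ((n : ENNReal) + 1)⁻¹ := by simp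
    obtain ⟨k, k0, k1, k2⟩ := ((e0.eventually_lt_const hpos).and
      ((e1.eventually_lt_const hpos).and (e2.eventually_lt_const hpos))).exists
    exact ⟨η k, hη k, k0, k1, k2⟩
  choose η hη e0 e1 e2 using key
  have hinv : Tendsto (fun n : ℕ => ((n : ENNReal) + 1)⁻¹) atTop (𝓝 0) := by
    have := (tendsto_add_atTop_iff_nat 1).2 ENNReal.tendsto_inv_nat_nhds_zero
    simpa using this
  have aux : ∀ (u v : ℕ → ℂ → ℂ) (W : ℂ → ℂ), (∀ n, AEStronglyMeasurable (u n) μ) →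
      (∀ n, AEStronglyMeasurable (v n) μ) → AEStronglyMeasurable W μ →
      (∀ n, eLpNorm (u n - v n) 2 μ < ((n : ENNReal) + 1)⁻¹) →
      Tendsto (fun n => eLpNorm (v n - W) 2 μ) atTop (𝓝 0) →
      Tendsto (fun n => eLpNorm (u n - W) 2 μ) atTop (𝓝 0) := by
    intro u v W hu hv hW huv hvW
    have h3 : Tendsto (fun n : ℕ => ((n : ENNReal) + 1)⁻¹ + eLpNorm (v n - W) 2 μ) atTop
        (𝓝 0) := by simpa using hinv.add hvW
    refine tendsto_of_tendsto_of_tendsto_of_le_of_le tendsto_const_nhds h3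
      (fun _ => zero_le) fun n => ?_
    have : u n - W = (u n - v n) + (v n - W) := by abel
    simp only [this]
    exact (eLpNorm_add_le ((hu n).sub (hv n)) ((hv n).sub hW) (by norm_num)).trans
      (add_le_add_left (huv n).le _)
  refine ⟨η, hη, aux η φ w (fun n => (hP _ (hC _ (hη n))).1) (fun n => (hP _ (hφ n)).1) hw e0 h0,
    aux _ _ g₁ (fun n => (hP _ (hC _ (hη n))).2.1) (fun n => (hP _ (hφ n)).2.1) hg₁ e1 h1,
    aux _ _ g₂ (fun n => (hP _ (hC _ (hη n))).2.2) (fun n => (hP _ (hφ n)).2.2) hg₂ e2 h2⟩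

/-! ### Reflections of the plane -/

theorem sigma₂_eq_conj : sigma₂ = fun z => conj z := rfl

theorem sigma₁_eq_neg_conj : sigma₁ = fun z => -conj z := by
  funext z
  apply Complex.ext <;> simp [sigma₁]

@[simp] theorem sigma₁_re (z : ℂ) : (sigma₁ z).re = -z.re := rfl
@[simp] theorem sigma₁_im (z : ℂ) : (sigma₁ z).im = z.im := rfl
@[simp] theorem sigma₂_re (z : ℂ) : (sigma₂ z).re = z.re := rfl
@[simp] theorem sigma₂_im (z : ℂ) : (sigma₂ z).im = -z.im := rfl

@[simp] theorem sigma₁_sigma₁ (z : ℂ) : sigma₁ (sigma₁ z) = z := by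
  apply Complex.ext <;> simp

@[simp] theorem sigma₂_sigma₂ (z : ℂ) : sigma₂ (sigma₂ z) = z := by
  apply Complex.ext <;> simp

@[simp] theorem norm_sigma₁ (z : ℂ) : ‖sigma₁ z‖ = ‖z‖ := by
  simp [sigma₁_eq_neg_conj]

/-- The reflection `σ₁` as a linear isometry. -/
def sigma₁Isometry : ℂ ≃ₗᵢ[ℝ] ℂ := Complex.conjLIE.trans (LinearIsometryEquiv.neg ℝ)

/-- The reflection `σ₂` as a linear isometry. -/
def sigma₂Isometry : ℂ ≃ₗᵢ[ℝ] ℂ := Complex.conjLIE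

theorem coe_sigma₁Isometry : ⇑sigma₁Isometry = sigma₁ := by
  rw [sigma₁_eq_neg_conj]; rfl

theorem coe_sigma₂Isometry : ⇑sigma₂Isometry = sigma₂ := rfl

theorem contDiff_sigma₁ {n : WithTop ℕ∞} : ContDiff ℝ n sigma₁ := by
  rw [← coe_sigma₁Isometry]; exact sigma₁Isometry.contDiff

theorem contDiff_sigma₂ {n : WithTop ℕ∞} : ContDiff ℝ n sigma₂ := by
  rw [← coe_sigma₂Isometry]; exact sigma₂Isometry.contDiff

theorem measurePreserving_sigma₁ : MeasurePreserving sigma₁ volume volume := by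
  rw [← coe_sigma₁Isometry]; exact sigma₁Isometry.measurePreserving

theorem measurePreserving_sigma₂ : MeasurePreserving sigma₂ volume volume := by
  rw [← coe_sigma₂Isometry]; exact sigma₂Isometry.measurePreserving

theorem measurableEmbedding_sigma₁ : MeasurableEmbedding sigma₁ := by
  rw [← coe_sigma₁Isometry]
  exact sigma₁Isometry.toHomeomorph.measurableEmbedding

theorem measurableEmbedding_sigma₂ : MeasurableEmbedding sigma₂ := by
  rw [← coe_sigma₂Isometry]
  exact sigma₂Isometry.toHomeomorph.measurableEmbedding

theorem fderiv_comp_sigma₁ (f : ℂ → ℂ) (z v : ℂ) :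
    fderiv ℝ (f ∘ sigma₁) z v = fderiv ℝ f (sigma₁ z) (sigma₁ v) := by
  have h := sigma₁Isometry.toContinuousLinearEquiv.comp_right_fderiv (f := f) (x := z)
  have e : ⇑sigma₁Isometry.toContinuousLinearEquiv = sigma₁ := coe_sigma₁Isometry
  rw [e] at h
  rw [h, ContinuousLinearMap.comp_apply]
  exact congrArg _ (congrFun e v)

theorem fderiv_comp_sigma₂ (f : ℂ → ℂ) (z v : ℂ) :
    fderiv ℝ (f ∘ sigma₂) z v = fderiv ℝ f (sigma₂ z) (sigma₂ v) := by
  have h := sigma₂Isometry.toContinuousLinearEquiv.comp_right_fderiv (f := f) (x := z)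
  have e : ⇑sigma₂Isometry.toContinuousLinearEquiv = sigma₂ := coe_sigma₂Isometry
  rw [e] at h
  rw [h, ContinuousLinearMap.comp_apply]
  exact congrArg _ (congrFun e v)

theorem sigma₁_one : sigma₁ 1 = -1 := by apply Complex.ext <;> simp
theorem sigma₁_I : sigma₁ Complex.I = Complex.I := by apply Complex.ext <;> simp
theorem sigma₂_one : sigma₂ 1 = 1 := by apply Complex.ext <;> simp
theorem sigma₂_I : sigma₂ Complex.I = -Complex.I := by apply Complex.ext <;> simp

theorem partialX_comp_sigma₁ (f : ℂ → ℂ) (z : ℂ) :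
    partialX (f ∘ sigma₁) z = -partialX f (sigma₁ z) := by
  rw [partialX, fderiv_comp_sigma₁, sigma₁_one, map_neg, partialX]

theorem partialY_comp_sigma₁ (f : ℂ → ℂ) (z : ℂ) :
    partialY (f ∘ sigma₁) z = partialY f (sigma₁ z) := by
  rw [partialY, fderiv_comp_sigma₁, sigma₁_I, partialY]

theorem partialX_comp_sigma₂ (f : ℂ → ℂ) (z : ℂ) :
    partialX (f ∘ sigma₂) z = partialX f (sigma₂ z) := by
  rw [partialX, fderiv_comp_sigma₂, sigma₂_one, partialX]

theorem partialY_comp_sigma₂ (f : ℂ → ℂ) (z : ℂ) :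
    partialY (f ∘ sigma₂) z = -partialY f (sigma₂ z) := by
  rw [partialY, fderiv_comp_sigma₂, sigma₂_I, map_neg, partialY]

theorem partialX_congr {f g : ℂ → ℂ} {z : ℂ} (h : f =ᶠ[𝓝 z] g) : partialX f z = partialX g z := by
  rw [partialX, h.fderiv_eq, partialX]

theorem partialY_congr {f g : ℂ → ℂ} {z : ℂ} (h : f =ᶠ[𝓝 z] g) : partialY f z = partialY g z := by
  rw [partialY, h.fderiv_eq, partialY]

theorem magneticX_congr {f g : ℂ → ℂ} {z : ℂ} (h : f =ᶠ[𝓝 z] g) :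
    magneticX f z = magneticX g z := by
  rw [magneticX, partialX_congr h, h.eq_of_nhds, magneticX]

theorem magneticY_congr {f g : ℂ → ℂ} {z : ℂ} (h : f =ᶠ[𝓝 z] g) :
    magneticY f z = magneticY g z := by
  rw [magneticY, partialY_congr h, h.eq_of_nhds, magneticY]

theorem volume_im_eq_zero : volume {z : ℂ | z.im = 0} = 0 := by
  have h := Measure.addHaar_submodule (volume : Measure ℂ) (LinearMap.ker Complex.imLm) (by
    intro h
    have : Complex.I ∈ LinearMap.ker Complex.imLm := h ▸ Submodule.mem_top
    simp at this)
  exact h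

theorem ae_im_ne_zero : ∀ᵐ z : ℂ, z.im ≠ 0 := by
  rw [ae_iff]; simpa using volume_im_eq_zero

theorem ae_mem_slitPlane : ∀ᵐ z : ℂ, z ∈ Complex.slitPlane := by
  filter_upwards [ae_im_ne_zero] with z hz
  exact Or.inr hz

theorem sigma₂_mem_slitPlane {z : ℂ} (hz : z ∈ Complex.slitPlane) :
    sigma₂ z ∈ Complex.slitPlane := by
  rw [Complex.mem_slitPlane_iff] at hz ⊢
  simpa using hz

/-! ### The gauge transformation on the slit plane -/

/-- The multivalued square root `e^{iθ/2}` of `z / |z|`, with the branch `θ ∈ ]-π, π]`. -/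
def phase (z : ℂ) : ℂ := Complex.exp (Complex.I * z.arg / 2)

theorem gaugeUp_apply (u : ℂ → ℂ) (z : ℂ) : gaugeUp u z = phase z * u z := rfl

theorem norm_phase (z : ℂ) : ‖phase z‖ = 1 := by
  rw [phase, show Complex.I * (z.arg : ℂ) / 2 = ((z.arg / 2 : ℝ) : ℂ) * Complex.I by
    push_cast; ring]
  exact Complex.norm_exp_ofReal_mul_I _

theorem phase_ne_zero (z : ℂ) : phase z ≠ 0 := Complex.exp_ne_zero _

theorem conj_phase (z : ℂ) : conj (phase z) = (phase z)⁻¹ := by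
  rw [Complex.inv_def, Complex.normSq_eq_norm_sq, norm_phase]; simp

theorem phase_mul_conj (z : ℂ) : phase z * conj (phase z) = 1 := by
  rw [conj_phase, mul_inv_cancel₀ (phase_ne_zero z)]

theorem gaugeDown_apply (u : ℂ → ℂ) (z : ℂ) : gaugeDown u z = conj (phase z) * u z := by
  rw [gaugeDown, Complex.exp_neg, conj_phase, phase]

theorem phase_sq (z : ℂ) : phase z * phase z = Complex.exp (Complex.I * z.arg) := by
  rw [phase, ← Complex.exp_add]; congr 1; ring

theorem gaugeUp_gaugeDown (u : ℂ → ℂ) : gaugeUp (gaugeDown u) = u := by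
  funext z
  rw [gaugeUp_apply, gaugeDown_apply, ← mul_assoc, phase_mul_conj, one_mul]

theorem norm_gaugeUp (u : ℂ → ℂ) (z : ℂ) : ‖gaugeUp u z‖ = ‖u z‖ := by
  rw [gaugeUp_apply, norm_mul, norm_phase, one_mul]

theorem norm_gaugeDown (u : ℂ → ℂ) (z : ℂ) : ‖gaugeDown u z‖ = ‖u z‖ := by
  rw [gaugeDown_apply, norm_mul, RCLike.norm_conj, norm_phase, one_mul]

theorem gaugeUp_sub (u v : ℂ → ℂ) : gaugeUp (u - v) = gaugeUp u - gaugeUp v := by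
  funext z; simp [gaugeUp_apply, mul_sub]

theorem gaugeDown_sub (u v : ℂ → ℂ) : gaugeDown (u - v) = gaugeDown u - gaugeDown v := by
  funext z; simp [gaugeDown_apply, mul_sub]

theorem measurable_phase : Measurable phase := by
  unfold phase; fun_prop

theorem phase_sigma₂ {z : ℂ} (hz : z ∈ Complex.slitPlane) : phase (sigma₂ z) = conj (phase z) := by
  have h := Complex.mem_slitPlane_iff_arg.1 hz
  rw [sigma₂_eq_conj, phase, Complex.arg_conj, if_neg h.1, phase, ← Complex.exp_conj]
  simp [Complex.conj_ofNat]

theorem hasFDerivAt_phase {z : ℂ} (hz : z ∈ Complex.slitPlane) :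
    HasFDerivAt phase ((Complex.I / 2 * phase z) • (Complex.ofRealCLM ∘L Complex.imCLM ∘L
      ((ContinuousLinearMap.toSpanSingleton ℂ (z⁻¹)).restrictScalars ℝ))) z := by
  have h1 : HasFDerivAt Complex.log
      ((ContinuousLinearMap.toSpanSingleton ℂ (z⁻¹)).restrictScalars ℝ) z :=
    ((Complex.hasStrictDerivAt_log hz).hasDerivAt.hasFDerivAt).restrictScalars ℝ
  have h2 : HasFDerivAt (fun z : ℂ => ((Complex.log z).im : ℂ)) (Complex.ofRealCLM ∘L
      Complex.imCLM ∘L ((ContinuousLinearMap.toSpanSingleton ℂ (z⁻¹)).restrictScalars ℝ)) z :=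
    (Complex.ofRealCLM.hasFDerivAt).comp z ((Complex.imCLM.hasFDerivAt).comp z h1)
  have h3 := ((h2.const_mul (Complex.I / 2)).cexp)
  have e : phase = fun z => Complex.exp (Complex.I / 2 * ((Complex.log z).im : ℂ)) := by
    funext z; rw [phase, Complex.log_im]; congr 1; ring
  have h4 : (Complex.I / 2 * phase z) • (Complex.ofRealCLM ∘L Complex.imCLM ∘L
      ((ContinuousLinearMap.toSpanSingleton ℂ (z⁻¹)).restrictScalars ℝ)) =
      Complex.exp (Complex.I / 2 * ((Complex.log z).im : ℂ)) • (Complex.I / 2) •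
        (Complex.ofRealCLM ∘L Complex.imCLM ∘L
          ((ContinuousLinearMap.toSpanSingleton ℂ (z⁻¹)).restrictScalars ℝ)) := by
    rw [smul_smul, mul_comm, congrFun e z]
  rw [h4, e]
  exact h3

theorem contDiffOn_phase : ContDiffOn ℝ ∞ phase Complex.slitPlane := by
  intro z hz
  have h1 : ContDiffAt ℝ ∞ Complex.log z := (Complex.contDiffAt_log hz).restrict_scalars ℝ
  have e : phase = fun z => Complex.exp (Complex.I / 2 * ((Complex.log z).im : ℂ)) := by
    funext z; rw [phase, Complex.log_im]; congr 1; ring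
  rw [e]
  refine ContDiffAt.contDiffWithinAt ?_
  have h2 : ContDiffAt ℝ ∞ (fun z : ℂ => ((Complex.log z).im : ℂ)) z :=
    (Complex.ofRealCLM.contDiff.contDiffAt).comp z ((Complex.imCLM.contDiff.contDiffAt).comp z h1)
  exact (contDiffAt_const.mul h2).cexp

theorem partialX_phase {z : ℂ} (hz : z ∈ Complex.slitPlane) :
    partialX phase z = Complex.I * potential₁ z * phase z := by
  rw [partialX, (hasFDerivAt_phase hz).fderiv]
  simp [potential₁, Complex.inv_im, Complex.normSq_eq_norm_sq]
  ring

theorem partialY_phase {z : ℂ} (hz : z ∈ Complex.slitPlane) :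
    partialY phase z = Complex.I * potential₂ z * phase z := by
  rw [partialY, (hasFDerivAt_phase hz).fderiv]
  simp [potential₂, Complex.inv_re, Complex.normSq_eq_norm_sq]
  ring

theorem partialX_mul {f g : ℂ → ℂ} {z : ℂ} (hf : DifferentiableAt ℝ f z)
    (hg : DifferentiableAt ℝ g z) :
    partialX (fun z => f z * g z) z = partialX f z * g z + f z * partialX g z := by
  rw [partialX, fderiv_fun_mul hf hg]; simp [partialX]; ring

theorem partialY_mul {f g : ℂ → ℂ} {z : ℂ} (hf : DifferentiableAt ℝ f z)
    (hg : DifferentiableAt ℝ g z) :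
    partialY (fun z => f z * g z) z = partialY f z * g z + f z * partialY g z := by
  rw [partialY, fderiv_fun_mul hf hg]; simp [partialY]; ring

/-- Off the slit, the magnetic potential is removed by the gauge transformation. -/
theorem magneticX_gaugeUp {f : ℂ → ℂ} {z : ℂ} (hz : z ∈ Complex.slitPlane)
    (hf : DifferentiableAt ℝ f z) :
    magneticX (gaugeUp f) z = -Complex.I * phase z * partialX f z := by
  have h := partialX_mul (hasFDerivAt_phase hz).differentiableAt hf
  have e : gaugeUp f = fun z => phase z * f z := rfl
  rw [magneticX, e, h, partialX_phase hz]
  linear_combination (-(potential₁ z : ℂ) * phase z * f z) * Complex.I_mul_I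

theorem magneticY_gaugeUp {f : ℂ → ℂ} {z : ℂ} (hz : z ∈ Complex.slitPlane)
    (hf : DifferentiableAt ℝ f z) :
    magneticY (gaugeUp f) z = -Complex.I * phase z * partialY f z := by
  have h := partialY_mul (hasFDerivAt_phase hz).differentiableAt hf
  have e : gaugeUp f = fun z => phase z * f z := rfl
  rw [magneticY, e, h, partialY_phase hz]
  linear_combination (-(potential₂ z : ℂ) * phase z * f z) * Complex.I_mul_I

theorem differentiableAt_gaugeDown {φ : ℂ → ℂ} {z : ℂ} (hz : z ∈ Complex.slitPlane)
    (hφ : DifferentiableAt ℝ φ z) : DifferentiableAt ℝ (gaugeDown φ) z := by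
  have e : gaugeDown φ = fun z => conj (phase z) * φ z := funext (gaugeDown_apply φ)
  rw [e]
  have h1 : DifferentiableAt ℝ (fun z => conj (phase z)) z :=
    (Complex.conjCLE.differentiableAt).comp z (hasFDerivAt_phase hz).differentiableAt
  exact h1.mul hφ

theorem partialX_gaugeDown {φ : ℂ → ℂ} {z : ℂ} (hz : z ∈ Complex.slitPlane)
    (hφ : DifferentiableAt ℝ φ z) :
    partialX (gaugeDown φ) z = Complex.I * conj (phase z) * magneticX φ z := by
  have h := magneticX_gaugeUp hz (differentiableAt_gaugeDown hz hφ)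
  rw [gaugeUp_gaugeDown] at h
  rw [h]
  linear_combination (-partialX (gaugeDown φ) z) * phase_mul_conj z +
    (phase z * conj (phase z) * partialX (gaugeDown φ) z) * Complex.I_mul_I

theorem partialY_gaugeDown {φ : ℂ → ℂ} {z : ℂ} (hz : z ∈ Complex.slitPlane)
    (hφ : DifferentiableAt ℝ φ z) :
    partialY (gaugeDown φ) z = Complex.I * conj (phase z) * magneticY φ z := by
  have h := magneticY_gaugeUp hz (differentiableAt_gaugeDown hz hφ)
  rw [gaugeUp_gaugeDown] at h
  rw [h]
  linear_combination (-partialY (gaugeDown φ) z) * phase_mul_conj z +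
    (phase z * conj (phase z) * partialY (gaugeDown φ) z) * Complex.I_mul_I

/-! ### The linear reflection `S = K Σ₂ᶜ` -/

/-- `S u = e^{iθ} (u ∘ σ₂)`, the composition of the antilinear operators `K` and `Σ₂ᶜ`. In the
gauge `e^{-iθ/2} u` it is the reflection with respect to the axis `y = 0`. -/
def twistedReflection (u : ℂ → ℂ) (z : ℂ) : ℂ := Complex.exp (Complex.I * z.arg) * u (sigma₂ z)

theorem norm_twistedReflection (u : ℂ → ℂ) (z : ℂ) : ‖twistedReflection u z‖ = ‖u (sigma₂ z)‖ := by
  rw [twistedReflection, ← phase_sq]; simp [norm_phase]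

theorem twistedReflection_twistedReflection (u : ℂ → ℂ) :
    twistedReflection (twistedReflection u) = u := by
  funext z
  rw [twistedReflection, twistedReflection, sigma₂_sigma₂, ← mul_assoc, ← Complex.exp_add,
    sigma₂_eq_conj, Complex.arg_conj]
  split_ifs with h
  · rw [h, show Complex.I * (Real.pi : ℂ) + Complex.I * Real.pi = 2 * Real.pi * Complex.I by ring,
      Complex.exp_two_pi_mul_I, one_mul]
  · simp

theorem twistedReflection_add (u v : ℂ → ℂ) :
    twistedReflection (u + v) = twistedReflection u + twistedReflection v := by
  funext z; simp [twistedReflection, mul_add]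

theorem twistedReflection_sub (u v : ℂ → ℂ) :
    twistedReflection (u - v) = twistedReflection u - twistedReflection v := by
  funext z; simp [twistedReflection, mul_sub]

theorem twistedReflection_const_mul (c : ℂ) (u : ℂ → ℂ) :
    twistedReflection (fun z => c * u z) = fun z => c * twistedReflection u z := by
  funext z; simp [twistedReflection]; ring

theorem twistedReflection_neg (u : ℂ → ℂ) :
    twistedReflection (-u) = -twistedReflection u := by
  funext z; simp [twistedReflection]

theorem twistedReflection_gaugeUp (u : ℂ → ℂ) {z : ℂ} (hz : z ∈ Complex.slitPlane) :
    twistedReflection (gaugeUp u) z = gaugeUp (u ∘ sigma₂) z := by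
  rw [gaugeUp_apply, Function.comp, twistedReflection, ← phase_sq, gaugeUp_apply, phase_sigma₂ hz]
  linear_combination (phase z * u (sigma₂ z)) * phase_mul_conj z

theorem eventually_mem_slitPlane {z : ℂ} (hz : z ∈ Complex.slitPlane) :
    ∀ᶠ z' in 𝓝 z, z' ∈ Complex.slitPlane := Complex.isOpen_slitPlane.mem_nhds hz

theorem twistedReflection_eventuallyEq (u : ℂ → ℂ) {z : ℂ} (hz : z ∈ Complex.slitPlane) :
    twistedReflection u =ᶠ[𝓝 z] gaugeUp (gaugeDown u ∘ sigma₂) := by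
  filter_upwards [eventually_mem_slitPlane hz] with z' hz'
  rw [← twistedReflection_gaugeUp _ hz', gaugeUp_gaugeDown]

theorem magneticX_twistedReflection {φ : ℂ → ℂ} {z : ℂ} (hz : z ∈ Complex.slitPlane)
    (hφ : DifferentiableAt ℝ φ (sigma₂ z)) :
    magneticX (twistedReflection φ) z = twistedReflection (magneticX φ) z := by
  have h1 := differentiableAt_gaugeDown (sigma₂_mem_slitPlane hz) hφ
  rw [magneticX_congr (twistedReflection_eventuallyEq φ hz), magneticX_gaugeUp hz
    (h1.comp z (contDiff_sigma₂.differentiable one_ne_zero z)),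
    partialX_comp_sigma₂, partialX_gaugeDown (sigma₂_mem_slitPlane hz) hφ, phase_sigma₂ hz,
    twistedReflection, ← phase_sq, Complex.conj_conj]
  linear_combination (-phase z * phase z * magneticX φ (sigma₂ z)) * Complex.I_mul_I

theorem magneticY_twistedReflection {φ : ℂ → ℂ} {z : ℂ} (hz : z ∈ Complex.slitPlane)
    (hφ : DifferentiableAt ℝ φ (sigma₂ z)) :
    magneticY (twistedReflection φ) z = -twistedReflection (magneticY φ) z := by
  have h1 := differentiableAt_gaugeDown (sigma₂_mem_slitPlane hz) hφ
  rw [magneticY_congr (twistedReflection_eventuallyEq φ hz), magneticY_gaugeUp hz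
    (h1.comp z (contDiff_sigma₂.differentiable one_ne_zero z)),
    partialY_comp_sigma₂, partialY_gaugeDown (sigma₂_mem_slitPlane hz) hφ, phase_sigma₂ hz,
    twistedReflection, ← phase_sq, Complex.conj_conj]
  linear_combination (phase z * phase z * magneticY φ (sigma₂ z)) * Complex.I_mul_I

/-! ### The antilinear reflection `Σ₁ᶜ` -/

/-- `Σ₁ᶜ u = conj (u ∘ σ₁)`. -/
def conjReflection (u : ℂ → ℂ) (z : ℂ) : ℂ := conj (u (sigma₁ z))

theorem conjReflection_conjReflection (u : ℂ → ℂ) : conjReflection (conjReflection u) = u := by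
  funext z; simp [conjReflection]

theorem conjReflection_sub (u v : ℂ → ℂ) :
    conjReflection (u - v) = conjReflection u - conjReflection v := by
  funext z; simp [conjReflection]

theorem fderiv_conj_comp (f : ℂ → ℂ) (z v : ℂ) :
    fderiv ℝ (fun z => conj (f z)) z v = conj (fderiv ℝ f z v) := by
  have h := Complex.conjCLE.comp_fderiv (f := f) (x := z)
  have e : (⇑Complex.conjCLE ∘ f) = fun z => conj (f z) := rfl
  rw [e] at h
  rw [h]; rfl

theorem magneticX_conjReflection (φ : ℂ → ℂ) (z : ℂ) :
    magneticX (conjReflection φ) z = conjReflection (magneticX φ) z := by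
  have h : partialX (conjReflection φ) z = -conj (partialX φ (sigma₁ z)) := by
    have := fderiv_conj_comp (φ ∘ sigma₁) z 1
    rw [partialX, show conjReflection φ = fun z => conj ((φ ∘ sigma₁) z) from rfl, this]
    have := partialX_comp_sigma₁ φ z
    rw [partialX] at this
    rw [this, map_neg]
  simp [magneticX, conjReflection, h, potential₁, Complex.conj_ofNat]

theorem magneticY_conjReflection (φ : ℂ → ℂ) (z : ℂ) :
    magneticY (conjReflection φ) z = -conjReflection (magneticY φ) z := by
  have h : partialY (conjReflection φ) z = conj (partialY φ (sigma₁ z)) := by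
    have := fderiv_conj_comp (φ ∘ sigma₁) z Complex.I
    rw [partialY, show conjReflection φ = fun z => conj ((φ ∘ sigma₁) z) from rfl, this]
    have := partialY_comp_sigma₁ φ z
    rw [partialY] at this
    rw [this]
  simp [magneticY, conjReflection, h, potential₂, Complex.conj_ofNat]
  ring

/-! ### Test functions -/

section TestFunctions

variable {W W' : Set ℂ} {φ ψ a : ℂ → ℂ}

theorem testFunctions_mono (h : W ⊆ W') (hφ : φ ∈ testFunctions W) : φ ∈ testFunctions W' :=
  ⟨hφ.1, hφ.2.1, hφ.2.2.trans h⟩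

theorem eq_zero_of_mem_testFunctions (hφ : φ ∈ testFunctions W) {z : ℂ} (hz : z ∉ W) : φ z = 0 :=
  image_eq_zero_of_notMem_tsupport fun h => hz (hφ.2.2 h)

theorem differentiable_of_mem (hφ : φ ∈ testFunctions W) : Differentiable ℝ φ :=
  hφ.1.differentiable (by simp)

theorem memLp_of_mem (hφ : φ ∈ testFunctions W) (s : Set ℂ) :
    MemLp φ 2 (volume.restrict s) :=
  (hφ.1.continuous.memLp_of_hasCompactSupport hφ.2.1).restrict s

theorem mul_mem_testFunctions (hW : IsOpen W) (ha : ContDiffOn ℝ ∞ a W)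
    (hφ : φ ∈ testFunctions W) : (fun z => a z * φ z) ∈ testFunctions W := by
  have hs : tsupport (fun z => a z * φ z) ⊆ tsupport φ := tsupport_mul_subset_right
  refine ⟨contDiff_iff_contDiffAt.2 fun z => ?_, hφ.2.1.mul_left, hs.trans hφ.2.2⟩
  by_cases hz : z ∈ tsupport φ
  · exact ((ha.contDiffAt (hW.mem_nhds (hφ.2.2 hz))).mul hφ.1.contDiffAt)
  · have h0 : (fun z => a z * φ z) =ᶠ[𝓝 z] fun _ => 0 := by
      filter_upwards [notMem_tsupport_iff_eventuallyEq.1 hz] with z' hz'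
      simp [hz']
    exact contDiffAt_const.congr_of_eventuallyEq h0

theorem add_mem_testFunctions (hφ : φ ∈ testFunctions W) (hψ : ψ ∈ testFunctions W) :
    φ + ψ ∈ testFunctions W :=
  ⟨hφ.1.add hψ.1, hφ.2.1.add hψ.2.1,
    (tsupport_add φ ψ).trans (Set.union_subset hφ.2.2 hψ.2.2)⟩

theorem const_mul_mem_testFunctions (c : ℂ) (hφ : φ ∈ testFunctions W) :
    (fun z => c * φ z) ∈ testFunctions W :=
  ⟨contDiff_const.mul hφ.1, hφ.2.1.mul_left, tsupport_mul_subset_right.trans hφ.2.2⟩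

theorem sub_mem_testFunctions (hφ : φ ∈ testFunctions W) (hψ : ψ ∈ testFunctions W) :
    φ - ψ ∈ testFunctions W := by
  have := add_mem_testFunctions hφ (const_mul_mem_testFunctions (-1) hψ)
  convert this using 1
  funext z; simp [sub_eq_add_neg]

theorem fderiv_apply_mem_testFunctions (v : ℂ) (hφ : φ ∈ testFunctions W) :
    (fun z => fderiv ℝ φ z v) ∈ testFunctions W := by
  have hs : tsupport (fun z => fderiv ℝ φ z v) ⊆ tsupport φ := tsupport_fderiv_apply_subset ℝ v
  refine ⟨(hφ.1.fderiv_right (m := ∞) (by simp)).clm_apply contDiff_const, ?_, hs.trans hφ.2.2⟩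
  exact hφ.2.1.of_isClosed_subset (isClosed_tsupport _) hs

theorem partialX_mem_testFunctions (hφ : φ ∈ testFunctions W) :
    partialX φ ∈ testFunctions W := fderiv_apply_mem_testFunctions 1 hφ

theorem partialY_mem_testFunctions (hφ : φ ∈ testFunctions W) :
    partialY φ ∈ testFunctions W := fderiv_apply_mem_testFunctions Complex.I hφ

theorem contDiffOn_potential₁ : ContDiffOn ℝ ∞ (fun z => (potential₁ z : ℂ)) {0}ᶜ := by
  intro z hz
  have h1 : ContDiffAt ℝ ∞ potential₁ z := by
    have h2 : ContDiffAt ℝ ∞ (fun z : ℂ => z.im) z := Complex.imCLM.contDiff.contDiffAt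
    exact contDiffAt_const.mul (h2.neg.div ((contDiff_norm_sq ℝ).contDiffAt)
      (by simpa using hz))
  exact (Complex.ofRealCLM.contDiff.contDiffAt.comp z h1).contDiffWithinAt

theorem contDiffOn_potential₂ : ContDiffOn ℝ ∞ (fun z => (potential₂ z : ℂ)) {0}ᶜ := by
  intro z hz
  have h1 : ContDiffAt ℝ ∞ potential₂ z := by
    have h2 : ContDiffAt ℝ ∞ (fun z : ℂ => z.re) z := Complex.reCLM.contDiff.contDiffAt
    exact contDiffAt_const.mul (h2.div ((contDiff_norm_sq ℝ).contDiffAt)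
      (by simpa using hz))
  exact (Complex.ofRealCLM.contDiff.contDiffAt.comp z h1).contDiffWithinAt

theorem contDiffOn_exp_arg :
    ContDiffOn ℝ ∞ (fun z : ℂ => Complex.exp (Complex.I * z.arg)) {0}ᶜ := by
  have h : ContDiffOn ℝ ∞ (fun z : ℂ => z * ((‖z‖⁻¹ : ℝ) : ℂ)) {0}ᶜ := by
    intro z hz
    have h1 : ContDiffAt ℝ ∞ (fun z : ℂ => ‖z‖⁻¹) z := (contDiffAt_norm ℝ hz).inv (by simpa using hz)
    exact (contDiffAt_id.mul
      (Complex.ofRealCLM.contDiff.contDiffAt.comp z h1)).contDiffWithinAt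
  refine h.congr fun z hz => ?_
  have h2 : (‖z‖ : ℂ) ≠ 0 := by simpa using hz
  have h3 := Complex.norm_mul_exp_arg_mul_I z
  rw [mul_comm Complex.I]
  push_cast
  rw [eq_mul_inv_iff_mul_eq₀ h2, mul_comm, h3]

theorem magneticX_mem_testFunctions (hW : IsOpen W) (h0 : (0 : ℂ) ∉ W)
    (hφ : φ ∈ testFunctions W) : magneticX φ ∈ testFunctions W :=
  sub_mem_testFunctions (const_mul_mem_testFunctions _ (partialX_mem_testFunctions hφ))
    (mul_mem_testFunctions hW (contDiffOn_potential₁.mono fun _ hz h => h0 (h ▸ hz)) hφ)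

theorem magneticY_mem_testFunctions (hW : IsOpen W) (h0 : (0 : ℂ) ∉ W)
    (hφ : φ ∈ testFunctions W) : magneticY φ ∈ testFunctions W :=
  sub_mem_testFunctions (const_mul_mem_testFunctions _ (partialY_mem_testFunctions hφ))
    (mul_mem_testFunctions hW (contDiffOn_potential₂.mono fun _ hz h => h0 (h ▸ hz)) hφ)

theorem magneticLaplacian_mem_testFunctions (hW : IsOpen W) (h0 : (0 : ℂ) ∉ W)
    (hφ : φ ∈ testFunctions W) : magneticLaplacian φ ∈ testFunctions W :=
  add_mem_testFunctions
    (magneticX_mem_testFunctions hW h0 (magneticX_mem_testFunctions hW h0 hφ))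
    (magneticY_mem_testFunctions hW h0 (magneticY_mem_testFunctions hW h0 hφ))

theorem comp_sigma₂_mem_testFunctions (hW : ∀ z ∈ W, sigma₂ z ∈ W) (hφ : φ ∈ testFunctions W) :
    φ ∘ sigma₂ ∈ testFunctions W := by
  refine ⟨hφ.1.comp contDiff_sigma₂, hφ.2.1.comp_homeomorph sigma₂Isometry.toHomeomorph, ?_⟩
  have h := tsupport_comp_subset_preimage φ (f := sigma₂) sigma₂Isometry.continuous
  intro z hz
  have := hW _ (hφ.2.2 (h hz))
  rwa [sigma₂_sigma₂] at this

theorem conjReflection_mem_testFunctions (hW : ∀ z ∈ W, sigma₁ z ∈ W)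
    (hφ : φ ∈ testFunctions W) : conjReflection φ ∈ testFunctions W := by
  have hc : Continuous sigma₁ := contDiff_sigma₁.continuous (n := 0)
  have h1 : ContDiff ℝ ∞ (φ ∘ sigma₁) := hφ.1.comp contDiff_sigma₁
  have h2 : HasCompactSupport (φ ∘ sigma₁) := by
    rw [← coe_sigma₁Isometry]
    exact hφ.2.1.comp_homeomorph sigma₁Isometry.toHomeomorph
  have h3 : tsupport (conjReflection φ) ⊆ tsupport (φ ∘ sigma₁) :=
    closure_mono fun z hz h => hz (by
      have h' : φ (sigma₁ z) = 0 := h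
      simp [conjReflection, h'])
  refine ⟨Complex.conjCLE.contDiff.comp h1, h2.mono' (subset_closure.trans h3), h3.trans ?_⟩
  intro z hz
  have := hW _ (hφ.2.2 (tsupport_comp_subset_preimage φ hc hz))
  rwa [sigma₁_sigma₁] at this

theorem twistedReflection_mem_testFunctions (hW : IsOpen W) (h0 : (0 : ℂ) ∉ W)
    (hW₂ : ∀ z ∈ W, sigma₂ z ∈ W) (hφ : φ ∈ testFunctions W) :
    twistedReflection φ ∈ testFunctions W :=
  mul_mem_testFunctions hW (contDiffOn_exp_arg.mono fun _ hz h => h0 (h ▸ hz))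
    (comp_sigma₂_mem_testFunctions hW₂ hφ)

theorem gaugeUp_mem_testFunctions (hW : IsOpen W) (hs : W ⊆ Complex.slitPlane)
    (hφ : φ ∈ testFunctions W) : gaugeUp φ ∈ testFunctions W :=
  mul_mem_testFunctions hW (contDiffOn_phase.mono hs) hφ

theorem partialX_sub (hφ : Differentiable ℝ φ) (hψ : Differentiable ℝ ψ) :
    partialX (φ - ψ) = partialX φ - partialX ψ := by
  funext z; simp [partialX, fderiv_sub (hφ z) (hψ z)]

theorem partialY_sub (hφ : Differentiable ℝ φ) (hψ : Differentiable ℝ ψ) :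
    partialY (φ - ψ) = partialY φ - partialY ψ := by
  funext z; simp [partialY, fderiv_sub (hφ z) (hψ z)]

theorem magneticX_sub (hφ : Differentiable ℝ φ) (hψ : Differentiable ℝ ψ) :
    magneticX (φ - ψ) = magneticX φ - magneticX ψ := by
  funext z; simp [magneticX, partialX_sub hφ hψ]; ring

theorem magneticY_sub (hφ : Differentiable ℝ φ) (hψ : Differentiable ℝ ψ) :
    magneticY (φ - ψ) = magneticY φ - magneticY ψ := by
  funext z; simp [magneticY, partialY_sub hφ hψ]; ring

theorem magneticX_add (hφ : Differentiable ℝ φ) (hψ : Differentiable ℝ ψ) :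
    magneticX (φ + ψ) = magneticX φ + magneticX ψ := by
  funext z; simp [magneticX, partialX, fderiv_add (hφ z) (hψ z)]; ring

theorem magneticY_add (hφ : Differentiable ℝ φ) (hψ : Differentiable ℝ ψ) :
    magneticY (φ + ψ) = magneticY φ + magneticY ψ := by
  funext z; simp [magneticY, partialY, fderiv_add (hφ z) (hψ z)]; ring

theorem magneticX_const_mul (c : ℂ) (hφ : Differentiable ℝ φ) :
    magneticX (fun z => c * φ z) = fun z => c * magneticX φ z := by
  funext z; simp [magneticX, partialX, fderiv_const_mul (hφ z)]; ring

theorem magneticY_const_mul (c : ℂ) (hφ : Differentiable ℝ φ) :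
    magneticY (fun z => c * φ z) = fun z => c * magneticY φ z := by
  funext z; simp [magneticY, partialY, fderiv_const_mul (hφ z)]; ring

/-! ### Integration by parts -/

theorem integral_fderiv_mul_conj (v : ℂ) (hφ : φ ∈ testFunctions W) (hψ : ψ ∈ testFunctions W) :
    ∫ z, fderiv ℝ φ z v * conj (ψ z) = -∫ z, φ z * conj (fderiv ℝ ψ z v) := by
  have hc : ∀ {f g : ℂ → ℂ}, f ∈ testFunctions W → g ∈ testFunctions W →
      Integrable (fun z => f z * conj (g z)) := by
    intro f g hf hg
    have := integrable_mul_conj (memLp_of_mem hf Set.univ) (memLp_of_mem hg Set.univ)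
    simpa using this
  have hd : Differentiable ℝ fun z => conj (ψ z) :=
    Complex.conjCLE.differentiable.comp (differentiable_of_mem hψ)
  have h := integral_mul_fderiv_eq_neg_fderiv_mul_of_integrable (μ := volume) (f := φ)
    (g := fun z => conj (ψ z)) (v := v)
    (hc (fderiv_apply_mem_testFunctions v hφ) hψ)
    (by simpa only [fderiv_conj_comp] using hc hφ (fderiv_apply_mem_testFunctions v hψ))
    (hc hφ hψ) (fun z _ => differentiable_of_mem hφ z) (fun z _ => hd z)
  simp only [fderiv_conj_comp] at h
  rw [h, neg_neg]

theorem l2inner_restrict (hφ : φ ∈ testFunctions W) (ψ : ℂ → ℂ) :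
    l2inner (volume.restrict W) φ ψ = l2inner volume φ ψ :=
  setIntegral_eq_integral_of_forall_compl_eq_zero fun z hz => by
    rw [eq_zero_of_mem_testFunctions hφ hz, zero_mul]

/-- `-i ∂_v - A` is symmetric on test functions, for a real potential `A`. -/
theorem l2inner_covariant (hW : IsOpen W) (v : ℂ) {A : ℂ → ℝ}
    (hA : ContDiffOn ℝ ∞ (fun z => (A z : ℂ)) W)
    (hφ : φ ∈ testFunctions W) (hψ : ψ ∈ testFunctions W) :
    l2inner (volume.restrict W) (fun z => -Complex.I * fderiv ℝ φ z v - A z * φ z) ψ =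
      l2inner (volume.restrict W) φ (fun z => -Complex.I * fderiv ℝ ψ z v - A z * ψ z) := by
  have hi : ∀ {f g : ℂ → ℂ}, f ∈ testFunctions W → g ∈ testFunctions W →
      Integrable (fun z => f z * conj (g z)) := by
    intro f g hf hg
    simpa using integrable_mul_conj (memLp_of_mem hf Set.univ) (memLp_of_mem hg Set.univ)
  have hD : ∀ {f : ℂ → ℂ}, f ∈ testFunctions W →
      (fun z => -Complex.I * fderiv ℝ f z v) ∈ testFunctions W := fun hf =>
    const_mul_mem_testFunctions _ (fderiv_apply_mem_testFunctions v hf)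
  have hP : ∀ {f : ℂ → ℂ}, f ∈ testFunctions W → (fun z => (A z : ℂ) * f z) ∈ testFunctions W :=
    fun hf => mul_mem_testFunctions hW hA hf
  have hDP : (fun z => -Complex.I * fderiv ℝ φ z v - A z * φ z) ∈ testFunctions W :=
    sub_mem_testFunctions (hD hφ) (hP hφ)
  rw [l2inner_restrict hDP, l2inner_restrict hφ]
  unfold l2inner
  simp only [map_sub, sub_mul, mul_sub]
  rw [integral_sub (hi (hD hφ) hψ) (hi (hP hφ) hψ), integral_sub (hi hφ (hD hψ)) (hi hφ (hP hψ))]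
  congr 1
  · have := integral_fderiv_mul_conj v hφ hψ
    simp only [map_mul, map_neg, Complex.conj_I, neg_neg, mul_assoc, integral_const_mul, this]
    rw [neg_mul_neg, ← integral_const_mul]
    refine integral_congr_ae (.of_forall fun z => ?_)
    simp only
    ring
  · refine integral_congr_ae (.of_forall fun z => ?_)
    simp only [map_mul, Complex.conj_ofReal]
    ring

/-- The quadratic form of `-Δ_A`. -/
theorem l2inner_magneticLaplacian (hW : IsOpen W) (h0 : (0 : ℂ) ∉ W)
    (hφ : φ ∈ testFunctions W) (hψ : ψ ∈ testFunctions W) :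
    l2inner (volume.restrict W) (magneticLaplacian φ) ψ =
      l2inner (volume.restrict W) (magneticX φ) (magneticX ψ) +
      l2inner (volume.restrict W) (magneticY φ) (magneticY ψ) := by
  have hX := magneticX_mem_testFunctions hW h0 hφ
  have hY := magneticY_mem_testFunctions hW h0 hφ
  have e : magneticLaplacian φ = magneticX (magneticX φ) + magneticY (magneticY φ) := rfl
  have hs : W ⊆ {0}ᶜ := fun _ hz h => h0 (h ▸ hz)
  rw [e, l2inner_add_left (memLp_of_mem (magneticX_mem_testFunctions hW h0 hX) _)
    (memLp_of_mem (magneticY_mem_testFunctions hW h0 hY) _) (memLp_of_mem hψ _)]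
  congr 1
  · exact l2inner_covariant hW 1 (contDiffOn_potential₁.mono hs) hX hψ
  · exact l2inner_covariant hW Complex.I (contDiffOn_potential₂.mono hs) hY hψ

theorem l2inner_magneticLaplacian_right (hW : IsOpen W) (h0 : (0 : ℂ) ∉ W)
    (hφ : φ ∈ testFunctions W) (hψ : ψ ∈ testFunctions W) :
    l2inner (volume.restrict W) φ (magneticLaplacian ψ) =
      l2inner (volume.restrict W) (magneticX φ) (magneticX ψ) +
      l2inner (volume.restrict W) (magneticY φ) (magneticY ψ) := by
  rw [← conj_l2inner, l2inner_magneticLaplacian hW h0 hψ hφ, map_add, conj_l2inner, conj_l2inner]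

end TestFunctions

/-! ### The magnetic form domain -/

section FormDomain

variable {W : Set ℂ} {u : ℂ → ℂ}

theorem l2inner_magneticLaplacian_sub {φ ψ : ℂ → ℂ} (hW : IsOpen W) (h0 : (0 : ℂ) ∉ W)
    (hφ : φ ∈ testFunctions W) (hψ : ψ ∈ testFunctions W) :
    l2inner (volume.restrict W) (magneticLaplacian (φ - ψ)) (φ - ψ) =
      (((eLpNorm (magneticX φ - magneticX ψ) 2 (volume.restrict W)).toReal ^ 2 +
        (eLpNorm (magneticY φ - magneticY ψ) 2 (volume.restrict W)).toReal ^ 2 : ℝ) : ℂ) := by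
  have hX := fun {f : ℂ → ℂ} (hf : f ∈ testFunctions W) =>
    memLp_of_mem (magneticX_mem_testFunctions hW h0 hf) W
  have hY := fun {f : ℂ → ℂ} (hf : f ∈ testFunctions W) =>
    memLp_of_mem (magneticY_mem_testFunctions hW h0 hf) W
  have hs := sub_mem_testFunctions hφ hψ
  rw [l2inner_magneticLaplacian hW h0 hs hs,
    magneticX_sub (differentiable_of_mem hφ) (differentiable_of_mem hψ),
    magneticY_sub (differentiable_of_mem hφ) (differentiable_of_mem hψ),
    l2inner_self ((hX hφ).sub (hX hψ)), l2inner_self ((hY hφ).sub (hY hψ)), ← Complex.ofReal_add]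

/-- A member of the form domain has a weak magnetic gradient in `L²`, the limit of the magnetic
gradients of its approximants. -/
theorem InFormDomain.exists_gradient (hW : IsOpen W) (h0 : (0 : ℂ) ∉ W)
    (hu : InFormDomain (volume.restrict W) (testFunctions W) magneticLaplacian u) :
    ∃ (φ : ℕ → ℂ → ℂ) (G₁ G₂ : ℂ → ℂ), (∀ n, φ n ∈ testFunctions W) ∧
      MemLp G₁ 2 (volume.restrict W) ∧ MemLp G₂ 2 (volume.restrict W) ∧
      Tendsto (fun n => eLpNorm (φ n - u) 2 (volume.restrict W)) atTop (𝓝 0) ∧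
      Tendsto (fun n => eLpNorm (magneticX (φ n) - G₁) 2 (volume.restrict W)) atTop (𝓝 0) ∧
      Tendsto (fun n => eLpNorm (magneticY (φ n) - G₂) 2 (volume.restrict W)) atTop (𝓝 0) := by
  obtain ⟨-, φ, hφ, hlim, hc⟩ := hu
  have hX := fun n => memLp_of_mem (magneticX_mem_testFunctions hW h0 (hφ n)) W
  have hY := fun n => memLp_of_mem (magneticY_mem_testFunctions hW h0 (hφ n)) W
  have hc' := hc.norm
  simp only [fun p : ℕ × ℕ => l2inner_magneticLaplacian_sub hW h0 (hφ p.1) (hφ p.2),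
    Complex.norm_real, norm_zero] at hc'
  simp only [fun x y : ℝ => Real.norm_of_nonneg (add_nonneg (sq_nonneg x) (sq_nonneg y))] at hc'
  have aux : ∀ {N : ℕ × ℕ → ENNReal} {r : ℕ × ℕ → ℝ}, (∀ p, N p ≠ ⊤) →
      (∀ p, (N p).toReal ^ 2 ≤ r p) → Tendsto r atTop (𝓝 0) → Tendsto N atTop (𝓝 0) := by
    intro N r hN hr h
    have h1 : Tendsto (fun p => (N p).toReal ^ 2) atTop (𝓝 0) :=
      squeeze_zero (fun p => by positivity) hr h
    have h2 := h1.sqrt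
    simp only [Real.sqrt_zero, Real.sqrt_sq ENNReal.toReal_nonneg] at h2
    rwa [← ENNReal.toReal_zero, ENNReal.tendsto_toReal_iff hN (by simp)] at h2
  obtain ⟨G₁, hG₁, h1⟩ := exists_tendsto_of_cauchy hX
    (aux (fun p => ((hX _).sub (hX _)).eLpNorm_ne_top)
      (fun p => le_add_of_nonneg_right (by positivity)) hc')
  obtain ⟨G₂, hG₂, h2⟩ := exists_tendsto_of_cauchy hY
    (aux (fun p => ((hY _).sub (hY _)).eLpNorm_ne_top)
      (fun p => le_add_of_nonneg_left (by positivity)) hc')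
  exact ⟨φ, G₁, G₂, hφ, hG₁, hG₂, hlim, h1, h2⟩

theorem inFormDomain_of_cauchy (hW : IsOpen W) (h0 : (0 : ℂ) ∉ W) {φ : ℕ → ℂ → ℂ}
    (hu : MemLp u 2 (volume.restrict W)) (hφ : ∀ n, φ n ∈ testFunctions W)
    (hlim : Tendsto (fun n => eLpNorm (φ n - u) 2 (volume.restrict W)) atTop (𝓝 0))
    (h1 : Tendsto (fun p : ℕ × ℕ => eLpNorm (magneticX (φ p.1) - magneticX (φ p.2)) 2
      (volume.restrict W)) atTop (𝓝 0))
    (h2 : Tendsto (fun p : ℕ × ℕ => eLpNorm (magneticY (φ p.1) - magneticY (φ p.2)) 2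
      (volume.restrict W)) atTop (𝓝 0)) :
    InFormDomain (volume.restrict W) (testFunctions W) magneticLaplacian u := by
  refine ⟨hu, φ, hφ, hlim, ?_⟩
  simp only [fun p : ℕ × ℕ => l2inner_magneticLaplacian_sub hW h0 (hφ p.1) (hφ p.2)]
  have t1 := ((ENNReal.tendsto_toReal (by simp)).comp h1).pow 2
  have t2 := ((ENNReal.tendsto_toReal (by simp)).comp h2).pow 2
  have := (Complex.continuous_ofReal.tendsto _).comp (t1.add t2)
  simpa [Function.comp_def] using this

end FormDomain

/-! ### Decomposition of `L²` of the punctured domain along the horizontal axis -/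

section Halves

variable {Ω : Set ℂ} {f g : ℂ → ℂ}

theorem isOpen_punctured (hΩ : IsOpen Ω) : IsOpen (punctured Ω) := hΩ.sdiff isClosed_singleton

theorem zero_notMem_punctured : (0 : ℂ) ∉ punctured Ω := fun h => h.2 rfl

theorem isOpen_upperHalf (hΩ : IsOpen Ω) : IsOpen (upperHalf Ω) :=
  hΩ.inter (isOpen_lt continuous_const Complex.continuous_im)

theorem upperHalf_subset_slitPlane : upperHalf Ω ⊆ Complex.slitPlane :=
  fun _ hz => Or.inr (ne_of_gt hz.2)

theorem upperHalf_subset_punctured : upperHalf Ω ⊆ punctured Ω := by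
  rintro z ⟨hz, him⟩
  refine ⟨hz, fun h => ?_⟩
  rw [Set.mem_singleton_iff] at h
  simp [h] at him

theorem sigma₂_mem_punctured (hΩ₂ : ∀ z ∈ Ω, sigma₂ z ∈ Ω) :
    ∀ z ∈ punctured Ω, sigma₂ z ∈ punctured Ω := by
  rintro z ⟨hz, h0⟩
  refine ⟨hΩ₂ z hz, fun h => h0 ?_⟩
  rw [Set.mem_singleton_iff] at h ⊢
  rw [← sigma₂_sigma₂ z, h]
  apply Complex.ext <;> simp

theorem sigma₁_mem_punctured (hΩ₁ : ∀ z ∈ Ω, sigma₁ z ∈ Ω) :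
    ∀ z ∈ punctured Ω, sigma₁ z ∈ punctured Ω := by
  rintro z ⟨hz, h0⟩
  refine ⟨hΩ₁ z hz, fun h => h0 ?_⟩
  rw [Set.mem_singleton_iff] at h ⊢
  rw [← sigma₁_sigma₁ z, h]
  apply Complex.ext <;> simp

theorem restrict_punctured (hΩ₂ : ∀ z ∈ Ω, sigma₂ z ∈ Ω) :
    volume.restrict (punctured Ω) =
      volume.restrict (upperHalf Ω ∪ sigma₂ ⁻¹' upperHalf Ω) := by
  refine Measure.restrict_congr_set ?_
  filter_upwards [ae_im_ne_zero] with z hz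
  refine propext ⟨fun h => ?_, ?_⟩
  · rcases lt_or_gt_of_ne hz with h1 | h1
    · exact Or.inr ⟨hΩ₂ z h.1, by simpa using h1⟩
    · exact Or.inl ⟨h.1, h1⟩
  · rintro (h | h)
    · exact upperHalf_subset_punctured h
    · refine ⟨by simpa using hΩ₂ _ h.1, fun h' => hz ?_⟩
      rw [Set.mem_singleton_iff] at h'
      simp [h']

theorem disjoint_upperHalf_preimage : Disjoint (upperHalf Ω) (sigma₂ ⁻¹' upperHalf Ω) := by
  rw [Set.disjoint_left]
  rintro z ⟨-, h1⟩ ⟨-, h2⟩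
  simp only [Set.mem_ofPred_eq, sigma₂_im] at h1 h2
  linarith

theorem measurePreserving_sigma₂_upperHalf :
    MeasurePreserving sigma₂ (volume.restrict (sigma₂ ⁻¹' upperHalf Ω))
      (volume.restrict (upperHalf Ω)) :=
  measurePreserving_sigma₂.restrict_preimage_emb measurableEmbedding_sigma₂ _

theorem measurable_exp_arg : Measurable fun z : ℂ => Complex.exp (Complex.I * z.arg) := by
  fun_prop

theorem ae_punctured_of_upperHalf (hΩ₂ : ∀ z ∈ Ω, sigma₂ z ∈ Ω) {P : ℂ → Prop}
    (h1 : ∀ᵐ z ∂(volume.restrict (upperHalf Ω)), P z)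
    (h2 : ∀ᵐ z ∂(volume.restrict (upperHalf Ω)), P (sigma₂ z)) :
    ∀ᵐ z ∂(volume.restrict (punctured Ω)), P z := by
  rw [restrict_punctured hΩ₂, ae_restrict_union_iff]
  refine ⟨h1, ?_⟩
  have := measurePreserving_sigma₂_upperHalf.quasiMeasurePreserving.ae h2
  simpa using this

theorem l2inner_punctured (hΩ : IsOpen Ω) (hΩ₂ : ∀ z ∈ Ω, sigma₂ z ∈ Ω)
    (hf : MemLp f 2 (volume.restrict (punctured Ω)))
    (hg : MemLp g 2 (volume.restrict (punctured Ω))) :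
    l2inner (volume.restrict (punctured Ω)) f g =
      l2inner (volume.restrict (upperHalf Ω)) f g +
      l2inner (volume.restrict (upperHalf Ω)) (twistedReflection f) (twistedReflection g) := by
  have hi := integrable_mul_conj hf hg
  have hm : MeasurableSet (sigma₂ ⁻¹' upperHalf Ω) :=
    measurePreserving_sigma₂.measurable (isOpen_upperHalf hΩ).measurableSet
  rw [restrict_punctured hΩ₂] at hi
  unfold l2inner
  rw [restrict_punctured hΩ₂, setIntegral_union disjoint_upperHalf_preimage hm
    (hi.mono_measure (Measure.restrict_mono Set.subset_union_left le_rfl))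
    (hi.mono_measure (Measure.restrict_mono Set.subset_union_right le_rfl))]
  congr 1
  have h := measurePreserving_sigma₂.setIntegral_preimage_emb measurableEmbedding_sigma₂
    (fun z => f (sigma₂ z) * conj (g (sigma₂ z))) (upperHalf Ω)
  simp only [sigma₂_sigma₂] at h
  rw [h]
  refine integral_congr_ae (.of_forall fun z => ?_)
  simp only [twistedReflection, ← phase_sq, map_mul]
  linear_combination (-f (sigma₂ z) * conj (g (sigma₂ z)) * (phase z * conj (phase z) + 1)) *
    phase_mul_conj z

theorem aestronglyMeasurable_punctured (hΩ₂ : ∀ z ∈ Ω, sigma₂ z ∈ Ω)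
    (hf : AEStronglyMeasurable f (volume.restrict (upperHalf Ω)))
    (hSf : AEStronglyMeasurable (twistedReflection f) (volume.restrict (upperHalf Ω))) :
    AEStronglyMeasurable f (volume.restrict (punctured Ω)) := by
  rw [restrict_punctured hΩ₂, aestronglyMeasurable_union_iff]
  refine ⟨hf, ?_⟩
  rw [← twistedReflection_twistedReflection f]
  exact measurable_exp_arg.aestronglyMeasurable.mul
    (hSf.comp_measurePreserving measurePreserving_sigma₂_upperHalf)

theorem eLpNorm_punctured_le (hΩ : IsOpen Ω) (hΩ₂ : ∀ z ∈ Ω, sigma₂ z ∈ Ω)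
    (hf : AEStronglyMeasurable f (volume.restrict (upperHalf Ω)))
    (hSf : AEStronglyMeasurable (twistedReflection f) (volume.restrict (upperHalf Ω))) :
    eLpNorm f 2 (volume.restrict (punctured Ω)) ≤
      eLpNorm f 2 (volume.restrict (upperHalf Ω)) +
      eLpNorm (twistedReflection f) 2 (volume.restrict (upperHalf Ω)) := by
  have hU := (isOpen_upperHalf hΩ).measurableSet
  have hm : MeasurableSet (sigma₂ ⁻¹' upperHalf Ω) := measurePreserving_sigma₂.measurable hU
  have hmeas := aestronglyMeasurable_punctured hΩ₂ hf hSf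
  have hmeas' := hmeas
  rw [restrict_punctured hΩ₂, aestronglyMeasurable_union_iff] at hmeas'
  have h2 : eLpNorm (twistedReflection f) 2 (volume.restrict (upperHalf Ω)) =
      eLpNorm f 2 (volume.restrict (sigma₂ ⁻¹' upperHalf Ω)) := by
    rw [← eLpNorm_comp_measurePreserving hSf measurePreserving_sigma₂_upperHalf]
    refine eLpNorm_congr_norm_ae (.of_forall fun z => ?_)
    rw [Function.comp, norm_twistedReflection, sigma₂_sigma₂]
  rw [h2, restrict_punctured hΩ₂, ← eLpNorm_indicator_eq_eLpNorm_restrict (hU.union hm),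
    Set.indicator_union_of_disjoint disjoint_upperHalf_preimage,
    ← eLpNorm_indicator_eq_eLpNorm_restrict hU, ← eLpNorm_indicator_eq_eLpNorm_restrict hm]
  exact eLpNorm_add_le ((aestronglyMeasurable_indicator_iff hU).2 hmeas'.1)
    ((aestronglyMeasurable_indicator_iff hm).2 hmeas'.2) (by norm_num)

theorem memLp_punctured (hΩ : IsOpen Ω) (hΩ₂ : ∀ z ∈ Ω, sigma₂ z ∈ Ω)
    (hf : MemLp f 2 (volume.restrict (upperHalf Ω)))
    (hSf : MemLp (twistedReflection f) 2 (volume.restrict (upperHalf Ω))) :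
    MemLp f 2 (volume.restrict (punctured Ω)) :=
  ⟨aestronglyMeasurable_punctured hΩ₂ hf.1 hSf.1,
    (eLpNorm_punctured_le hΩ hΩ₂ hf.1 hSf.1).trans_lt (ENNReal.add_lt_top.2 ⟨hf.2, hSf.2⟩)⟩

theorem preimage_eq_of_involution {s : ℂ → ℂ} (hs : ∀ z, s (s z) = z) {A : Set ℂ}
    (hA : ∀ z ∈ A, s z ∈ A) : s ⁻¹' A = A := by
  ext z
  exact ⟨fun h => by simpa [hs] using hA _ h, fun h => hA z h⟩

theorem measurePreserving_sigma₂_punctured (hΩ₂ : ∀ z ∈ Ω, sigma₂ z ∈ Ω) :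
    MeasurePreserving sigma₂ (volume.restrict (punctured Ω)) (volume.restrict (punctured Ω)) := by
  have := measurePreserving_sigma₂.restrict_preimage_emb measurableEmbedding_sigma₂ (punctured Ω)
  rwa [preimage_eq_of_involution sigma₂_sigma₂ (sigma₂_mem_punctured hΩ₂)] at this

theorem measurePreserving_sigma₁_punctured (hΩ₁ : ∀ z ∈ Ω, sigma₁ z ∈ Ω) :
    MeasurePreserving sigma₁ (volume.restrict (punctured Ω)) (volume.restrict (punctured Ω)) := by
  have := measurePreserving_sigma₁.restrict_preimage_emb measurableEmbedding_sigma₁ (punctured Ω)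
  rwa [preimage_eq_of_involution sigma₁_sigma₁ (sigma₁_mem_punctured hΩ₁)] at this

theorem aestronglyMeasurable_twistedReflection (hΩ₂ : ∀ z ∈ Ω, sigma₂ z ∈ Ω)
    (hf : AEStronglyMeasurable f (volume.restrict (punctured Ω))) :
    AEStronglyMeasurable (twistedReflection f) (volume.restrict (punctured Ω)) :=
  measurable_exp_arg.aestronglyMeasurable.mul
    (hf.comp_measurePreserving (measurePreserving_sigma₂_punctured hΩ₂))

theorem eLpNorm_twistedReflection (hΩ₂ : ∀ z ∈ Ω, sigma₂ z ∈ Ω)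
    (hf : AEStronglyMeasurable f (volume.restrict (punctured Ω))) :
    eLpNorm (twistedReflection f) 2 (volume.restrict (punctured Ω)) =
      eLpNorm f 2 (volume.restrict (punctured Ω)) := by
  rw [← eLpNorm_comp_measurePreserving hf (measurePreserving_sigma₂_punctured hΩ₂)]
  exact eLpNorm_congr_norm_ae (.of_forall fun z => norm_twistedReflection f z)

theorem memLp_twistedReflection (hΩ₂ : ∀ z ∈ Ω, sigma₂ z ∈ Ω)
    (hf : MemLp f 2 (volume.restrict (punctured Ω))) :
    MemLp (twistedReflection f) 2 (volume.restrict (punctured Ω)) :=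
  ⟨aestronglyMeasurable_twistedReflection hΩ₂ hf.1,
    (eLpNorm_twistedReflection hΩ₂ hf.1).trans_lt hf.2⟩

theorem l2inner_twistedReflection (hΩ₂ : ∀ z ∈ Ω, sigma₂ z ∈ Ω) (f g : ℂ → ℂ) :
    l2inner (volume.restrict (punctured Ω)) (twistedReflection f) (twistedReflection g) =
      l2inner (volume.restrict (punctured Ω)) f g := by
  unfold l2inner
  rw [← (measurePreserving_sigma₂_punctured hΩ₂).integral_comp measurableEmbedding_sigma₂
    fun z => f z * conj (g z)]
  refine integral_congr_ae (.of_forall fun z => ?_)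
  simp only [twistedReflection, ← phase_sq, map_mul]
  linear_combination (f (sigma₂ z) * conj (g (sigma₂ z)) * (phase z * conj (phase z) + 1)) *
    phase_mul_conj z

theorem aestronglyMeasurable_conjReflection (hΩ₁ : ∀ z ∈ Ω, sigma₁ z ∈ Ω)
    (hf : AEStronglyMeasurable f (volume.restrict (punctured Ω))) :
    AEStronglyMeasurable (conjReflection f) (volume.restrict (punctured Ω)) :=
  Complex.continuous_conj.comp_aestronglyMeasurable
    (hf.comp_measurePreserving (measurePreserving_sigma₁_punctured hΩ₁))

theorem eLpNorm_conjReflection (hΩ₁ : ∀ z ∈ Ω, sigma₁ z ∈ Ω)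
    (hf : AEStronglyMeasurable f (volume.restrict (punctured Ω))) :
    eLpNorm (conjReflection f) 2 (volume.restrict (punctured Ω)) =
      eLpNorm f 2 (volume.restrict (punctured Ω)) := by
  rw [← eLpNorm_comp_measurePreserving hf (measurePreserving_sigma₁_punctured hΩ₁)]
  exact eLpNorm_congr_norm_ae (.of_forall fun z => by simp [conjReflection])

theorem l2inner_conjReflection (hΩ₁ : ∀ z ∈ Ω, sigma₁ z ∈ Ω) (f g : ℂ → ℂ) :
    l2inner (volume.restrict (punctured Ω)) (conjReflection f) (conjReflection g) =
      conj (l2inner (volume.restrict (punctured Ω)) f g) := by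
  rw [conj_l2inner]
  unfold l2inner
  rw [← (measurePreserving_sigma₁_punctured hΩ₁).integral_comp measurableEmbedding_sigma₁
    fun z => g z * conj (f z)]
  refine integral_congr_ae (.of_forall fun z => ?_)
  simp only [conjReflection, Complex.conj_conj, mul_comm]

end Halves

/-! ### Symmetries of the magnetic Laplacian -/

section Symmetry

variable {W Ω : Set ℂ} {u f φ : ℂ → ℂ}

/-- A linear or antilinear (according to `τ`) involution of `L²` which preserves the norm and the
test functions and commutes with `T` on them also preserves the graph of the Friedrichs extension
of `T`. -/
theorem FriedrichsGraph.map_symmetry {μ : Measure ℂ} {C : Set (ℂ → ℂ)} {T : (ℂ → ℂ) → ℂ → ℂ}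
    (hCm : ∀ φ ∈ C, AEStronglyMeasurable φ μ) (hCsub : ∀ φ ∈ C, ∀ ψ ∈ C, φ - ψ ∈ C)
    (R : (ℂ → ℂ) → ℂ → ℂ) {τ : ℂ → ℂ} (hτ : Continuous τ) (hτ0 : τ 0 = 0)
    (hRsub : ∀ f g, R (f - g) = R f - R g) (hRR : ∀ f, R (R f) = f)
    (hRm : ∀ f, AEStronglyMeasurable f μ → AEStronglyMeasurable (R f) μ)
    (hRn : ∀ f, AEStronglyMeasurable f μ → eLpNorm (R f) 2 μ = eLpNorm f 2 μ)
    (hRi : ∀ f g, l2inner μ (R f) (R g) = τ (l2inner μ f g))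
    (hRC : ∀ φ ∈ C, R φ ∈ C) (hRT : ∀ φ ∈ C, T (R φ) =ᵐ[μ] R (T φ))
    (h : FriedrichsGraph μ C T u f) : FriedrichsGraph μ C T (R u) (R f) := by
  obtain ⟨⟨hu, φ, hφ, hlim, hc⟩, hf, ht⟩ := h
  have hL : ∀ {f}, MemLp f 2 μ → MemLp (R f) 2 μ := fun hf =>
    ⟨hRm _ hf.1, (hRn _ hf.1).trans_lt hf.2⟩
  refine ⟨⟨hL hu, fun n => R (φ n), fun n => hRC _ (hφ n), ?_, ?_⟩, hL hf, ?_⟩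
  · refine hlim.congr fun n => ?_
    rw [← hRsub, hRn _ ((hCm _ (hφ n)).sub hu.1)]
  · have := (hτ.tendsto 0).comp hc
    rw [hτ0] at this
    refine this.congr fun p => ?_
    rw [Function.comp, ← hRi, ← hRsub]
    exact l2inner_congr (hRT _ (hCsub _ (hφ _) _ (hφ _))).symm .rfl
  · intro ψ hψ
    have h1 := hRT _ (hRC ψ hψ)
    rw [hRR] at h1
    rw [l2inner_congr .rfl h1, hRi, ht _ (hRC ψ hψ), ← hRi, hRR]

theorem magneticY_neg (ψ : ℂ → ℂ) : magneticY (-ψ) = -magneticY ψ := by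
  funext z
  simp [magneticY, partialY, fderiv_neg]
  ring

theorem magneticLaplacian_twistedReflection (hφ : φ ∈ testFunctions (punctured Ω))
    (hΩ : IsOpen Ω) {z : ℂ} (hz : z ∈ Complex.slitPlane) :
    magneticLaplacian (twistedReflection φ) z = twistedReflection (magneticLaplacian φ) z := by
  have hW := isOpen_punctured hΩ
  have dX := differentiable_of_mem (magneticX_mem_testFunctions hW zero_notMem_punctured hφ)
  have dY := differentiable_of_mem (magneticY_mem_testFunctions hW zero_notMem_punctured hφ)
  have eX : magneticX (twistedReflection φ) =ᶠ[𝓝 z] twistedReflection (magneticX φ) := by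
    filter_upwards [eventually_mem_slitPlane hz] with z' hz'
    exact magneticX_twistedReflection hz' (differentiable_of_mem hφ _)
  have eY : magneticY (twistedReflection φ) =ᶠ[𝓝 z] twistedReflection (-magneticY φ) := by
    filter_upwards [eventually_mem_slitPlane hz] with z' hz'
    rw [magneticY_twistedReflection hz' (differentiable_of_mem hφ _), twistedReflection_neg]
    rfl
  have e' : magneticLaplacian φ = magneticX (magneticX φ) + magneticY (magneticY φ) := rfl
  rw [magneticLaplacian, magneticX_congr eX, magneticY_congr eY,
    magneticX_twistedReflection hz (dX _), magneticY_twistedReflection hz (dY.neg _), magneticY_neg, e',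
    twistedReflection_neg, twistedReflection_add]
  simp

theorem magneticLaplacian_conjReflection (φ : ℂ → ℂ) :
    magneticLaplacian (conjReflection φ) = conjReflection (magneticLaplacian φ) := by
  have eX : magneticX (conjReflection φ) = conjReflection (magneticX φ) :=
    funext (magneticX_conjReflection φ)
  have eY : magneticY (conjReflection φ) = conjReflection (-magneticY φ) := by
    funext z; rw [magneticY_conjReflection]; simp [conjReflection]
  funext z
  rw [magneticLaplacian, eX, eY, magneticX_conjReflection, magneticY_conjReflection, magneticY_neg]
  simp [conjReflection, magneticLaplacian]

variable {lam : ℝ}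

/-- The graph of the Aharonov-Bohm operator, for the pairs `(u, λ u)`. -/
abbrev SolvesAB (Ω : Set ℂ) (lam : ℝ) (u : ℂ → ℂ) : Prop :=
  FriedrichsGraph (volume.restrict (punctured Ω)) (testFunctions (punctured Ω)) magneticLaplacian
    u (fun z => (lam : ℂ) * u z)

theorem SolvesAB.twistedReflection (hΩ : IsOpen Ω) (hΩ₂ : ∀ z ∈ Ω, sigma₂ z ∈ Ω)
    (h : SolvesAB Ω lam u) : SolvesAB Ω lam (twistedReflection u) := by
  have := FriedrichsGraph.map_symmetry (τ := id)
    (fun φ hφ => (memLp_of_mem hφ _).1) (fun φ hφ ψ hψ => sub_mem_testFunctions hφ hψ)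
    AharonovBohm.twistedReflection continuous_id rfl twistedReflection_sub
    twistedReflection_twistedReflection
    (fun f hf => aestronglyMeasurable_twistedReflection hΩ₂ hf)
    (fun f hf => eLpNorm_twistedReflection hΩ₂ hf) (l2inner_twistedReflection hΩ₂)
    (fun φ hφ => twistedReflection_mem_testFunctions (isOpen_punctured hΩ) zero_notMem_punctured
      (sigma₂_mem_punctured hΩ₂) hφ)
    (fun φ hφ => by
      filter_upwards [ae_restrict_of_ae ae_mem_slitPlane] with z hz
      exact magneticLaplacian_twistedReflection hφ hΩ hz) h
  rwa [twistedReflection_const_mul] at this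

theorem SolvesAB.conjReflection (hΩ₁ : ∀ z ∈ Ω, sigma₁ z ∈ Ω)
    (h : SolvesAB Ω lam u) : SolvesAB Ω lam (conjReflection u) := by
  have := FriedrichsGraph.map_symmetry
    (fun φ hφ => (memLp_of_mem hφ _).1) (fun φ hφ ψ hψ => sub_mem_testFunctions hφ hψ)
    AharonovBohm.conjReflection Complex.continuous_conj (map_zero _) conjReflection_sub
    conjReflection_conjReflection
    (fun f hf => aestronglyMeasurable_conjReflection hΩ₁ hf)
    (fun f hf => eLpNorm_conjReflection hΩ₁ hf) (l2inner_conjReflection hΩ₁)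
    (fun φ hφ => conjReflection_mem_testFunctions (sigma₁_mem_punctured hΩ₁) hφ)
    (fun φ _ => (magneticLaplacian_conjReflection φ).eventuallyEq) h
  convert this using 1
  funext z
  simp [AharonovBohm.conjReflection]

theorem tendsto_eLpNorm_add {μ : Measure ℂ} {f g : ℕ → ℂ → ℂ} {F G : ℂ → ℂ}
    (hf : ∀ n, MemLp (f n) 2 μ) (hg : ∀ n, MemLp (g n) 2 μ) (hF : MemLp F 2 μ)
    (hG : MemLp G 2 μ) (h1 : Tendsto (fun n => eLpNorm (f n - F) 2 μ) atTop (𝓝 0))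
    (h2 : Tendsto (fun n => eLpNorm (g n - G) 2 μ) atTop (𝓝 0)) :
    Tendsto (fun n => eLpNorm (f n + g n - (F + G)) 2 μ) atTop (𝓝 0) := by
  have h3 := h1.add h2
  rw [add_zero] at h3
  refine tendsto_of_tendsto_of_tendsto_of_le_of_le tendsto_const_nhds h3
    (fun _ => zero_le) fun n => ?_
  have : f n + g n - (F + G) = (f n - F) + (g n - G) := by abel
  simp only [this]
  exact eLpNorm_add_le ((hf n).sub hF).1 ((hg n).sub hG).1 (by norm_num)

theorem SolvesAB.add (hΩ : IsOpen Ω) {v : ℂ → ℂ} (hu : SolvesAB Ω lam u) (hv : SolvesAB Ω lam v) :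
    SolvesAB Ω lam (u + v) := by
  have hW := isOpen_punctured hΩ
  have h0 := zero_notMem_punctured (Ω := Ω)
  obtain ⟨φ, G₁, G₂, hφ, hG₁, hG₂, l0, l1, l2⟩ := hu.1.exists_gradient hW h0
  obtain ⟨φ', G₁', G₂', hφ', hG₁', hG₂', l0', l1', l2'⟩ := hv.1.exists_gradient hW h0
  have hs := fun n => add_mem_testFunctions (hφ n) (hφ' n)
  have eX : ∀ n, magneticX (φ n + φ' n) = magneticX (φ n) + magneticX (φ' n) := fun n =>
    magneticX_add (differentiable_of_mem (hφ n)) (differentiable_of_mem (hφ' n))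
  have eY : ∀ n, magneticY (φ n + φ' n) = magneticY (φ n) + magneticY (φ' n) := fun n =>
    magneticY_add (differentiable_of_mem (hφ n)) (differentiable_of_mem (hφ' n))
  have mX := fun n => memLp_of_mem (magneticX_mem_testFunctions hW h0 (hφ n)) (punctured Ω)
  have mY := fun n => memLp_of_mem (magneticY_mem_testFunctions hW h0 (hφ n)) (punctured Ω)
  have mX' := fun n => memLp_of_mem (magneticX_mem_testFunctions hW h0 (hφ' n)) (punctured Ω)
  have mY' := fun n => memLp_of_mem (magneticY_mem_testFunctions hW h0 (hφ' n)) (punctured Ω)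
  have hl := tendsto_eLpNorm_add (fun n => memLp_of_mem (hφ n) (punctured Ω))
    (fun n => memLp_of_mem (hφ' n) (punctured Ω)) hu.1.1 hv.1.1 l0 l0'
  refine ⟨inFormDomain_of_cauchy (φ := fun n => φ n + φ' n) hW h0 (hu.1.1.add hv.1.1) hs hl
    ?_ ?_, ?_, ?_⟩
  · simp only [eX]
    exact tendsto_cauchy_of_tendsto (f := fun n => magneticX (φ n) + magneticX (φ' n))
      (fun n => (mX n).add (mX' n)) (hG₁.add hG₁')
      (tendsto_eLpNorm_add mX mX' hG₁ hG₁' l1 l1')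
  · simp only [eY]
    exact tendsto_cauchy_of_tendsto (f := fun n => magneticY (φ n) + magneticY (φ' n))
      (fun n => (mY n).add (mY' n)) (hG₂.add hG₂')
      (tendsto_eLpNorm_add mY mY' hG₂ hG₂' l2 l2')
  · exact (hu.1.1.add hv.1.1).const_mul _
  · intro ψ hψ
    have hT := memLp_of_mem (magneticLaplacian_mem_testFunctions hW h0 hψ) (punctured Ω)
    have hψ' := memLp_of_mem hψ (punctured Ω)
    have e : (fun z => (lam : ℂ) * (u + v) z) =
        (fun z => (lam : ℂ) * u z) + fun z => (lam : ℂ) * v z := by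
      funext z; simp [mul_add]
    rw [l2inner_add_left hu.1.1 hv.1.1 hT, hu.2.2 ψ hψ, hv.2.2 ψ hψ, e,
      l2inner_add_left hu.2.1 hv.2.1 hψ']

/-- The projection `f ↦ (f + c S f) / 2`, for a sign `c`. -/
def symmetrize (c : ℂ) (f : ℂ → ℂ) (z : ℂ) : ℂ := 1 / 2 * (f z + c * twistedReflection f z)

theorem twistedReflection_symmetrize {c : ℂ} (hc : c * c = 1) (f : ℂ → ℂ) :
    twistedReflection (symmetrize c f) = fun z => c * symmetrize c f z := by
  have e : symmetrize c f = fun z => 1 / 2 * (f + fun z => c * twistedReflection f z) z := rfl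
  rw [e, twistedReflection_const_mul, twistedReflection_add, twistedReflection_const_mul,
    twistedReflection_twistedReflection]
  funext z
  simp only [Pi.add_apply]
  linear_combination (-1 / 2 * twistedReflection f z) * hc

theorem memLp_symmetrize (hΩ₂ : ∀ z ∈ Ω, sigma₂ z ∈ Ω) (c : ℂ)
    (hf : MemLp f 2 (volume.restrict (punctured Ω))) :
    MemLp (symmetrize c f) 2 (volume.restrict (punctured Ω)) :=
  (hf.add ((memLp_twistedReflection hΩ₂ hf).const_mul c)).const_mul _

theorem eLpNorm_symmetrize_le (hΩ₂ : ∀ z ∈ Ω, sigma₂ z ∈ Ω) {c : ℂ} (hc : ‖c‖ = 1)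
    (hf : AEStronglyMeasurable f (volume.restrict (punctured Ω))) :
    eLpNorm (symmetrize c f) 2 (volume.restrict (punctured Ω)) ≤
      eLpNorm f 2 (volume.restrict (punctured Ω)) := by
  have hSf := aestronglyMeasurable_twistedReflection hΩ₂ hf
  have e : symmetrize c f = (1 / 2 : ℂ) • (f + c • twistedReflection f) := rfl
  rw [e, eLpNorm_const_smul]
  have h1 : eLpNorm (f + c • twistedReflection f) 2 (volume.restrict (punctured Ω)) ≤
      2 * eLpNorm f 2 (volume.restrict (punctured Ω)) := by
    refine (eLpNorm_add_le hf (hSf.const_smul c) (by norm_num)).trans ?_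
    rw [eLpNorm_const_smul, eLpNorm_twistedReflection hΩ₂ hf, ← ofReal_norm, hc, ENNReal.ofReal_one,
      one_mul, two_mul]
  refine (mul_le_mul_right h1 _).trans ?_
  rw [← mul_assoc, ← ofReal_norm, show ‖(1 / 2 : ℂ)‖ = 2⁻¹ by simp,
    ENNReal.ofReal_inv_of_pos (by norm_num), ENNReal.ofReal_ofNat,
    ENNReal.inv_mul_cancel (by norm_num) (by norm_num), one_mul]

theorem symmetrize_sub (c : ℂ) (f g : ℂ → ℂ) :
    symmetrize c f - symmetrize c g = symmetrize c (f - g) := by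
  funext z; simp [symmetrize, twistedReflection_sub]; ring

theorem tendsto_symmetrize (hΩ₂ : ∀ z ∈ Ω, sigma₂ z ∈ Ω) {c : ℂ} (hc : ‖c‖ = 1)
    {f : ℕ → ℂ → ℂ} {F : ℂ → ℂ} (hf : ∀ n, MemLp (f n) 2 (volume.restrict (punctured Ω)))
    (hF : MemLp F 2 (volume.restrict (punctured Ω)))
    (h : Tendsto (fun n => eLpNorm (f n - F) 2 (volume.restrict (punctured Ω))) atTop (𝓝 0)) :
    Tendsto (fun n => eLpNorm (symmetrize c (f n) - symmetrize c F) 2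
      (volume.restrict (punctured Ω))) atTop (𝓝 0) := by
  refine tendsto_of_tendsto_of_tendsto_of_le_of_le tendsto_const_nhds h
    (fun _ => zero_le) fun n => ?_
  simp only [symmetrize_sub]
  exact eLpNorm_symmetrize_le hΩ₂ hc ((hf n).sub hF).1

/-- A member of the form domain which is fixed by `S` is a limit of test functions fixed by `S`. -/
theorem InFormDomain.exists_gradient_of_fixed (hΩ : IsOpen Ω) (hΩ₂ : ∀ z ∈ Ω, sigma₂ z ∈ Ω)
    (hu : InFormDomain (volume.restrict (punctured Ω)) (testFunctions (punctured Ω))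
      magneticLaplacian u)
    (hS : twistedReflection u =ᵐ[volume.restrict (punctured Ω)] u) :
    ∃ (φ : ℕ → ℂ → ℂ) (G₁ G₂ : ℂ → ℂ), (∀ n, φ n ∈ testFunctions (punctured Ω)) ∧
      (∀ n, twistedReflection (φ n) = φ n) ∧
      MemLp G₁ 2 (volume.restrict (punctured Ω)) ∧ MemLp G₂ 2 (volume.restrict (punctured Ω)) ∧
      twistedReflection G₁ = G₁ ∧ twistedReflection G₂ = -G₂ ∧
      Tendsto (fun n => eLpNorm (φ n - u) 2 (volume.restrict (punctured Ω))) atTop (𝓝 0) ∧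
      Tendsto (fun n => eLpNorm (magneticX (φ n) - G₁) 2 (volume.restrict (punctured Ω)))
        atTop (𝓝 0) ∧
      Tendsto (fun n => eLpNorm (magneticY (φ n) - G₂) 2 (volume.restrict (punctured Ω)))
        atTop (𝓝 0) := by
  have hW := isOpen_punctured hΩ
  have h0 := zero_notMem_punctured (Ω := Ω)
  obtain ⟨φ, G₁, G₂, hφ, hG₁, hG₂, l0, l1, l2⟩ := hu.exists_gradient hW h0
  have hSφ := fun n => twistedReflection_mem_testFunctions hW h0 (sigma₂_mem_punctured hΩ₂) (hφ n)
  have dφ := fun n => differentiable_of_mem (hφ n)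
  have dSφ := fun n => differentiable_of_mem (hSφ n)
  have e : ∀ n, symmetrize 1 (φ n) = fun z => 1 / 2 * (φ n + twistedReflection (φ n)) z := by
    intro n; funext z; simp [symmetrize]
  have mX := fun n => memLp_of_mem (magneticX_mem_testFunctions hW h0 (hφ n)) (punctured Ω)
  have mY := fun n => memLp_of_mem (magneticY_mem_testFunctions hW h0 (hφ n)) (punctured Ω)
  refine ⟨fun n => symmetrize 1 (φ n), symmetrize 1 G₁, symmetrize (-1) G₂, fun n => ?_,
    fun n => ?_, memLp_symmetrize hΩ₂ _ hG₁, memLp_symmetrize hΩ₂ _ hG₂, ?_, ?_, ?_, ?_, ?_⟩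
  · simp only [e]
    exact const_mul_mem_testFunctions _ (add_mem_testFunctions (hφ n) (hSφ n))
  · simpa using twistedReflection_symmetrize (one_mul 1) (φ n)
  · simpa using twistedReflection_symmetrize (one_mul 1) G₁
  · rw [twistedReflection_symmetrize (by norm_num)]
    funext z; simp
  · refine (tendsto_symmetrize hΩ₂ (c := 1) (by simp) (fun n => memLp_of_mem (hφ n) _)
      hu.1 l0).congr fun n => eLpNorm_congr_ae ?_
    filter_upwards [hS] with z hz
    simp only [Pi.sub_apply, symmetrize, hz]
    ring
  · refine (tendsto_symmetrize hΩ₂ (c := 1) (by simp) mX hG₁ l1).congr fun n =>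
      eLpNorm_congr_ae ?_
    filter_upwards [ae_restrict_of_ae ae_mem_slitPlane] with z hz
    rw [e, magneticX_const_mul _ ((dφ n).add (dSφ n)), magneticX_add (dφ n) (dSφ n)]
    simp only [Pi.sub_apply, Pi.add_apply, magneticX_twistedReflection hz (dφ n _), symmetrize]
    ring
  · refine (tendsto_symmetrize hΩ₂ (c := -1) (by simp) mY hG₂ l2).congr fun n =>
      eLpNorm_congr_ae ?_
    filter_upwards [ae_restrict_of_ae ae_mem_slitPlane] with z hz
    rw [e, magneticY_const_mul _ ((dφ n).add (dSφ n)), magneticY_add (dφ n) (dSφ n)]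
    simp only [Pi.sub_apply, Pi.add_apply, magneticY_twistedReflection hz (dφ n _), symmetrize]
    ring

end Symmetry

/-! ### Geometry of the half-domain -/

section Geometry

variable {Ω : Set ℂ} {a b : ℝ}

/-- The domain cut along the half-axis `θ = π`. -/
def slitDomain (Ω : Set ℂ) : Set ℂ := Ω ∩ Complex.slitPlane

theorem isOpen_slitDomain (hΩ : IsOpen Ω) : IsOpen (slitDomain Ω) :=
  hΩ.inter Complex.isOpen_slitPlane

theorem slitDomain_subset_punctured : slitDomain Ω ⊆ punctured Ω :=
  fun _ hz => ⟨hz.1, fun h => Complex.slitPlane_ne_zero hz.2 h⟩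

theorem upperHalf_subset_slitDomain : upperHalf Ω ⊆ slitDomain Ω :=
  fun _ hz => ⟨hz.1, upperHalf_subset_slitPlane hz⟩

theorem sigma₂_mem_slitDomain (hΩ₂ : ∀ z ∈ Ω, sigma₂ z ∈ Ω) :
    ∀ z ∈ slitDomain Ω, sigma₂ z ∈ slitDomain Ω :=
  fun _ hz => ⟨hΩ₂ _ hz.1, sigma₂_mem_slitPlane hz.2⟩

/-- The part of the boundary of the half-domain which carries the Dirichlet condition. -/
abbrev dirichletPart (Ω : Set ℂ) (a : ℝ) : Set ℂ := frontier (upperHalf Ω) \ neumannPart a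

theorem mem_of_real (ha : Ω ∩ {z | z.im = 0} = {z | -(a / 2) < z.re ∧ z.re < a / 2 ∧ z.im = 0})
    {z : ℂ} (hz : z.im = 0) : z ∈ Ω ↔ -(a / 2) < z.re ∧ z.re < a / 2 := by
  have h := Set.ext_iff.1 ha z
  simp only [Set.mem_inter_iff, Set.mem_ofPred_eq, hz, and_true] at h
  exact h

theorem abs_re_lt (hconv : Convex ℝ Ω) (hΩ₂ : ∀ z ∈ Ω, sigma₂ z ∈ Ω)
    (ha : Ω ∩ {z | z.im = 0} = {z | -(a / 2) < z.re ∧ z.re < a / 2 ∧ z.im = 0})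
    {z : ℂ} (hz : z ∈ Ω) : -(a / 2) < z.re ∧ z.re < a / 2 := by
  have h := hconv hz (hΩ₂ z hz) (a := 1 / 2) (b := 1 / 2) (by norm_num) (by norm_num) (by norm_num)
  have e : (1 / 2 : ℝ) • z + (1 / 2 : ℝ) • sigma₂ z = (z.re : ℂ) := by
    apply Complex.ext
    · simp; ring
    · simp
  rw [e] at h
  simpa using (mem_of_real ha (Complex.ofReal_im _)).1 h

theorem abs_im_lt (hconv : Convex ℝ Ω) (hΩ₁ : ∀ z ∈ Ω, sigma₁ z ∈ Ω)
    (hb : Ω ∩ {z | z.re = 0} = {z | z.re = 0 ∧ -(b / 2) < z.im ∧ z.im < b / 2})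
    {z : ℂ} (hz : z ∈ Ω) : -(b / 2) < z.im ∧ z.im < b / 2 := by
  have h := hconv hz (hΩ₁ z hz) (a := 1 / 2) (b := 1 / 2) (by norm_num) (by norm_num) (by norm_num)
  have e : (1 / 2 : ℝ) • z + (1 / 2 : ℝ) • sigma₁ z = z.im * Complex.I := by
    apply Complex.ext
    · simp
    · simp; ring
  rw [e] at h
  have h' := (Set.ext_iff.1 hb (z.im * Complex.I)).1 ⟨h, by simp⟩
  simpa using h'

theorem isFiniteMeasure_upperHalf (hconv : Convex ℝ Ω) (hΩ₁ : ∀ z ∈ Ω, sigma₁ z ∈ Ω)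
    (hΩ₂ : ∀ z ∈ Ω, sigma₂ z ∈ Ω)
    (ha : Ω ∩ {z | z.im = 0} = {z | -(a / 2) < z.re ∧ z.re < a / 2 ∧ z.im = 0})
    (hb : Ω ∩ {z | z.re = 0} = {z | z.re = 0 ∧ -(b / 2) < z.im ∧ z.im < b / 2}) :
    IsFiniteMeasure (volume.restrict (upperHalf Ω)) := by
  have hbd : Bornology.IsBounded (upperHalf Ω) := by
    refine (Metric.isBounded_closedBall (x := (0 : ℂ)) (r := a / 2 + b / 2)).subset ?_
    intro z hz
    have h1 := abs_re_lt hconv hΩ₂ ha hz.1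
    have h2 := abs_im_lt hconv hΩ₁ hb hz.1
    rw [mem_closedBall_zero_iff]
    exact (Complex.norm_le_abs_re_add_abs_im z).trans
      (add_le_add (abs_le.2 ⟨h1.1.le, h1.2.le⟩) (abs_le.2 ⟨h2.1.le, h2.2.le⟩))
  exact isFiniteMeasure_restrict.2 hbd.measure_lt_top.ne

/-- The right end of the Neumann part belongs to the closure of the Dirichlet part: close to it,
horizontal segments from inside the half-domain have to leave it. -/
theorem corner_mem_closure (hΩ : IsOpen Ω) (hconv : Convex ℝ Ω) (h0 : (0 : ℂ) ∈ Ω)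
    (hΩ₂ : ∀ z ∈ Ω, sigma₂ z ∈ Ω)
    (ha : Ω ∩ {z | z.im = 0} = {z | -(a / 2) < z.re ∧ z.re < a / 2 ∧ z.im = 0}) :
    ((a / 2 : ℝ) : ℂ) ∈ closure (dirichletPart Ω a) := by
  rw [Metric.mem_closure_iff]
  intro ε hε
  have ha0 : 0 < a / 2 := ((mem_of_real ha (by simp)).1 h0).2
  set δ := min (ε / 4) (a / 4) with hδ
  have hδ0 : 0 < δ := lt_min (by positivity) (by linarith)
  have hδε : δ ≤ ε / 4 := min_le_left _ _
  have hδa : δ ≤ a / 4 := min_le_right _ _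
  have hc : ((a / 2 - δ : ℝ) : ℂ) ∈ Ω :=
    (mem_of_real ha (Complex.ofReal_im _)).2 ⟨by simp; linarith, by simp; linarith⟩
  obtain ⟨η, hη, hball⟩ := Metric.isOpen_iff.1 hΩ _ hc
  set t := min δ (η / 2) with ht
  have ht0 : 0 < t := lt_min hδ0 (by positivity)
  have htδ : t ≤ δ := min_le_left _ _
  have htη : t ≤ η / 2 := min_le_right _ _
  have hp : (⟨a / 2 - δ, t⟩ : ℂ) ∈ upperHalf Ω := by
    refine ⟨hball ?_, ht0⟩
    rw [Metric.mem_ball, Complex.dist_of_re_eq (by simp)]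
    simp only [Complex.ofReal_im, Real.dist_eq, sub_zero, abs_of_pos ht0]
    linarith
  have hq : (⟨a / 2, t⟩ : ℂ) ∉ upperHalf Ω := fun h =>
    lt_irrefl _ (abs_re_lt hconv hΩ₂ ha h.1).2
  have hconn : IsPreconnected (segment ℝ (⟨a / 2 - δ, t⟩ : ℂ) ⟨a / 2, t⟩) :=
    (convex_segment _ _).isPreconnected
  obtain ⟨z, hz, hzf⟩ : (segment ℝ (⟨a / 2 - δ, t⟩ : ℂ) ⟨a / 2, t⟩ ∩
      frontier (upperHalf Ω)).Nonempty := by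
    by_contra hne
    have hsub : ∀ z ∈ segment ℝ (⟨a / 2 - δ, t⟩ : ℂ) ⟨a / 2, t⟩, z ∉ upperHalf Ω →
        z ∈ (closure (upperHalf Ω))ᶜ := fun z hz hU h =>
      hne ⟨z, hz, by rw [(isOpen_upperHalf hΩ).frontier_eq]; exact ⟨h, hU⟩⟩
    obtain ⟨z, -, hz1, hz2⟩ := hconn _ _ (isOpen_upperHalf hΩ) isClosed_closure.isOpen_compl
      (fun z hz => or_iff_not_imp_left.2 (hsub z hz)) ⟨_, left_mem_segment ℝ _ _, hp⟩
      ⟨_, right_mem_segment ℝ _ _, hsub _ (right_mem_segment ℝ _ _) hq⟩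
    exact hz2 (subset_closure hz1)
  obtain ⟨s, r, hs, hr, hsr, rfl⟩ := hz
  have him : (s • (⟨a / 2 - δ, t⟩ : ℂ) + r • (⟨a / 2, t⟩ : ℂ)).im = t := by
    simp [← add_mul, hsr]
  have hre : (s • (⟨a / 2 - δ, t⟩ : ℂ) + r • (⟨a / 2, t⟩ : ℂ)).re = a / 2 - s * δ := by
    simp only [Complex.add_re, Complex.real_smul, Complex.mul_re, Complex.ofReal_re,
      Complex.ofReal_im]
    linear_combination (a / 2) * hsr
  refine ⟨_, ⟨hzf, fun h => ?_⟩, ?_⟩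
  · rw [neumannPart, Set.mem_ofPred_eq, him] at h
    exact ht0.ne' h.2.2
  · rw [dist_comm, dist_eq_norm]
    refine (Complex.norm_le_abs_re_add_abs_im _).trans_lt ?_
    rw [Complex.sub_re, Complex.sub_im, hre, him, Complex.ofReal_re, Complex.ofReal_im,
      sub_zero, abs_of_pos ht0, sub_sub_cancel_left, abs_neg, abs_of_nonneg (by positivity)]
    have : s * δ ≤ 1 * δ := by gcongr; linarith
    linarith

theorem disjoint_slitDomain_closure (hΩ : IsOpen Ω)
    (ha : Ω ∩ {z | z.im = 0} = {z | -(a / 2) < z.re ∧ z.re < a / 2 ∧ z.im = 0}) :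
    Disjoint (slitDomain Ω) (closure (dirichletPart Ω a)) := by
  refine Disjoint.closure_right ?_ (isOpen_slitDomain hΩ)
  rw [Set.disjoint_left]
  rintro z ⟨hz, hs⟩ ⟨hf, hN⟩
  rw [(isOpen_upperHalf hΩ).frontier_eq] at hf
  have him : 0 ≤ z.im := by
    have : closure (upperHalf Ω) ⊆ {z : ℂ | 0 ≤ z.im} :=
      closure_minimal (fun z hz => (show 0 < z.im from hz.2).le)
        (isClosed_le continuous_const Complex.continuous_im)
    exact this hf.1
  rcases him.eq_or_lt with h | h
  · refine hN ⟨?_, ((mem_of_real ha h.symm).1 hz).2.le, h.symm⟩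
    rcases Complex.mem_slitPlane_iff.1 hs with h' | h'
    · exact h'
    · exact absurd h.symm h'
  · exact hf.2 ⟨hz, h⟩

theorem testFunctions_subset_vanishingNear (hΩ : IsOpen Ω)
    (ha : Ω ∩ {z | z.im = 0} = {z | -(a / 2) < z.re ∧ z.re < a / 2 ∧ z.im = 0}) :
    testFunctions (slitDomain Ω) ⊆ vanishingNear (dirichletPart Ω a) :=
  fun _ hφ => ⟨hφ.1, hφ.2.1, (disjoint_slitDomain_closure hΩ ha).mono_left hφ.2.2⟩

/-- Away from the Dirichlet part, the closed half-domain only reaches the open Neumann segment, which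
lies inside the domain. -/
theorem closure_upperHalf_subset (hΩ : IsOpen Ω) (hconv : Convex ℝ Ω) (h0 : (0 : ℂ) ∈ Ω)
    (hΩ₂ : ∀ z ∈ Ω, sigma₂ z ∈ Ω)
    (ha : Ω ∩ {z | z.im = 0} = {z | -(a / 2) < z.re ∧ z.re < a / 2 ∧ z.im = 0}) :
    closure (upperHalf Ω) \ closure (dirichletPart Ω a) ⊆ slitDomain Ω := by
  rintro z ⟨hz, hD⟩
  by_cases hU : z ∈ upperHalf Ω
  · exact upperHalf_subset_slitDomain hU
  have hf : z ∈ frontier (upperHalf Ω) := by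
    rw [(isOpen_upperHalf hΩ).frontier_eq]; exact ⟨hz, hU⟩
  have hN : z ∈ neumannPart a := by
    by_contra hN
    exact hD (subset_closure ⟨hf, hN⟩)
  obtain ⟨h1, h2, h3⟩ := hN
  refine ⟨(mem_of_real ha h3).2 ⟨by linarith, lt_of_le_of_ne h2 fun h => hD ?_⟩, Or.inl h1⟩
  have : z = ((a / 2 : ℝ) : ℂ) := by
    apply Complex.ext <;> simp [h3, h]
  rw [this]
  exact corner_mem_closure hΩ hconv h0 hΩ₂ ha

/-- On the half-domain, a function vanishing near the Dirichlet part coincides with a test function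
of the slit domain. -/
theorem exists_testFunction_eqOn (hΩ : IsOpen Ω) (hconv : Convex ℝ Ω) (h0 : (0 : ℂ) ∈ Ω)
    (hΩ₂ : ∀ z ∈ Ω, sigma₂ z ∈ Ω)
    (ha : Ω ∩ {z | z.im = 0} = {z | -(a / 2) < z.re ∧ z.re < a / 2 ∧ z.im = 0})
    {φ : ℂ → ℂ} (hφ : φ ∈ vanishingNear (dirichletPart Ω a)) :
    ∃ ψ ∈ testFunctions (slitDomain Ω), Set.EqOn ψ φ (upperHalf Ω) := by
  obtain ⟨h1, h2, h3⟩ := hφ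
  have hK : IsClosed (tsupport φ ∩ closure (upperHalf Ω)) :=
    (isClosed_tsupport φ).inter isClosed_closure
  have hKV : tsupport φ ∩ closure (upperHalf Ω) ⊆ slitDomain Ω := fun z hz =>
    closure_upperHalf_subset hΩ hconv h0 hΩ₂ ha ⟨hz.2, Set.disjoint_left.1 h3 hz.1⟩
  obtain ⟨W, hW, hKW, hWV⟩ := normal_exists_closure_subset hK (isOpen_slitDomain hΩ) hKV
  obtain ⟨χ, hχ0, hχ1, -⟩ := exists_contMDiffMap_zero_one_of_isClosed (n := ⊤)
    (modelWithCornersSelf ℝ ℂ) hW.isClosed_compl hK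
    (Set.disjoint_left.2 fun z hz h => hz (hKW h))
  have hχs : ContDiff ℝ ∞ χ := χ.contMDiff.contDiff
  refine ⟨fun z => (χ z : ℂ) * φ z,
    ⟨(Complex.ofRealCLM.contDiff.comp hχs).mul h1, h2.mul_left, ?_⟩, fun z hz => ?_⟩
  · refine (closure_mono fun z hz => ?_).trans hWV
    by_contra hzW
    have h0 : χ z = 0 := hχ0 hzW
    exact hz (by simp [h0])
  · by_cases h : φ z = 0
    · simp [h]
    · have h1 : χ z = 1 := hχ1 ⟨subset_tsupport φ h, subset_closure hz⟩
      simp [h1]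

end Geometry

/-! ### Approximation by smooth even functions -/

section EvenApproximation

variable {Ω : Set ℂ} {ε : ℝ}

/-- A smooth version `(x, y) ↦ (x, √(y² + ε²))` of the folding map `(x, y) ↦ (x, |y|)`. -/
def smoothFold (ε : ℝ) (z : ℂ) : ℂ := z.re + √(z.im ^ 2 + ε ^ 2) * Complex.I

theorem smoothFold_re (z : ℂ) : (smoothFold ε z).re = z.re := by simp [smoothFold]

theorem smoothFold_im (z : ℂ) : (smoothFold ε z).im = √(z.im ^ 2 + ε ^ 2) := by simp [smoothFold]

theorem smoothFold_sigma₂ (z : ℂ) : smoothFold ε (sigma₂ z) = smoothFold ε z := by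
  simp [smoothFold]

theorem sq_add_sq_pos (hε : 0 < ε) (y : ℝ) : 0 < y ^ 2 + ε ^ 2 := by positivity

theorem contDiff_smoothFold (hε : 0 < ε) : ContDiff ℝ ∞ (smoothFold ε) := by
  have h1 : ContDiff ℝ ∞ fun z : ℂ => (z.re : ℂ) :=
    Complex.ofRealCLM.contDiff.comp Complex.reCLM.contDiff
  have h2 : ContDiff ℝ ∞ fun z : ℂ => √(z.im ^ 2 + ε ^ 2) := by
    have h3 : ContDiff ℝ ∞ fun z : ℂ => z.im ^ 2 + ε ^ 2 :=
      (Complex.imCLM.contDiff.pow 2).add contDiff_const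
    exact h3.sqrt fun z => (sq_add_sq_pos hε z.im).ne'
  exact h1.add ((Complex.ofRealCLM.contDiff.comp h2).mul contDiff_const)

theorem hasFDerivAt_smoothFold (hε : 0 < ε) (z : ℂ) :
    HasFDerivAt (smoothFold ε) (Complex.ofRealCLM ∘L Complex.reCLM +
      (z.im / √(z.im ^ 2 + ε ^ 2)) • Complex.I • (Complex.ofRealCLM ∘L Complex.imCLM)) z := by
  have h1 : HasFDerivAt (fun z : ℂ => (z.re : ℂ)) (Complex.ofRealCLM ∘L Complex.reCLM) z :=
    (Complex.ofRealCLM ∘L Complex.reCLM).hasFDerivAt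
  have h2 : HasDerivAt (fun y : ℝ => √(y ^ 2 + ε ^ 2)) (z.im / √(z.im ^ 2 + ε ^ 2)) z.im := by
    have h3 : HasDerivAt (fun y : ℝ => y ^ 2 + ε ^ 2) (2 * z.im) z.im := by
      simpa using (hasDerivAt_pow 2 z.im).add_const (ε ^ 2)
    convert h3.sqrt (sq_add_sq_pos hε z.im).ne' using 1
    rw [mul_div_mul_left _ _ two_ne_zero]
  have h4 := (Complex.ofRealCLM.hasFDerivAt.comp z
    (h2.comp_hasFDerivAt z Complex.imCLM.hasFDerivAt)).mul_const Complex.I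
  refine (h1.add h4).congr_fderiv ?_
  ext v
  simp
  ring

theorem partialX_comp_smoothFold (hε : 0 < ε) {ψ : ℂ → ℂ} (hψ : Differentiable ℝ ψ) (z : ℂ) :
    partialX (ψ ∘ smoothFold ε) z = partialX ψ (smoothFold ε z) := by
  rw [partialX, ((hψ _).hasFDerivAt.comp z (hasFDerivAt_smoothFold hε z)).fderiv, partialX]
  simp

theorem partialY_comp_smoothFold (hε : 0 < ε) {ψ : ℂ → ℂ} (hψ : Differentiable ℝ ψ) (z : ℂ) :
    partialY (ψ ∘ smoothFold ε) z =
      (z.im / √(z.im ^ 2 + ε ^ 2) : ℝ) * partialY ψ (smoothFold ε z) := by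
  rw [partialY, ((hψ _).hasFDerivAt.comp z (hasFDerivAt_smoothFold hε z)).fderiv, partialY,
    ← Complex.real_smul, ← map_smul, ContinuousLinearMap.comp_apply]
  congr 1
  simp

theorem norm_le_norm_smoothFold (z : ℂ) : ‖z‖ ≤ ‖smoothFold ε z‖ := by
  rw [Complex.norm_eq_sqrt_sq_add_sq, Complex.norm_eq_sqrt_sq_add_sq, smoothFold_re,
    smoothFold_im, Real.sq_sqrt (by positivity)]
  exact Real.sqrt_le_sqrt (by nlinarith [sq_nonneg ε])

theorem dist_smoothFold_le (hε : 0 < ε) (z : ℂ) :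
    dist (⟨z.re, |z.im|⟩ : ℂ) (smoothFold ε z) ≤ ε := by
  rw [Complex.dist_of_re_eq (z := ⟨z.re, |z.im|⟩) (smoothFold_re z).symm, smoothFold_im, Real.dist_eq, abs_sub_comm]
  have h1 : |z.im| ≤ √(z.im ^ 2 + ε ^ 2) := Real.abs_le_sqrt (by nlinarith [sq_nonneg ε])
  rw [abs_of_nonneg (by linarith), sub_le_iff_le_add, Real.sqrt_le_left (by positivity)]
  nlinarith [sq_abs z.im, abs_nonneg z.im]

theorem abs_div_sqrt_le_one (hε : 0 < ε) (y : ℝ) : |y / √(y ^ 2 + ε ^ 2)| ≤ 1 := by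
  rw [abs_div, abs_of_pos (Real.sqrt_pos.2 (sq_add_sq_pos hε y))]
  exact div_le_one_of_le₀ (Real.abs_le_sqrt (by nlinarith [sq_nonneg ε])) (Real.sqrt_nonneg _)

theorem comp_smoothFold_mem_testFunctions (hΩ₂ : ∀ z ∈ Ω, sigma₂ z ∈ Ω) (hε : 0 < ε)
    {ψ : ℂ → ℂ} (hψ : ψ ∈ testFunctions (slitDomain Ω))
    (hth : Metric.cthickening ε (tsupport ψ) ⊆ slitDomain Ω) :
    ψ ∘ smoothFold ε ∈ testFunctions (slitDomain Ω) := by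
  have hc : Continuous (smoothFold ε) := (contDiff_smoothFold hε).continuous
  have hs : tsupport (ψ ∘ smoothFold ε) ⊆ smoothFold ε ⁻¹' tsupport ψ :=
    tsupport_comp_subset_preimage ψ hc
  refine ⟨hψ.1.comp (contDiff_smoothFold hε), ?_, hs.trans fun z hz => ?_⟩
  · obtain ⟨R, hR⟩ := hψ.2.1.isBounded.exists_norm_le
    refine Metric.isCompact_of_isClosed_isBounded (isClosed_tsupport _) ?_
    exact isBounded_iff_forall_norm_le.2
      ⟨R, fun z hz => (norm_le_norm_smoothFold z).trans (hR _ (hs hz))⟩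
  · have h1 : (⟨z.re, |z.im|⟩ : ℂ) ∈ slitDomain Ω :=
      hth (Metric.mem_cthickening_of_dist_le _ _ _ _ hz (dist_smoothFold_le hε z))
    rcases abs_choice z.im with h | h
    · rwa [h] at h1
    · rw [h] at h1
      exact (sigma₂_sigma₂ z) ▸ sigma₂_mem_slitDomain hΩ₂ _ h1

/-- The test functions of the slit domain which are even in `y`. -/
def evenTestFunctions (Ω : Set ℂ) : Set (ℂ → ℂ) :=
  {ψ | ψ ∈ testFunctions (slitDomain Ω) ∧ ψ ∘ sigma₂ = ψ}

theorem exists_bound_of_mem {W : Set ℂ} {ψ : ℂ → ℂ} (hψ : ψ ∈ testFunctions W) :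
    ∃ C, ∀ z, ‖ψ z‖ ≤ C :=
  hψ.2.1.exists_bound_of_continuous hψ.1.continuous

/-- On the half-domain, test functions of the slit domain are limits of even ones. -/
theorem exists_even_approximation (hΩ : IsOpen Ω) (hΩ₂ : ∀ z ∈ Ω, sigma₂ z ∈ Ω)
    [IsFiniteMeasure (volume.restrict (upperHalf Ω))] {ψ : ℂ → ℂ}
    (hψ : ψ ∈ testFunctions (slitDomain Ω)) :
    ∃ η : ℕ → ℂ → ℂ, (∀ k, η k ∈ evenTestFunctions Ω) ∧
      Tendsto (fun k => eLpNorm (η k - ψ) 2 (volume.restrict (upperHalf Ω))) atTop (𝓝 0) ∧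
      Tendsto (fun k => eLpNorm (partialX (η k) - partialX ψ) 2
        (volume.restrict (upperHalf Ω))) atTop (𝓝 0) ∧
      Tendsto (fun k => eLpNorm (partialY (η k) - partialY ψ) 2
        (volume.restrict (upperHalf Ω))) atTop (𝓝 0) := by
  obtain ⟨δ, hδ, hth⟩ := hψ.2.1.isCompact.exists_cthickening_subset_open (isOpen_slitDomain hΩ)
    hψ.2.2
  have hε0 : ∀ k : ℕ, 0 < δ / (k + 1) := fun k => by positivity
  have hεδ : ∀ k : ℕ, δ / (k + 1) ≤ δ := fun k =>
    div_le_self hδ.le (by linarith [(Nat.cast_nonneg k : (0 : ℝ) ≤ k)])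
  have hmem : ∀ k : ℕ, ψ ∘ smoothFold (δ / (k + 1)) ∈ testFunctions (slitDomain Ω) := fun k =>
    comp_smoothFold_mem_testFunctions hΩ₂ (hε0 k) hψ
      ((Metric.cthickening_mono (hεδ k) _).trans hth)
  have hεlim : Tendsto (fun k : ℕ => δ / ((k : ℝ) + 1)) atTop (𝓝 0) := by
    simpa [div_eq_mul_inv] using tendsto_one_div_add_atTop_nhds_zero_nat.const_mul δ
  have hsq : ∀ y : ℝ, 0 < y → Tendsto (fun k : ℕ => √(y ^ 2 + (δ / ((k : ℝ) + 1)) ^ 2)) atTop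
      (𝓝 y) := by
    intro y hy
    have := ((hεlim.pow 2).const_add (y ^ 2)).sqrt
    simpa [Real.sqrt_sq hy.le] using this
  have hfold : ∀ z : ℂ, 0 < z.im →
      Tendsto (fun k : ℕ => smoothFold (δ / ((k : ℝ) + 1)) z) atTop (𝓝 z) := by
    intro z hz
    have h1 := ((Complex.continuous_ofReal.tendsto _).comp (hsq _ hz)).mul_const Complex.I
    have h2 := h1.const_add (z.re : ℂ)
    rw [Complex.re_add_im] at h2
    exact h2
  have hpos : ∀ᵐ z ∂(volume.restrict (upperHalf Ω)), 0 < z.im :=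
    (ae_restrict_mem (isOpen_upperHalf hΩ).measurableSet).mono fun z hz => hz.2
  have hX := partialX_mem_testFunctions hψ
  have hY := partialY_mem_testFunctions hψ
  have dψ := differentiable_of_mem hψ
  refine ⟨fun k => ψ ∘ smoothFold (δ / (k + 1)), fun k => ⟨hmem k, ?_⟩, ?_, ?_, ?_⟩
  · funext z
    simp [smoothFold_sigma₂]
  · obtain ⟨C, hC⟩ := exists_bound_of_mem hψ
    refine tendsto_eLpNorm_of_bounded (C := C + C) (fun k => (memLp_of_mem (hmem k) _).1)
      (memLp_of_mem hψ _).1 (fun k => .of_forall fun z => ?_) ?_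
    · exact (norm_sub_le _ _).trans (add_le_add (hC _) (hC _))
    · filter_upwards [hpos] with z hz
      exact (hψ.1.continuous.tendsto z).comp (hfold z hz)
  · obtain ⟨C, hC⟩ := exists_bound_of_mem hX
    refine tendsto_eLpNorm_of_bounded (C := C + C)
      (fun k => (memLp_of_mem (partialX_mem_testFunctions (hmem k)) _).1)
      (memLp_of_mem hX _).1 (fun k => .of_forall fun z => ?_) ?_
    · rw [partialX_comp_smoothFold (hε0 k) dψ]
      exact (norm_sub_le _ _).trans (add_le_add (hC _) (hC _))
    · filter_upwards [hpos] with z hz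
      simp only [fun k : ℕ => partialX_comp_smoothFold (hε0 k) dψ z]
      exact (hX.1.continuous.tendsto z).comp (hfold z hz)
  · obtain ⟨C, hC⟩ := exists_bound_of_mem hY
    refine tendsto_eLpNorm_of_bounded (C := C + C)
      (fun k => (memLp_of_mem (partialY_mem_testFunctions (hmem k)) _).1)
      (memLp_of_mem hY _).1 (fun k => .of_forall fun z => ?_) ?_
    · rw [partialY_comp_smoothFold (hε0 k) dψ]
      refine (norm_sub_le _ _).trans (add_le_add ?_ (hC _))
      rw [norm_mul, Complex.norm_real, Real.norm_eq_abs]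
      exact (mul_le_of_le_one_left (norm_nonneg _) (abs_div_sqrt_le_one (hε0 k) _)).trans (hC _)
    · filter_upwards [hpos] with z hz
      simp only [fun k : ℕ => partialY_comp_smoothFold (hε0 k) dψ z]
      have h1 : Tendsto (fun k : ℕ => ((z.im / √(z.im ^ 2 + (δ / ((k : ℝ) + 1)) ^ 2) : ℝ) : ℂ))
          atTop (𝓝 1) := by
        have := tendsto_const_nhds (x := z.im) |>.div (hsq _ hz) hz.ne'
        rw [div_self hz.ne'] at this
        exact_mod_cast (Complex.continuous_ofReal.tendsto _).comp this
      have h2 := h1.mul ((hY.1.continuous.tendsto z).comp (hfold z hz))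
      rwa [one_mul] at h2

end EvenApproximation

/-! ### Cutting off along the slit -/

section SlitCutoff

variable {Ω : Set ℂ} {φ : ℂ → ℂ}

/-- A bump function on the line, equal to `1` on `[-1, 1]` and supported in `[-2, 2]`. -/
def lineBump : ContDiffBump (0 : ℝ) := ⟨1, 2, one_pos, one_lt_two⟩

/-- A cutoff function which vanishes for `x ≤ -1/M`, `|y| ≤ 1/c`, and is equal to `1` if `x ≥ 0` or
`|y| ≥ 2/c`. -/
def slitCutoff (M c : ℝ) (z : ℂ) : ℂ :=
  ((1 - lineBump (c * z.im) * Real.smoothTransition (-M * z.re) : ℝ) : ℂ)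

theorem contDiff_slitCutoff (M c : ℝ) : ContDiff ℝ ∞ (slitCutoff M c) := by
  have h1 : ContDiff ℝ ∞ fun z : ℂ => lineBump (c * z.im) :=
    lineBump.contDiff.comp (contDiff_const.mul Complex.imCLM.contDiff)
  have h2 : ContDiff ℝ ∞ fun z : ℂ => Real.smoothTransition (-M * z.re) :=
    (Real.smoothTransition.contDiff (n := ⊤)).comp (contDiff_const.mul Complex.reCLM.contDiff)
  exact Complex.ofRealCLM.contDiff.comp (contDiff_const.sub (h1.mul h2))

theorem hasFDerivAt_slitCutoff (M c : ℝ) (z : ℂ) :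
    HasFDerivAt (slitCutoff M c) (Complex.ofRealCLM ∘L
      (-(lineBump (c * z.im) • deriv Real.smoothTransition (-M * z.re) • (-M) • Complex.reCLM +
        Real.smoothTransition (-M * z.re) • deriv lineBump (c * z.im) • c • Complex.imCLM))) z := by
  have h1 : HasFDerivAt (fun z : ℂ => lineBump (c * z.im))
      (deriv lineBump (c * z.im) • c • Complex.imCLM) z :=
    ((lineBump.contDiff (n := 1)).differentiable one_ne_zero _).hasDerivAt.comp_hasFDerivAt z
      (Complex.imCLM.hasFDerivAt.const_mul c)
  have h2 : HasFDerivAt (fun z : ℂ => Real.smoothTransition (-M * z.re))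
      (deriv Real.smoothTransition (-M * z.re) • (-M) • Complex.reCLM) z :=
    ((Real.smoothTransition.contDiff (n := 1)).differentiable one_ne_zero
      _).hasDerivAt.comp_hasFDerivAt z (Complex.reCLM.hasFDerivAt.const_mul (-M))
  exact Complex.ofRealCLM.hasFDerivAt.comp z ((h1.mul h2).const_sub 1)

theorem partialX_slitCutoff (M c : ℝ) (z : ℂ) : partialX (slitCutoff M c) z =
    ((M * lineBump (c * z.im) * deriv Real.smoothTransition (-M * z.re) : ℝ) : ℂ) := by
  rw [partialX, (hasFDerivAt_slitCutoff M c z).fderiv]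
  simp
  ring

theorem partialY_slitCutoff (M c : ℝ) (z : ℂ) : partialY (slitCutoff M c) z =
    ((-(Real.smoothTransition (-M * z.re) * (c * deriv lineBump (c * z.im))) : ℝ) : ℂ) := by
  rw [partialY, (hasFDerivAt_slitCutoff M c z).fderiv]
  simp [-mul_eq_mul_left_iff, -mul_eq_mul_right_iff]
  ring

theorem norm_slitCutoff_le (M c : ℝ) (z : ℂ) : ‖slitCutoff M c z‖ ≤ 1 := by
  rw [slitCutoff, Complex.norm_real, Real.norm_eq_abs, abs_le]
  have h1 := lineBump.nonneg (x := c * z.im)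
  have h2 := lineBump.le_one (x := c * z.im)
  have h3 := Real.smoothTransition.nonneg (-M * z.re)
  have h4 := Real.smoothTransition.le_one (-M * z.re)
  constructor <;> nlinarith [mul_nonneg h1 h3, mul_le_one₀ h2 h3 h4]

/-- The scale-invariant bound which controls `|y| ∂_y` of the cutoff, uniformly in its width. -/
theorem exists_bound_mul_deriv_lineBump : ∃ C, ∀ t, |t * deriv lineBump t| ≤ C := by
  have h1 : Continuous fun t => t * deriv lineBump t :=
    continuous_id.mul ((lineBump.contDiff (n := 1)).continuous_deriv le_rfl)
  exact (lineBump.hasCompactSupport.deriv.mul_left).exists_bound_of_continuous h1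

theorem slitCutoff_eventuallyEq_one {M c : ℝ} {z : ℂ} (h : 2 < c * z.im) :
    slitCutoff M c =ᶠ[𝓝 z] fun _ => 1 := by
  have hc : Continuous fun z : ℂ => c * z.im := continuous_const.mul Complex.continuous_im
  filter_upwards [hc.continuousAt.eventually_const_lt h] with z' hz'
  have h0 : lineBump (c * z'.im) = 0 := lineBump.zero_of_le_dist (by
    rw [Real.dist_eq, sub_zero]
    exact hz'.le.trans (le_abs_self _))
  simp [slitCutoff, h0]

theorem slitCutoff_eventuallyEq_zero {M c : ℝ} {z : ℂ} (hre : 1 < -M * z.re)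
    (him : z.im = 0) : slitCutoff M c =ᶠ[𝓝 z] fun _ => 0 := by
  have hc : Continuous fun z : ℂ => |c * z.im| :=
    (continuous_const.mul Complex.continuous_im).abs
  have hc' : Continuous fun z : ℂ => -M * z.re := continuous_const.mul Complex.continuous_re
  filter_upwards [(hc.tendsto z).eventually_lt_const (u := 1) (by simp [him]),
    (hc'.tendsto z).eventually_const_lt hre] with z' h1 h2
  have h3 : lineBump (c * z'.im) = 1 := lineBump.one_of_mem_closedBall (by
    rw [mem_closedBall_zero_iff]; exact h1.le)
  rw [slitCutoff, h3, Real.smoothTransition.one_of_one_le h2.le]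
  simp

/-- Since `φ` vanishes for `|z| < δ` and the cutoff near the points of the slit with `|z| ≥ δ`, the
product extends smoothly across the slit, where the gauge factor jumps. -/
theorem slitCutoff_mul_mem_testFunctions {M c δ : ℝ}
    (hφ : φ ∈ testFunctions (punctured Ω)) (hδ : 0 < δ) (hM : 1 < M * δ)
    (hsupp : ∀ z ∈ tsupport φ, δ ≤ ‖z‖) :
    (fun z => slitCutoff M c z * gaugeDown φ z) ∈ testFunctions (slitDomain Ω) := by
  set η : ℂ → ℂ := fun z => slitCutoff M c z * gaugeDown φ z with hη
  have hM0 : 0 < M := by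
    by_contra h
    nlinarith
  have hnot : ∀ z ∉ Complex.slitPlane, η =ᶠ[𝓝 z] fun _ => 0 := by
    intro z hz
    rw [Complex.mem_slitPlane_iff, not_or, not_not, not_lt] at hz
    by_cases hs : z ∈ tsupport φ
    · have hn : ‖z‖ = -z.re := by
        have e : z = (z.re : ℂ) := Complex.ext rfl (by simp [hz.2])
        rw [e, Complex.norm_real, Real.norm_eq_abs, abs_of_nonpos hz.1, Complex.ofReal_re]
      have h1 := hsupp z hs
      rw [hn] at h1
      filter_upwards [slitCutoff_eventuallyEq_zero (M := M) (c := c) (by nlinarith) hz.2]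
        with z' hz'
      simp [hη, hz']
    · filter_upwards [notMem_tsupport_iff_eventuallyEq.1 hs] with z' hz'
      simp [hη, gaugeDown_apply, hz']
  have hsub : tsupport η ⊆ tsupport φ := closure_mono fun z hz h => hz (by
    simp [hη, gaugeDown_apply, h])
  refine ⟨contDiff_iff_contDiffAt.2 fun z => ?_, hφ.2.1.of_isClosed_subset (isClosed_tsupport _)
    hsub, fun z hz => ⟨(hφ.2.2 (hsub hz)).1, ?_⟩⟩
  · by_cases hz : z ∈ Complex.slitPlane
    · have h1 : ContDiffAt ℝ ∞ phase z :=
        contDiffOn_phase.contDiffAt (Complex.isOpen_slitPlane.mem_nhds hz)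
      have h2 : ContDiffAt ℝ ∞ (fun z => conj (phase z)) z :=
        Complex.conjCLE.contDiff.contDiffAt.comp z h1
      have h3 : η = fun z => slitCutoff M c z * (conj (phase z) * φ z) := by
        funext z; rw [hη]; simp only [gaugeDown_apply]
      rw [h3]
      exact (contDiff_slitCutoff M c).contDiffAt.mul (h2.mul hφ.1.contDiffAt)
    · exact contDiffAt_const.congr_of_eventuallyEq (hnot z hz)
  · by_contra hz'
    exact notMem_tsupport_iff_eventuallyEq.2 (hnot z hz') hz

/-- If a test function of the punctured domain vanishes on the slit, then on the half-domain its
gauge transform is a limit in `H¹` of test functions of the slit domain. The cutoff costs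
a gradient of size `1/|y|` near the slit, which is compensated by the vanishing of `φ` there. -/
theorem exists_slit_approximation (hΩ : IsOpen Ω)
    [IsFiniteMeasure (volume.restrict (upperHalf Ω))]
    (hφ : φ ∈ testFunctions (punctured Ω)) (hslit : ∀ x : ℝ, x < 0 → φ x = 0) :
    ∃ η : ℕ → ℂ → ℂ, (∀ k, η k ∈ testFunctions (slitDomain Ω)) ∧
      Tendsto (fun k => eLpNorm (η k - gaugeDown φ) 2 (volume.restrict (upperHalf Ω)))
        atTop (𝓝 0) ∧
      Tendsto (fun k => eLpNorm (partialX (η k) - partialX (gaugeDown φ)) 2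
        (volume.restrict (upperHalf Ω))) atTop (𝓝 0) ∧
      Tendsto (fun k => eLpNorm (partialY (η k) - partialY (gaugeDown φ)) 2
        (volume.restrict (upperHalf Ω))) atTop (𝓝 0) := by
  have h0 : (0 : ℂ) ∉ tsupport φ := fun h => (hφ.2.2 h).2 rfl
  obtain ⟨δ, hδ, hball⟩ := Metric.isOpen_iff.1 (isClosed_tsupport φ).isOpen_compl 0 h0
  have hsupp : ∀ z ∈ tsupport φ, δ ≤ ‖z‖ := by
    intro z hz
    by_contra h
    exact hball (mem_ball_zero_iff.2 (not_le.1 h)) hz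
  -- The cutoff has to be complete for `x ≤ -δ`, and the transition in `x` ends at `-1/M`.
  set M := 2 / δ with hM
  have hMδ : 1 < M * δ := by rw [hM, div_mul_cancel₀ _ hδ.ne']; norm_num
  have hM0 : 0 < M := by positivity
  set η : ℕ → ℂ → ℂ := fun k z => slitCutoff M (k + 1) z * gaugeDown φ z with hη
  have hmem : ∀ k, η k ∈ testFunctions (slitDomain Ω) := fun k =>
    slitCutoff_mul_mem_testFunctions hφ hδ hMδ hsupp
  have hU := ae_restrict_mem (μ := volume) (isOpen_upperHalf hΩ).measurableSet
  have hW := isOpen_punctured hΩ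
  have hX := magneticX_mem_testFunctions hW zero_notMem_punctured hφ
  have hY := magneticY_mem_testFunctions hW zero_notMem_punctured hφ
  have dφ := differentiable_of_mem hφ
  have mI : Measurable fun z => Complex.I * conj (phase z) :=
    (Complex.continuous_conj.measurable.comp measurable_phase).const_mul _
  have eX : ∀ᵐ z ∂(volume.restrict (upperHalf Ω)),
      partialX (gaugeDown φ) z = Complex.I * conj (phase z) * magneticX φ z := by
    filter_upwards [hU] with z hz
    exact partialX_gaugeDown (upperHalf_subset_slitPlane hz) (dφ z)
  have eY : ∀ᵐ z ∂(volume.restrict (upperHalf Ω)),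
      partialY (gaugeDown φ) z = Complex.I * conj (phase z) * magneticY φ z := by
    filter_upwards [hU] with z hz
    exact partialY_gaugeDown (upperHalf_subset_slitPlane hz) (dφ z)
  have m0 : AEStronglyMeasurable (gaugeDown φ) (volume.restrict (upperHalf Ω)) := by
    have e : gaugeDown φ = fun z => conj (phase z) * φ z := funext (gaugeDown_apply φ)
    rw [e]
    exact ((Complex.continuous_conj.measurable.comp
      measurable_phase).aestronglyMeasurable).mul (memLp_of_mem hφ _).1
  have mX : AEStronglyMeasurable (partialX (gaugeDown φ)) (volume.restrict (upperHalf Ω)) :=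
    (mI.aestronglyMeasurable.mul (memLp_of_mem hX _).1).congr (eX.mono fun z hz => hz.symm)
  have mY : AEStronglyMeasurable (partialY (gaugeDown φ)) (volume.restrict (upperHalf Ω)) :=
    (mI.aestronglyMeasurable.mul (memLp_of_mem hY _).1).congr (eY.mono fun z hz => hz.symm)
  -- At a given point of the half-domain the cutoff is eventually inactive.
  have hev : ∀ z ∈ upperHalf Ω, ∀ᶠ k : ℕ in atTop, η k =ᶠ[𝓝 z] gaugeDown φ := by
    intro z hz
    have hz' : 0 < z.im := hz.2
    obtain ⟨N, hN⟩ := exists_nat_gt (2 / z.im)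
    filter_upwards [eventually_ge_atTop N] with k hk
    have h1 : (2 : ℝ) < (k + 1) * z.im := by
      rw [div_lt_iff₀ hz'] at hN
      have : (N : ℝ) ≤ k := by exact_mod_cast hk
      nlinarith
    filter_upwards [slitCutoff_eventuallyEq_one (M := M) h1] with z' hz'
    simp [hη, hz']
  obtain ⟨C0, hC0⟩ := exists_bound_of_mem hφ
  obtain ⟨CX, hCX⟩ := exists_bound_of_mem hX
  obtain ⟨CY, hCY⟩ := exists_bound_of_mem hY
  have hmul : ∀ (c : ℝ) (w : ℂ) (z : ℂ), ‖slitCutoff M c z * w - w‖ ≤ 2 * ‖w‖ := by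
    intro c w z
    refine (norm_sub_le _ _).trans ?_
    rw [norm_mul]
    nlinarith [norm_slitCutoff_le M c z, norm_nonneg w]
  have hphase : ∀ (w z : ℂ), ‖Complex.I * conj (phase z) * w‖ = ‖w‖ := by
    intro w z; simp [norm_phase]
  refine ⟨η, hmem, ?_, ?_, ?_⟩
  · refine tendsto_eLpNorm_of_bounded (C := 2 * C0) (fun k => (memLp_of_mem (hmem k) _).1) m0
      (fun k => .of_forall fun z => ?_) ?_
    · refine (hmul _ _ _).trans ?_
      rw [norm_gaugeDown]
      linarith [hC0 z]
    · filter_upwards [hU] with z hz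
      exact tendsto_const_nhds.congr' ((hev z hz).mono fun k hk => hk.eq_of_nhds.symm)
  · have hρ : Continuous fun z : ℂ => deriv Real.smoothTransition (-M * z.re) :=
      ((Real.smoothTransition.contDiff (n := 1)).continuous_deriv le_rfl).comp
        (continuous_const.mul Complex.continuous_re)
    obtain ⟨C1, hC1⟩ := (hφ.2.1.mul_left (f := fun z : ℂ =>
      ((deriv Real.smoothTransition (-M * z.re) : ℝ) : ℂ))).exists_bound_of_continuous
      ((Complex.continuous_ofReal.comp hρ).mul hφ.1.continuous)
    refine tendsto_eLpNorm_of_bounded (C := M * C1 + 2 * CX)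
      (fun k => (memLp_of_mem (partialX_mem_testFunctions (hmem k)) _).1) mX (fun k => ?_) ?_
    · filter_upwards [hU, eX] with z hz hzX
      have hs := upperHalf_subset_slitPlane hz
      have h1 : partialX (η k) z = partialX (slitCutoff M (k + 1)) z * gaugeDown φ z +
          slitCutoff M (k + 1) z * partialX (gaugeDown φ) z :=
        partialX_mul (hasFDerivAt_slitCutoff _ _ z).differentiableAt
          (differentiableAt_gaugeDown hs (dφ z))
      rw [h1, add_sub_assoc]
      refine (norm_add_le _ _).trans (add_le_add ?_ ?_)
      · rw [partialX_slitCutoff, norm_mul, norm_gaugeDown, Complex.norm_real, norm_mul, norm_mul,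
          Real.norm_of_nonneg hM0.le, Real.norm_of_nonneg lineBump.nonneg]
        have h2 := hC1 z
        rw [Pi.mul_apply, norm_mul, Complex.norm_real] at h2
        calc M * lineBump ((k + 1) * z.im) * ‖deriv Real.smoothTransition (-M * z.re)‖ * ‖φ z‖
            = lineBump ((k + 1) * z.im) *
              (M * (‖deriv Real.smoothTransition (-M * z.re)‖ * ‖φ z‖)) := by ring
          _ ≤ 1 * (M * C1) := by
            gcongr
            exact lineBump.le_one
          _ = M * C1 := one_mul _
      · refine (hmul _ _ _).trans ?_
        rw [hzX, hphase]
        linarith [hCX z]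
    · filter_upwards [hU] with z hz
      exact tendsto_const_nhds.congr' ((hev z hz).mono fun k hk => (partialX_congr hk).symm)
  · obtain ⟨L, hL⟩ := hφ.1.lipschitzWith_of_hasCompactSupport hφ.2.1 (by simp)
    obtain ⟨C1, hC1⟩ := exists_bound_mul_deriv_lineBump
    refine tendsto_eLpNorm_of_bounded (C := L * C1 + 2 * CY)
      (fun k => (memLp_of_mem (partialY_mem_testFunctions (hmem k)) _).1) mY (fun k => ?_) ?_
    · filter_upwards [hU, eY] with z hz hzY
      have hs := upperHalf_subset_slitPlane hz
      have h1 : partialY (η k) z = partialY (slitCutoff M (k + 1)) z * gaugeDown φ z +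
          slitCutoff M (k + 1) z * partialY (gaugeDown φ) z :=
        partialY_mul (hasFDerivAt_slitCutoff _ _ z).differentiableAt
          (differentiableAt_gaugeDown hs (dφ z))
      rw [h1, add_sub_assoc]
      refine (norm_add_le _ _).trans (add_le_add ?_ ?_)
      · have hC10 : 0 ≤ C1 := (abs_nonneg _).trans (hC1 0)
        rw [partialY_slitCutoff, norm_mul, norm_gaugeDown, Complex.norm_real, norm_neg, norm_mul,
          Real.norm_of_nonneg (Real.smoothTransition.nonneg _)]
        rcases le_or_gt 0 z.re with hre | hre
        · rw [Real.smoothTransition.zero_of_nonpos (by nlinarith)]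
          simp only [zero_mul]
          positivity
        have h2 : ‖φ z‖ ≤ L * z.im := by
          have := hL.dist_le_mul z (z.re : ℂ)
          rw [hslit _ hre, dist_zero_right, Complex.dist_of_re_eq (by simp), Real.dist_eq,
            Complex.ofReal_im, sub_zero, abs_of_pos hz.2] at this
          exact this
        have hz2 : 0 < z.im := hz.2
        calc Real.smoothTransition (-M * z.re) * ‖((k : ℝ) + 1) * deriv lineBump ((k + 1) * z.im)‖ *
              ‖φ z‖
            ≤ 1 * ‖((k : ℝ) + 1) * deriv lineBump ((k + 1) * z.im)‖ * (L * z.im) := by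
              gcongr
              exact Real.smoothTransition.le_one _
          _ = L * |((k : ℝ) + 1) * z.im * deriv lineBump ((k + 1) * z.im)| := by
              rw [one_mul, Real.norm_eq_abs, abs_mul, abs_mul, abs_mul, abs_of_pos hz2]
              ring
          _ ≤ L * C1 := by
              gcongr
              exact hC1 _
      · refine (hmul _ _ _).trans ?_
        rw [hzY, hphase]
        linarith [hCY z]
    · filter_upwards [hU] with z hz
      exact tendsto_const_nhds.congr' ((hev z hz).mono fun k hk => (partialY_congr hk).symm)

end SlitCutoff

/-! ### From the magnetic Laplacian to the mixed problem and back -/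

section Correspondence

variable {Ω : Set ℂ} {a lam : ℝ} {u w f g : ℂ → ℂ} {μ : Measure ℂ}

theorem restrict_upperHalf_le :
    volume.restrict (upperHalf Ω) ≤ volume.restrict (punctured Ω) :=
  Measure.restrict_mono upperHalf_subset_punctured le_rfl

theorem memLp_mul_of_norm_eq_one {c : ℂ → ℂ} (hc : Measurable c) (h1 : ∀ z, ‖c z‖ = 1)
    (hf : MemLp f 2 μ) : MemLp (fun z => c z * f z) 2 μ :=
  ⟨hc.aestronglyMeasurable.mul hf.1, by
    rw [eLpNorm_congr_norm_ae (g := f) (.of_forall fun z => by simp [h1])]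
    exact hf.2⟩

theorem measurable_conj_phase : Measurable fun z => conj (phase z) :=
  Complex.continuous_conj.measurable.comp measurable_phase

theorem memLp_gaugeUp (hf : MemLp f 2 μ) : MemLp (gaugeUp f) 2 μ :=
  memLp_mul_of_norm_eq_one measurable_phase norm_phase hf

theorem memLp_gaugeDown (hf : MemLp f 2 μ) : MemLp (gaugeDown f) 2 μ := by
  have e : gaugeDown f = fun z => conj (phase z) * f z := funext (gaugeDown_apply f)
  rw [e]
  exact memLp_mul_of_norm_eq_one measurable_conj_phase (by simp [norm_phase]) hf

theorem memLp_I_mul_conj_phase_mul (hf : MemLp f 2 μ) :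
    MemLp (fun z => Complex.I * conj (phase z) * f z) 2 μ :=
  memLp_mul_of_norm_eq_one (measurable_conj_phase.const_mul _) (by simp [norm_phase]) hf

theorem l2inner_gaugeUp_left (f g : ℂ → ℂ) :
    l2inner μ (gaugeUp f) g = l2inner μ f (gaugeDown g) := by
  refine integral_congr_ae (.of_forall fun z => ?_)
  simp only [gaugeUp_apply, gaugeDown_apply, map_mul, Complex.conj_conj]
  ring

theorem l2inner_I_mul_conj_phase_left (f g : ℂ → ℂ) :
    l2inner μ (fun z => Complex.I * conj (phase z) * f z) g =
      l2inner μ f (fun z => -Complex.I * phase z * g z) := by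
  refine integral_congr_ae (.of_forall fun z => ?_)
  simp only [map_mul, map_neg, Complex.conj_I, neg_neg]
  ring

theorem l2inner_neg_I_mul_phase_left (f g : ℂ → ℂ) :
    l2inner μ (fun z => -Complex.I * phase z * f z) g =
      l2inner μ f (fun z => Complex.I * conj (phase z) * g z) := by
  refine integral_congr_ae (.of_forall fun z => ?_)
  simp only [map_mul, Complex.conj_conj, Complex.conj_I]
  ring

/-- A weak equation passes to `H¹` limits of the test functions. -/
theorem weak_equation_of_tendsto {g₁ g₂ ψ ψ₁ ψ₂ : ℂ → ℂ} {η η₁ η₂ : ℕ → ℂ → ℂ}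
    (hg₁ : MemLp g₁ 2 μ) (hg₂ : MemLp g₂ 2 μ) (hf : MemLp f 2 μ)
    (hη : ∀ k, MemLp (η k) 2 μ) (hη₁ : ∀ k, MemLp (η₁ k) 2 μ) (hη₂ : ∀ k, MemLp (η₂ k) 2 μ)
    (hψ : MemLp ψ 2 μ) (hψ₁ : MemLp ψ₁ 2 μ) (hψ₂ : MemLp ψ₂ 2 μ)
    (h0 : Tendsto (fun k => eLpNorm (η k - ψ) 2 μ) atTop (𝓝 0))
    (h1 : Tendsto (fun k => eLpNorm (η₁ k - ψ₁) 2 μ) atTop (𝓝 0))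
    (h2 : Tendsto (fun k => eLpNorm (η₂ k - ψ₂) 2 μ) atTop (𝓝 0))
    (heq : ∀ k, l2inner μ g₁ (η₁ k) + l2inner μ g₂ (η₂ k) = l2inner μ f (η k)) :
    l2inner μ g₁ ψ₁ + l2inner μ g₂ ψ₂ = l2inner μ f ψ :=
  tendsto_nhds_unique_of_eventuallyEq
    ((tendsto_l2inner_right hη₁ hψ₁ hg₁ h1).add (tendsto_l2inner_right hη₂ hψ₂ hg₂ h2))
    (tendsto_l2inner_right hη hψ hf h0) (.of_forall heq)

theorem exists_even_approximation_of_vanishingNear (hΩ : IsOpen Ω) (hconv : Convex ℝ Ω)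
    (h0 : (0 : ℂ) ∈ Ω) (hΩ₂ : ∀ z ∈ Ω, sigma₂ z ∈ Ω)
    (ha : Ω ∩ {z | z.im = 0} = {z | -(a / 2) < z.re ∧ z.re < a / 2 ∧ z.im = 0})
    [IsFiniteMeasure (volume.restrict (upperHalf Ω))] {φ : ℂ → ℂ}
    (hφ : φ ∈ vanishingNear (dirichletPart Ω a)) :
    ∃ η : ℕ → ℂ → ℂ, (∀ k, η k ∈ evenTestFunctions Ω) ∧
      Tendsto (fun k => eLpNorm (η k - φ) 2 (volume.restrict (upperHalf Ω))) atTop (𝓝 0) ∧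
      Tendsto (fun k => eLpNorm (partialX (η k) - partialX φ) 2
        (volume.restrict (upperHalf Ω))) atTop (𝓝 0) ∧
      Tendsto (fun k => eLpNorm (partialY (η k) - partialY φ) 2
        (volume.restrict (upperHalf Ω))) atTop (𝓝 0) := by
  obtain ⟨ψ, hψ, heq⟩ := exists_testFunction_eqOn hΩ hconv h0 hΩ₂ ha hφ
  obtain ⟨η, hη, l0, l1, l2⟩ := exists_even_approximation hΩ hΩ₂ hψ
  have hU := ae_restrict_mem (μ := volume) (isOpen_upperHalf hΩ).measurableSet
  have hloc : ∀ z ∈ upperHalf Ω, ψ =ᶠ[𝓝 z] φ := fun z hz =>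
    heq.eventuallyEq_of_mem ((isOpen_upperHalf hΩ).mem_nhds hz)
  refine ⟨η, hη, l0.congr fun k => eLpNorm_congr_ae ?_, l1.congr fun k => eLpNorm_congr_ae ?_,
    l2.congr fun k => eLpNorm_congr_ae ?_⟩
  · filter_upwards [hU] with z hz
    simp [(hloc z hz).eq_of_nhds]
  · filter_upwards [hU] with z hz
    simp [partialX_congr (hloc z hz)]
  · filter_upwards [hU] with z hz
    simp [partialY_congr (hloc z hz)]

theorem gaugeUp_mem_of_even (hΩ : IsOpen Ω) {ψ : ℂ → ℂ} (hψ : ψ ∈ evenTestFunctions Ω) :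
    gaugeUp ψ ∈ testFunctions (punctured Ω) :=
  testFunctions_mono slitDomain_subset_punctured
    (gaugeUp_mem_testFunctions (isOpen_slitDomain hΩ) Set.inter_subset_right hψ.1)

theorem twistedReflection_gaugeUp_of_even {ψ : ℂ → ℂ} (hψ : ψ ∘ sigma₂ = ψ) {z : ℂ}
    (hz : z ∈ Complex.slitPlane) : twistedReflection (gaugeUp ψ) z = gaugeUp ψ z := by
  rw [twistedReflection_gaugeUp _ hz, hψ]

theorem twistedReflection_magneticX_of_even (hΩ : IsOpen Ω) {ψ : ℂ → ℂ}
    (hψ : ψ ∈ evenTestFunctions Ω) {z : ℂ} (hz : z ∈ Complex.slitPlane) :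
    twistedReflection (magneticX (gaugeUp ψ)) z = magneticX (gaugeUp ψ) z := by
  rw [← magneticX_twistedReflection hz (differentiable_of_mem (gaugeUp_mem_of_even hΩ hψ) _)]
  refine magneticX_congr ?_
  filter_upwards [eventually_mem_slitPlane hz] with z' hz'
  exact twistedReflection_gaugeUp_of_even hψ.2 hz'

theorem twistedReflection_magneticY_of_even (hΩ : IsOpen Ω) {ψ : ℂ → ℂ}
    (hψ : ψ ∈ evenTestFunctions Ω) {z : ℂ} (hz : z ∈ Complex.slitPlane) :
    twistedReflection (magneticY (gaugeUp ψ)) z = -magneticY (gaugeUp ψ) z := by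
  rw [eq_neg_iff_add_eq_zero, ← neg_eq_zero, neg_add, ← sub_eq_add_neg, sub_eq_zero, ←
    magneticY_twistedReflection hz (differentiable_of_mem (gaugeUp_mem_of_even hΩ hψ) _)]
  refine magneticY_congr ?_
  filter_upwards [eventually_mem_slitPlane hz] with z' hz'
  exact twistedReflection_gaugeUp_of_even hψ.2 hz'

/-- The weak equation of an `S`-invariant eigenfunction, read in the half-domain, for even test
functions: both sides are twice the contribution of the half-domain. -/
theorem weak_equation_of_even (hΩ : IsOpen Ω) (hΩ₂ : ∀ z ∈ Ω, sigma₂ z ∈ Ω)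
    (hu : SolvesAB Ω lam u)
    (hS : twistedReflection u =ᵐ[volume.restrict (punctured Ω)] u)
    {φ : ℕ → ℂ → ℂ} {G₁ G₂ : ℂ → ℂ} (hφ : ∀ n, φ n ∈ testFunctions (punctured Ω))
    (hG₁ : MemLp G₁ 2 (volume.restrict (punctured Ω)))
    (hG₂ : MemLp G₂ 2 (volume.restrict (punctured Ω)))
    (hS₁ : twistedReflection G₁ = G₁) (hS₂ : twistedReflection G₂ = -G₂)
    (l0 : Tendsto (fun n => eLpNorm (φ n - u) 2 (volume.restrict (punctured Ω))) atTop (𝓝 0))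
    (l1 : Tendsto (fun n => eLpNorm (magneticX (φ n) - G₁) 2 (volume.restrict (punctured Ω)))
      atTop (𝓝 0))
    (l2 : Tendsto (fun n => eLpNorm (magneticY (φ n) - G₂) 2 (volume.restrict (punctured Ω)))
      atTop (𝓝 0)) {ψ : ℂ → ℂ} (hψ : ψ ∈ evenTestFunctions Ω) :
    l2inner (volume.restrict (upperHalf Ω)) (fun z => Complex.I * conj (phase z) * G₁ z)
        (partialX ψ) +
      l2inner (volume.restrict (upperHalf Ω)) (fun z => Complex.I * conj (phase z) * G₂ z)
        (partialY ψ) =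
      l2inner (volume.restrict (upperHalf Ω)) (fun z => (lam : ℂ) * gaugeDown u z) ψ := by
  have hW := isOpen_punctured hΩ
  have h0 := zero_notMem_punctured (Ω := Ω)
  have hV := gaugeUp_mem_of_even hΩ hψ
  have mT := memLp_of_mem (magneticLaplacian_mem_testFunctions hW h0 hV) (punctured Ω)
  have mX := memLp_of_mem (magneticX_mem_testFunctions hW h0 hV) (punctured Ω)
  have mY := memLp_of_mem (magneticY_mem_testFunctions hW h0 hV) (punctured Ω)
  have hφX := fun n => memLp_of_mem (magneticX_mem_testFunctions hW h0 (hφ n)) (punctured Ω)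
  have hφY := fun n => memLp_of_mem (magneticY_mem_testFunctions hW h0 (hφ n)) (punctured Ω)
  have e1 : l2inner (volume.restrict (punctured Ω)) G₁ (magneticX (gaugeUp ψ)) +
      l2inner (volume.restrict (punctured Ω)) G₂ (magneticY (gaugeUp ψ)) =
      l2inner (volume.restrict (punctured Ω)) (fun z => (lam : ℂ) * u z) (gaugeUp ψ) := by
    rw [← hu.2.2 _ hV]
    refine tendsto_nhds_unique_of_eventuallyEq ((tendsto_l2inner_left hφX hG₁ mX l1).add
      (tendsto_l2inner_left hφY hG₂ mY l2))
      (tendsto_l2inner_left (fun n => memLp_of_mem (hφ n) _) hu.1.1 mT l0) (.of_forall fun n => ?_)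
    exact (l2inner_magneticLaplacian_right hW h0 (hφ n) hV).symm
  have hU := ae_restrict_mem (μ := volume) (isOpen_upperHalf hΩ).measurableSet
  have dψ := differentiable_of_mem hψ.1
  have eX : magneticX (gaugeUp ψ) =ᵐ[volume.restrict (upperHalf Ω)]
      fun z => -Complex.I * phase z * partialX ψ z := by
    filter_upwards [hU] with z hz
    exact magneticX_gaugeUp (upperHalf_subset_slitPlane hz) (dψ z)
  have eY : magneticY (gaugeUp ψ) =ᵐ[volume.restrict (upperHalf Ω)]
      fun z => -Complex.I * phase z * partialY ψ z := by
    filter_upwards [hU] with z hz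
    exact magneticY_gaugeUp (upperHalf_subset_slitPlane hz) (dψ z)
  have sX : twistedReflection (magneticX (gaugeUp ψ)) =ᵐ[volume.restrict (upperHalf Ω)]
      magneticX (gaugeUp ψ) := by
    filter_upwards [hU] with z hz
    exact twistedReflection_magneticX_of_even hΩ hψ (upperHalf_subset_slitPlane hz)
  have sY : twistedReflection (magneticY (gaugeUp ψ)) =ᵐ[volume.restrict (upperHalf Ω)]
      -magneticY (gaugeUp ψ) := by
    filter_upwards [hU] with z hz
    exact twistedReflection_magneticY_of_even hΩ hψ (upperHalf_subset_slitPlane hz)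
  have sV : twistedReflection (gaugeUp ψ) =ᵐ[volume.restrict (upperHalf Ω)] gaugeUp ψ := by
    filter_upwards [hU] with z hz
    exact twistedReflection_gaugeUp_of_even hψ.2 (upperHalf_subset_slitPlane hz)
  have sU : twistedReflection (fun z => (lam : ℂ) * u z) =ᵐ[volume.restrict (upperHalf Ω)]
      fun z => (lam : ℂ) * u z := by
    rw [twistedReflection_const_mul]
    filter_upwards [ae_mono restrict_upperHalf_le hS] with z hz
    rw [hz]
  have hneg : ∀ f g : ℂ → ℂ, l2inner (volume.restrict (upperHalf Ω)) (-f) (-g) =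
      l2inner (volume.restrict (upperHalf Ω)) f g := by
    intro f g; simp [l2inner]
  rw [l2inner_punctured hΩ hΩ₂ hG₁ mX, l2inner_punctured hΩ hΩ₂ hG₂ mY,
    l2inner_punctured hΩ hΩ₂ hu.2.1 (memLp_of_mem hV _), hS₁, hS₂, l2inner_congr .rfl sX,
    l2inner_congr .rfl sY, l2inner_congr sU sV, hneg, l2inner_congr .rfl eX,
    l2inner_congr .rfl eY, ← l2inner_I_mul_conj_phase_left, ← l2inner_I_mul_conj_phase_left] at e1
  have e2 : l2inner (volume.restrict (upperHalf Ω)) (fun z => (lam : ℂ) * u z) (gaugeUp ψ) =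
      l2inner (volume.restrict (upperHalf Ω)) (fun z => (lam : ℂ) * gaugeDown u z) ψ := by
    rw [l2inner_const_mul_left, l2inner_const_mul_left, ← conj_l2inner, l2inner_gaugeUp_left,
      conj_l2inner]
  rw [← e2]
  linear_combination (1 / 2 : ℂ) * e1

/-- On the slit `S` is multiplication by `e^{iπ} = -1`, which forces the Dirichlet condition. -/
theorem eq_zero_of_twistedReflection_eq {φ : ℂ → ℂ} (h : twistedReflection φ = φ) (x : ℝ)
    (hx : x < 0) : φ x = 0 := by
  have h1 := congrFun h (x : ℂ)
  rw [twistedReflection, Complex.arg_ofReal_of_neg hx, mul_comm, mul_comm Complex.I,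
    Complex.exp_pi_mul_I, show sigma₂ (x : ℂ) = x by apply Complex.ext <;> simp] at h1
  linear_combination (-1 / 2 : ℂ) * h1

/-- An eigenfunction of the Aharonov-Bohm operator which is fixed by `S` gives an eigenfunction of
the mixed problem. -/
theorem isDNEigenfunction_gaugeDown (hΩ : IsOpen Ω) (hconv : Convex ℝ Ω) (h0 : (0 : ℂ) ∈ Ω)
    (hΩ₂ : ∀ z ∈ Ω, sigma₂ z ∈ Ω)
    (ha : Ω ∩ {z | z.im = 0} = {z | -(a / 2) < z.re ∧ z.re < a / 2 ∧ z.im = 0})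
    [IsFiniteMeasure (volume.restrict (upperHalf Ω))]
    (hu : IsABEigenfunction Ω lam u)
    (hS : twistedReflection u =ᵐ[volume.restrict (punctured Ω)] u) :
    IsDNEigenfunction Ω a lam (gaugeDown u) := by
  have hle := restrict_upperHalf_le (Ω := Ω)
  have hW := isOpen_punctured hΩ
  have hU := ae_restrict_mem (μ := volume) (isOpen_upperHalf hΩ).measurableSet
  obtain ⟨φ, G₁, G₂, hφ, hφS, hG₁, hG₂, hS₁, hS₂, l0, l1, l2⟩ :=
    hu.1.1.exists_gradient_of_fixed hΩ hΩ₂ hS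
  have hX := fun n => magneticX_mem_testFunctions hW zero_notMem_punctured (hφ n)
  have hY := fun n => magneticY_mem_testFunctions hW zero_notMem_punctured (hφ n)
  have hwL := memLp_gaugeDown (hu.1.1.1.mono_measure hle)
  have hg₁ := memLp_I_mul_conj_phase_mul (hG₁.mono_measure hle)
  have hg₂ := memLp_I_mul_conj_phase_mul (hG₂.mono_measure hle)
  have eX : ∀ n, partialX (gaugeDown (φ n)) =ᵐ[volume.restrict (upperHalf Ω)]
      fun z => Complex.I * conj (phase z) * magneticX (φ n) z := by
    intro n
    filter_upwards [hU] with z hz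
    exact partialX_gaugeDown (upperHalf_subset_slitPlane hz) (differentiable_of_mem (hφ n) z)
  have eY : ∀ n, partialY (gaugeDown (φ n)) =ᵐ[volume.restrict (upperHalf Ω)]
      fun z => Complex.I * conj (phase z) * magneticY (φ n) z := by
    intro n
    filter_upwards [hU] with z hz
    exact partialY_gaugeDown (upperHalf_subset_slitPlane hz) (differentiable_of_mem (hφ n) z)
  have hto : ∀ {F : ℕ → ENNReal} {E : ℕ → ENNReal}, (∀ n, E n ≤ F n) →
      Tendsto F atTop (𝓝 0) → Tendsto E atTop (𝓝 0) := fun hle h =>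
    tendsto_of_tendsto_of_tendsto_of_le_of_le tendsto_const_nhds h (fun _ => zero_le) hle
  obtain ⟨η, hη, k0, k1, k2⟩ := exists_diagonal (μ := volume.restrict (upperHalf Ω))
    (C := testFunctions (slitDomain Ω)) (D₁ := partialX) (D₂ := partialY)
    (φ := fun n => gaugeDown (φ n)) (w := gaugeDown u)
    (fun η => AEStronglyMeasurable η (volume.restrict (upperHalf Ω)) ∧
      AEStronglyMeasurable (partialX η) (volume.restrict (upperHalf Ω)) ∧
      AEStronglyMeasurable (partialY η) (volume.restrict (upperHalf Ω)))
    (fun η h => h)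
    (fun η h => ⟨(memLp_of_mem h _).1, (memLp_of_mem (partialX_mem_testFunctions h) _).1,
      (memLp_of_mem (partialY_mem_testFunctions h) _).1⟩)
    (fun n => ⟨(memLp_gaugeDown (memLp_of_mem (hφ n) _)).1,
      (memLp_I_mul_conj_phase_mul (memLp_of_mem (hX n) _)).1.congr (eX n).symm,
      (memLp_I_mul_conj_phase_mul (memLp_of_mem (hY n) _)).1.congr (eY n).symm⟩)
    hwL.1 hg₁.1 hg₂.1
    (hto (fun n => by
      rw [← gaugeDown_sub, eLpNorm_congr_norm_ae (.of_forall (norm_gaugeDown _))]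
      exact eLpNorm_mono_measure _ hle) l0)
    (hto (fun n => by
      refine le_trans (le_of_eq (eLpNorm_congr_norm_ae ?_)) (eLpNorm_mono_measure _ hle)
      filter_upwards [eX n] with z hz
      rw [Pi.sub_apply, hz, ← mul_sub]
      simp [norm_phase]) l1)
    (hto (fun n => by
      refine le_trans (le_of_eq (eLpNorm_congr_norm_ae ?_)) (eLpNorm_mono_measure _ hle)
      filter_upwards [eY n] with z hz
      rw [Pi.sub_apply, hz, ← mul_sub]
      simp [norm_phase]) l2)
    (fun n => exists_slit_approximation hΩ (hφ n) (eq_zero_of_twistedReflection_eq (hφS n)))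
  refine ⟨⟨hwL.const_mul _, _, _, ⟨hwL, hg₁, hg₂, η, fun k =>
    testFunctions_subset_vanishingNear hΩ ha (hη k), k0, k1, k2⟩, fun ψ hψ => ?_⟩, fun hz => ?_⟩
  · obtain ⟨ψ', hψ', m0, m1, m2⟩ :=
      exists_even_approximation_of_vanishingNear hΩ hconv h0 hΩ₂ ha hψ
    have hψu : ψ ∈ testFunctions Set.univ := ⟨hψ.1, hψ.2.1, Set.subset_univ _⟩
    exact weak_equation_of_tendsto hg₁ hg₂ (hwL.const_mul _)
      (fun k => memLp_of_mem (hψ' k).1 _)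
      (fun k => memLp_of_mem (partialX_mem_testFunctions (hψ' k).1) _)
      (fun k => memLp_of_mem (partialY_mem_testFunctions (hψ' k).1) _)
      (memLp_of_mem hψu _) (memLp_of_mem (partialX_mem_testFunctions hψu) _)
      (memLp_of_mem (partialY_mem_testFunctions hψu) _) m0 m1 m2
      (fun k => weak_equation_of_even hΩ hΩ₂ hu.1 hS hφ hG₁ hG₂ hS₁ hS₂ l0 l1 l2 (hψ' k))
  · refine hu.2 (ae_punctured_of_upperHalf hΩ₂ ?_ ?_)
    · filter_upwards [hz] with z hz
      rw [Pi.zero_apply, ← norm_eq_zero, ← norm_gaugeDown, hz]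
      simp
    · filter_upwards [hz, ae_mono hle hS] with z hz hz'
      rw [Pi.zero_apply, ← norm_eq_zero, ← norm_twistedReflection, hz', ← norm_gaugeDown, hz]
      simp

theorem eLpNorm_punctured_le_of_fixed (hΩ : IsOpen Ω) (hΩ₂ : ∀ z ∈ Ω, sigma₂ z ∈ Ω) {c : ℂ}
    (hc : ‖c‖ = 1) (hf : AEStronglyMeasurable f (volume.restrict (upperHalf Ω)))
    (hS : twistedReflection f =ᵐ[volume.restrict (upperHalf Ω)] fun z => c * f z) :
    eLpNorm f 2 (volume.restrict (punctured Ω)) ≤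
      2 * eLpNorm f 2 (volume.restrict (upperHalf Ω)) := by
  refine (eLpNorm_punctured_le hΩ hΩ₂ hf ((hf.const_mul c).congr hS.symm)).trans (le_of_eq ?_)
  rw [two_mul, eLpNorm_congr_ae hS]
  congr 1
  exact eLpNorm_congr_norm_ae (.of_forall fun z => by simp [hc])

/-- The action of the magnetic form on `e^{iθ/2} φ`, for an even `φ`, read in the half-domain: only
the symmetric part `ψ + S ψ` of the second argument contributes. -/
theorem l2inner_gaugeUp_magneticLaplacian (hΩ : IsOpen Ω) (hΩ₂ : ∀ z ∈ Ω, sigma₂ z ∈ Ω)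
    {φ ψ : ℂ → ℂ} (hφ : φ ∈ evenTestFunctions Ω) (hψ : ψ ∈ testFunctions (punctured Ω)) :
    l2inner (volume.restrict (punctured Ω)) (gaugeUp φ) (magneticLaplacian ψ) =
      l2inner (volume.restrict (upperHalf Ω)) (partialX φ)
        (partialX (gaugeDown (ψ + twistedReflection ψ))) +
      l2inner (volume.restrict (upperHalf Ω)) (partialY φ)
        (partialY (gaugeDown (ψ + twistedReflection ψ))) := by
  have hW := isOpen_punctured hΩ
  have h0 := zero_notMem_punctured (Ω := Ω)
  have hV := gaugeUp_mem_of_even hΩ hφ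
  have hSψ := twistedReflection_mem_testFunctions hW h0 (sigma₂_mem_punctured hΩ₂) hψ
  have hχ := add_mem_testFunctions hψ hSψ
  have dφ := differentiable_of_mem hφ.1
  have dψ := differentiable_of_mem hψ
  have dSψ := differentiable_of_mem hSψ
  have dχ := differentiable_of_mem hχ
  have hU := ae_restrict_mem (μ := volume) (isOpen_upperHalf hΩ).measurableSet
  have L := fun {f : ℂ → ℂ} (hf : f ∈ testFunctions (punctured Ω)) (s : Set ℂ) => memLp_of_mem hf s
  rw [l2inner_magneticLaplacian_right hW h0 hV hψ]
  congr 1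
  · have e1 : twistedReflection (magneticX (gaugeUp φ)) =ᵐ[volume.restrict (upperHalf Ω)]
        magneticX (gaugeUp φ) := by
      filter_upwards [hU] with z hz
      exact twistedReflection_magneticX_of_even hΩ hφ (upperHalf_subset_slitPlane hz)
    have e2 : twistedReflection (magneticX ψ) =ᵐ[volume.restrict (upperHalf Ω)]
        magneticX (twistedReflection ψ) := by
      filter_upwards [hU] with z hz
      exact (magneticX_twistedReflection (upperHalf_subset_slitPlane hz) (dψ _)).symm
    have e3 : magneticX (gaugeUp φ) =ᵐ[volume.restrict (upperHalf Ω)]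
        fun z => -Complex.I * phase z * partialX φ z := by
      filter_upwards [hU] with z hz
      exact magneticX_gaugeUp (upperHalf_subset_slitPlane hz) (dφ z)
    have e4 : (fun z => Complex.I * conj (phase z) * magneticX (ψ + twistedReflection ψ) z)
        =ᵐ[volume.restrict (upperHalf Ω)] partialX (gaugeDown (ψ + twistedReflection ψ)) := by
      filter_upwards [hU] with z hz
      exact (partialX_gaugeDown (upperHalf_subset_slitPlane hz) (dχ z)).symm
    rw [l2inner_punctured hΩ hΩ₂ (L (magneticX_mem_testFunctions hW h0 hV) _)
      (L (magneticX_mem_testFunctions hW h0 hψ) _), l2inner_congr e1 e2,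
      ← l2inner_add_right (L (magneticX_mem_testFunctions hW h0 hV) _)
      (L (magneticX_mem_testFunctions hW h0 hψ) _) (L (magneticX_mem_testFunctions hW h0 hSψ) _),
      ← magneticX_add dψ dSψ, l2inner_congr e3 .rfl, l2inner_neg_I_mul_phase_left,
      l2inner_congr .rfl e4]
  · have e1 : twistedReflection (magneticY (gaugeUp φ)) =ᵐ[volume.restrict (upperHalf Ω)]
        -magneticY (gaugeUp φ) := by
      filter_upwards [hU] with z hz
      exact twistedReflection_magneticY_of_even hΩ hφ (upperHalf_subset_slitPlane hz)
    have e2 : twistedReflection (magneticY ψ) =ᵐ[volume.restrict (upperHalf Ω)]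
        -magneticY (twistedReflection ψ) := by
      filter_upwards [hU] with z hz
      rw [Pi.neg_apply, magneticY_twistedReflection (upperHalf_subset_slitPlane hz) (dψ _), neg_neg]
    have e3 : magneticY (gaugeUp φ) =ᵐ[volume.restrict (upperHalf Ω)]
        fun z => -Complex.I * phase z * partialY φ z := by
      filter_upwards [hU] with z hz
      exact magneticY_gaugeUp (upperHalf_subset_slitPlane hz) (dφ z)
    have e4 : (fun z => Complex.I * conj (phase z) * magneticY (ψ + twistedReflection ψ) z)
        =ᵐ[volume.restrict (upperHalf Ω)] partialY (gaugeDown (ψ + twistedReflection ψ)) := by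
      filter_upwards [hU] with z hz
      exact (partialY_gaugeDown (upperHalf_subset_slitPlane hz) (dχ z)).symm
    have hneg : ∀ f g : ℂ → ℂ, l2inner (volume.restrict (upperHalf Ω)) (-f) (-g) =
        l2inner (volume.restrict (upperHalf Ω)) f g := by
      intro f g; simp [l2inner]
    rw [l2inner_punctured hΩ hΩ₂ (L (magneticY_mem_testFunctions hW h0 hV) _)
      (L (magneticY_mem_testFunctions hW h0 hψ) _), l2inner_congr e1 e2, hneg,
      ← l2inner_add_right (L (magneticY_mem_testFunctions hW h0 hV) _)
      (L (magneticY_mem_testFunctions hW h0 hψ) _) (L (magneticY_mem_testFunctions hW h0 hSψ) _),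
      ← magneticY_add dψ dSψ, l2inner_congr e3 .rfl, l2inner_neg_I_mul_phase_left,
      l2inner_congr .rfl e4]

theorem symmExtension_comp_sigma₂ (w : ℂ → ℂ) : symmExtension w ∘ sigma₂ = symmExtension w := by
  funext z; simp [symmExtension]

theorem symmExtension_of_im_pos (w : ℂ → ℂ) {z : ℂ} (hz : 0 < z.im) :
    symmExtension w z = w z := by
  rw [symmExtension, abs_of_pos hz]

/-- An eigenfunction of the mixed problem gives, after extension by symmetry, an eigenfunction of
the Aharonov-Bohm operator. -/
theorem isABEigenfunction_gaugeUp (hΩ : IsOpen Ω) (hconv : Convex ℝ Ω) (h0 : (0 : ℂ) ∈ Ω)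
    (hΩ₂ : ∀ z ∈ Ω, sigma₂ z ∈ Ω)
    (ha : Ω ∩ {z | z.im = 0} = {z | -(a / 2) < z.re ∧ z.re < a / 2 ∧ z.im = 0})
    [IsFiniteMeasure (volume.restrict (upperHalf Ω))]
    (hw : IsDNEigenfunction Ω a lam w) :
    IsABEigenfunction Ω lam (gaugeUp (symmExtension w)) := by
  have hle := restrict_upperHalf_le (Ω := Ω)
  have hW := isOpen_punctured hΩ
  have h0' := zero_notMem_punctured (Ω := Ω)
  have hU := ae_restrict_mem (μ := volume) (isOpen_upperHalf hΩ).measurableSet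
  obtain ⟨⟨hf, g₁, g₂, ⟨hwL, hg₁, hg₂, φ₀, hφ₀, k0, k1, k2⟩, htest⟩, hne⟩ := hw
  have hvan : ∀ {ψ : ℂ → ℂ}, ψ ∈ vanishingNear (dirichletPart Ω a) →
      ψ ∈ testFunctions Set.univ := fun h => ⟨h.1, h.2.1, Set.subset_univ _⟩
  obtain ⟨φ, hφ, l0, l1, l2⟩ := exists_diagonal (μ := volume.restrict (upperHalf Ω))
    (C := evenTestFunctions Ω) (D₁ := partialX) (D₂ := partialY) (φ := φ₀) (w := w)
    (fun η => η ∈ testFunctions Set.univ)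
    (fun η h => ⟨(memLp_of_mem h _).1, (memLp_of_mem (partialX_mem_testFunctions h) _).1,
      (memLp_of_mem (partialY_mem_testFunctions h) _).1⟩)
    (fun η h => testFunctions_mono (Set.subset_univ _) h.1) (fun n => hvan (hφ₀ n))
    hwL.1 hg₁.1 hg₂.1 k0 k1 k2
    (fun n => exists_even_approximation_of_vanishingNear hΩ hconv h0 hΩ₂ ha (hφ₀ n))
  set v := gaugeUp (symmExtension w) with hv
  have ev : v =ᵐ[volume.restrict (upperHalf Ω)] gaugeUp w := by
    filter_upwards [hU] with z hz
    rw [hv, gaugeUp_apply, symmExtension_of_im_pos w hz.2, gaugeUp_apply]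
  have sv : ∀ z ∈ Complex.slitPlane, twistedReflection v z = v z := fun z hz => by
    rw [hv, twistedReflection_gaugeUp _ hz, symmExtension_comp_sigma₂]
  have sv' : twistedReflection v =ᵐ[volume.restrict (upperHalf Ω)] v := by
    filter_upwards [hU] with z hz
    exact sv z (upperHalf_subset_slitPlane hz)
  have hvU : MemLp v 2 (volume.restrict (upperHalf Ω)) := (memLp_gaugeUp hwL).ae_eq ev.symm
  have hvL : MemLp v 2 (volume.restrict (punctured Ω)) :=
    memLp_punctured hΩ hΩ₂ hvU (hvU.ae_eq sv'.symm)
  have hV := fun n => gaugeUp_mem_of_even hΩ (hφ n)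
  have dφ := fun n => differentiable_of_mem (hφ n).1
  have hX := fun n => magneticX_mem_testFunctions hW h0' (hV n)
  have hY := fun n => magneticY_mem_testFunctions hW h0' (hV n)
  have hto : ∀ {ι : Type} {l : Filter ι} {F E : ι → ENNReal}, (∀ n, E n ≤ 2 * F n) →
      Tendsto F l (𝓝 0) → Tendsto E l (𝓝 0) := fun hle h =>
    tendsto_of_tendsto_of_tendsto_of_le_of_le tendsto_const_nhds
      (by simpa using ENNReal.Tendsto.const_mul h (Or.inr (by norm_num : (2 : ENNReal) ≠ ⊤)))
      (fun _ => zero_le) hle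
  have hlim : Tendsto (fun n => eLpNorm (gaugeUp (φ n) - v) 2 (volume.restrict (punctured Ω)))
      atTop (𝓝 0) := by
    refine hto (fun n => ?_) l0
    refine (eLpNorm_punctured_le_of_fixed hΩ hΩ₂ (c := 1) (by simp)
      ((memLp_of_mem (hV n) _).sub hvU).1 ?_).trans (le_of_eq ?_)
    · rw [twistedReflection_sub]
      filter_upwards [hU, sv'] with z hz hz'
      rw [Pi.sub_apply, hz', twistedReflection_gaugeUp_of_even (hφ n).2
        (upperHalf_subset_slitPlane hz), one_mul, Pi.sub_apply]
    · congr 1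
      refine eLpNorm_congr_norm_ae ?_
      filter_upwards [ev] with z hz
      rw [Pi.sub_apply, hz, ← Pi.sub_apply, ← gaugeUp_sub, norm_gaugeUp]
  have hcX : Tendsto (fun p : ℕ × ℕ => eLpNorm (magneticX (gaugeUp (φ p.1)) -
      magneticX (gaugeUp (φ p.2))) 2 (volume.restrict (punctured Ω))) atTop (𝓝 0) := by
    refine hto (fun p => ?_) (tendsto_cauchy_of_tendsto (f := fun n => partialX (φ n))
      (fun n => memLp_of_mem (partialX_mem_testFunctions (hφ n).1) _) hg₁ l1)
    refine (eLpNorm_punctured_le_of_fixed hΩ hΩ₂ (c := 1) (by simp)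
      ((memLp_of_mem (hX p.1) _).sub (memLp_of_mem (hX p.2) _)).1 ?_).trans (le_of_eq ?_)
    · rw [twistedReflection_sub]
      filter_upwards [hU] with z hz
      have hz := upperHalf_subset_slitPlane hz
      rw [Pi.sub_apply, twistedReflection_magneticX_of_even hΩ (hφ _) hz,
        twistedReflection_magneticX_of_even hΩ (hφ _) hz, one_mul, Pi.sub_apply]
    · congr 1
      refine eLpNorm_congr_norm_ae ?_
      filter_upwards [hU] with z hz
      have hz := upperHalf_subset_slitPlane hz
      rw [Pi.sub_apply, magneticX_gaugeUp hz (dφ _ z), magneticX_gaugeUp hz (dφ _ z), ← mul_sub]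
      simp [norm_phase]
  have hcY : Tendsto (fun p : ℕ × ℕ => eLpNorm (magneticY (gaugeUp (φ p.1)) -
      magneticY (gaugeUp (φ p.2))) 2 (volume.restrict (punctured Ω))) atTop (𝓝 0) := by
    refine hto (fun p => ?_) (tendsto_cauchy_of_tendsto (f := fun n => partialY (φ n))
      (fun n => memLp_of_mem (partialY_mem_testFunctions (hφ n).1) _) hg₂ l2)
    refine (eLpNorm_punctured_le_of_fixed hΩ hΩ₂ (c := -1) (by simp)
      ((memLp_of_mem (hY p.1) _).sub (memLp_of_mem (hY p.2) _)).1 ?_).trans (le_of_eq ?_)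
    · rw [twistedReflection_sub]
      filter_upwards [hU] with z hz
      have hz := upperHalf_subset_slitPlane hz
      rw [Pi.sub_apply, twistedReflection_magneticY_of_even hΩ (hφ _) hz,
        twistedReflection_magneticY_of_even hΩ (hφ _) hz, Pi.sub_apply]
      ring
    · congr 1
      refine eLpNorm_congr_norm_ae ?_
      filter_upwards [hU] with z hz
      have hz := upperHalf_subset_slitPlane hz
      rw [Pi.sub_apply, magneticY_gaugeUp hz (dφ _ z), magneticY_gaugeUp hz (dφ _ z), ← mul_sub]
      simp [norm_phase]
  refine ⟨⟨inFormDomain_of_cauchy hW h0' hvL hV hlim hcX hcY, hvL.const_mul _, fun ψ hψ => ?_⟩,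
    fun hz => hne ?_⟩
  · have hSψ := twistedReflection_mem_testFunctions hW h0' (sigma₂_mem_punctured hΩ₂) hψ
    have hχ := add_mem_testFunctions hψ hSψ
    have dχ := differentiable_of_mem hχ
    have sχ : twistedReflection (ψ + twistedReflection ψ) = ψ + twistedReflection ψ := by
      rw [twistedReflection_add, twistedReflection_twistedReflection, add_comm]
    have mη : MemLp (gaugeDown (ψ + twistedReflection ψ)) 2 (volume.restrict (upperHalf Ω)) :=
      memLp_gaugeDown (memLp_of_mem hχ _)
    have mηX : MemLp (partialX (gaugeDown (ψ + twistedReflection ψ))) 2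
        (volume.restrict (upperHalf Ω)) := by
      refine (memLp_I_mul_conj_phase_mul (memLp_of_mem
        (magneticX_mem_testFunctions hW h0' hχ) _)).ae_eq ?_
      filter_upwards [hU] with z hz
      exact (partialX_gaugeDown (upperHalf_subset_slitPlane hz) (dχ z)).symm
    have mηY : MemLp (partialY (gaugeDown (ψ + twistedReflection ψ))) 2
        (volume.restrict (upperHalf Ω)) := by
      refine (memLp_I_mul_conj_phase_mul (memLp_of_mem
        (magneticY_mem_testFunctions hW h0' hχ) _)).ae_eq ?_
      filter_upwards [hU] with z hz
      exact (partialY_gaugeDown (upperHalf_subset_slitPlane hz) (dχ z)).symm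
    obtain ⟨η, hη, m0, m1, m2⟩ :=
      exists_slit_approximation hΩ hχ (eq_zero_of_twistedReflection_eq sχ)
    have hweak := weak_equation_of_tendsto hg₁ hg₂ hf (fun k => memLp_of_mem (hη k) _)
      (fun k => memLp_of_mem (partialX_mem_testFunctions (hη k)) _)
      (fun k => memLp_of_mem (partialY_mem_testFunctions (hη k)) _) mη mηX mηY m0 m1 m2
      (fun k => htest _ (testFunctions_subset_vanishingNear hΩ ha (hη k)))
    have hleft : l2inner (volume.restrict (punctured Ω)) v (magneticLaplacian ψ) =
        l2inner (volume.restrict (upperHalf Ω)) g₁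
          (partialX (gaugeDown (ψ + twistedReflection ψ))) +
        l2inner (volume.restrict (upperHalf Ω)) g₂
          (partialY (gaugeDown (ψ + twistedReflection ψ))) := by
      refine tendsto_nhds_unique_of_eventuallyEq
        (tendsto_l2inner_left (fun n => memLp_of_mem (hV n) _) hvL
          (memLp_of_mem (magneticLaplacian_mem_testFunctions hW h0' hψ) _) hlim)
        ((tendsto_l2inner_left (fun n => memLp_of_mem (partialX_mem_testFunctions (hφ n).1) _)
          hg₁ mηX l1).add
        (tendsto_l2inner_left (fun n => memLp_of_mem (partialY_mem_testFunctions (hφ n).1) _)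
          hg₂ mηY l2)) (.of_forall fun n => ?_)
      exact l2inner_gaugeUp_magneticLaplacian hΩ hΩ₂ (hφ n) hψ
    rw [hleft, hweak, l2inner_const_mul_left, l2inner_const_mul_left,
      l2inner_punctured hΩ hΩ₂ hvL (memLp_of_mem hψ _), l2inner_congr sv' .rfl,
      ← l2inner_add_right hvU (memLp_of_mem hψ _) (memLp_of_mem hSψ _), l2inner_congr ev .rfl,
      l2inner_gaugeUp_left]
  · filter_upwards [ae_mono hle hz, ev] with z h1 h2
    rw [h1] at h2
    rw [Pi.zero_apply, ← norm_eq_zero, ← norm_gaugeUp, ← h2]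
    simp

end Correspondence

/-! ### Reality and the symmetric eigenfunctions -/

section Reality

variable {Ω : Set ℂ} {lam : ℝ} {u w : ℂ → ℂ}

theorem opK_opSigma₂c (u : ℂ → ℂ) : opK (opSigma₂c u) = twistedReflection u := by
  funext z; simp [opK, opSigma₂c, twistedReflection]

theorem twistedReflection_eq_of_isKReal (hK : IsKReal Ω u) (hS : IsSigma₂cInvariant Ω u) :
    twistedReflection u =ᵐ[volume.restrict (punctured Ω)] u := by
  filter_upwards [hK, hS] with z h1 h2
  rw [← opK_opSigma₂c, opK, h2]
  exact h1

theorem isRealValued_gaugeDown (hK : IsKReal Ω u) :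
    IsRealValued (upperHalf Ω) (gaugeDown u) := by
  filter_upwards [ae_mono restrict_upperHalf_le hK] with z hz
  rw [opK, ← phase_sq] at hz
  rw [← Complex.conj_eq_iff_im, gaugeDown_apply, map_mul, Complex.conj_conj]
  linear_combination conj (phase z) * hz - phase z * conj (u z) * phase_mul_conj z

theorem ae_conj_symmExtension (hΩ : IsOpen Ω) (hΩ₂ : ∀ z ∈ Ω, sigma₂ z ∈ Ω)
    (hw : IsRealValued (upperHalf Ω) w) :
    ∀ᵐ z ∂(volume.restrict (punctured Ω)), conj (symmExtension w z) = symmExtension w z := by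
  have hU := ae_restrict_mem (μ := volume) (isOpen_upperHalf hΩ).measurableSet
  have h : ∀ᵐ z ∂(volume.restrict (upperHalf Ω)),
      conj (symmExtension w z) = symmExtension w z := by
    filter_upwards [hU, hw] with z hz h
    rw [symmExtension_of_im_pos w hz.2, Complex.conj_eq_iff_im, h]
  refine ae_punctured_of_upperHalf hΩ₂ h ?_
  filter_upwards [h] with z hz
  rwa [← Function.comp_apply (f := symmExtension w), symmExtension_comp_sigma₂]

theorem isKReal_gaugeUp (h : ∀ᵐ z ∂(volume.restrict (punctured Ω)), conj (w z) = w z) :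
    IsKReal Ω (gaugeUp w) := by
  filter_upwards [h] with z hz
  rw [opK, ← phase_sq, gaugeUp_apply, map_mul, hz]
  linear_combination (phase z * w z) * phase_mul_conj z

theorem isSigma₂cInvariant_gaugeUp
    (h : ∀ᵐ z ∂(volume.restrict (punctured Ω)), conj (w z) = w z) (hw : w ∘ sigma₂ = w) :
    IsSigma₂cInvariant Ω (gaugeUp w) := by
  filter_upwards [h, ae_restrict_of_ae ae_mem_slitPlane] with z hz hs
  rw [opSigma₂c, gaugeUp_apply, gaugeUp_apply, phase_sigma₂ hs,
    ← Function.comp_apply (f := w) (g := sigma₂), hw, map_mul, Complex.conj_conj, hz]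

/-- The antilinear reflection `Σ₁ᶜ` exchanges the two eigenspaces of `S`. -/
theorem twistedReflection_conjReflection (u : ℂ → ℂ) {z : ℂ} (hz : z ≠ 0) :
    twistedReflection (conjReflection u) z = -conjReflection (twistedReflection u) z := by
  have hu : ∀ ζ : ℂ, ζ ≠ 0 → Complex.exp (Complex.I * ζ.arg) = ζ / ‖ζ‖ := by
    intro ζ hζ
    have h := Complex.norm_mul_exp_arg_mul_I ζ
    have h2 : (‖ζ‖ : ℂ) ≠ 0 := by simpa using hζ
    rw [mul_comm Complex.I, eq_div_iff h2, mul_comm, h]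
  have hz1 : sigma₁ z ≠ 0 := fun h => hz (by
    rw [← norm_eq_zero, ← norm_sigma₁, h, norm_zero])
  have hcomm : sigma₁ (sigma₂ z) = sigma₂ (sigma₁ z) := by apply Complex.ext <;> simp
  rw [twistedReflection, conjReflection, conjReflection, twistedReflection, hu z hz, hu _ hz1,
    norm_sigma₁, hcomm, map_mul, map_div₀, Complex.conj_ofReal,
    show conj (sigma₁ z) = -z by simp [sigma₁_eq_neg_conj]]
  ring

/-- Every eigenvalue of the Aharonov-Bohm operator has an eigenfunction fixed by `S`: either
`u + S u` is one, or `S u = -u` and `Σ₁ᶜ u` is one. -/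
theorem exists_fixed_eigenfunction (hΩ : IsOpen Ω) (hΩ₁ : ∀ z ∈ Ω, sigma₁ z ∈ Ω)
    (hΩ₂ : ∀ z ∈ Ω, sigma₂ z ∈ Ω) (hu : IsABEigenfunction Ω lam u) :
    ∃ v, IsABEigenfunction Ω lam v ∧
      twistedReflection v =ᵐ[volume.restrict (punctured Ω)] v := by
  by_cases h : u + twistedReflection u =ᵐ[volume.restrict (punctured Ω)] 0
  · have hq := (measurePreserving_sigma₁_punctured hΩ₁).quasiMeasurePreserving
    refine ⟨conjReflection u, ⟨SolvesAB.conjReflection hΩ₁ hu.1, fun h0 => hu.2 ?_⟩, ?_⟩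
    · filter_upwards [hq.ae h0] with z hz
      have : conjReflection u (sigma₁ z) = 0 := hz
      rw [conjReflection, sigma₁_sigma₁] at this
      simpa using this
    · have hne : ∀ᵐ z ∂(volume.restrict (punctured Ω)), z ∈ Complex.slitPlane :=
        ae_restrict_of_ae ae_mem_slitPlane
      filter_upwards [hq.ae h, hne] with z hz hs
      rw [twistedReflection_conjReflection u (Complex.slitPlane_ne_zero hs)]
      have h1 : u (sigma₁ z) + twistedReflection u (sigma₁ z) = 0 := hz
      rw [conjReflection, conjReflection, eq_neg_of_add_eq_zero_right h1, map_neg, neg_neg]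
  · refine ⟨u + twistedReflection u,
      ⟨SolvesAB.add hΩ hu.1 (SolvesAB.twistedReflection hΩ hΩ₂ hu.1), h⟩, .of_eq ?_⟩
    rw [twistedReflection_add, twistedReflection_twistedReflection, add_comm]

theorem sigma_mem_of_image_punctured {s : ℂ → ℂ} (hs : s 0 = 0)
    (h : s '' punctured Ω = punctured Ω) (z : ℂ) (hz : z ∈ Ω) : s z ∈ Ω := by
  by_cases h0 : z = 0
  · rw [h0, hs, ← h0]; exact hz
  · exact (h ▸ Set.mem_image_of_mem s (show z ∈ punctured Ω from ⟨hz, h0⟩) : s z ∈ punctured Ω).1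

end Reality

end AharonovBohm

end

theorem mainTheorem4 (Ω : Set ℂ) (a b : ℝ)
    (hopen : IsOpen Ω) (hconv : Convex ℝ Ω) (h0 : (0 : ℂ) ∈ Ω)
    (hσ₁ : AharonovBohm.sigma₁ '' AharonovBohm.punctured Ω = AharonovBohm.punctured Ω)
    (hσ₂ : AharonovBohm.sigma₂ '' AharonovBohm.punctured Ω = AharonovBohm.punctured Ω)
    (ha : Ω ∩ {z | z.im = 0} = {z | -(a / 2) < z.re ∧ z.re < a / 2 ∧ z.im = 0})
    (hb : Ω ∩ {z | z.re = 0} = {z | z.re = 0 ∧ -(b / 2) < z.im ∧ z.im < b / 2}) :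
    (∀ (lam : ℝ) (u : ℂ → ℂ),
      AharonovBohm.IsABEigenfunction Ω lam u →
      AharonovBohm.IsKReal Ω u →
      AharonovBohm.IsSigma₂cInvariant Ω u →
        AharonovBohm.IsRealValued (AharonovBohm.upperHalf Ω) (AharonovBohm.gaugeDown u) ∧
        AharonovBohm.IsDNEigenfunction Ω a lam (AharonovBohm.gaugeDown u)) ∧
    (∀ lam : ℝ, AharonovBohm.IsABEigenvalue Ω lam → AharonovBohm.IsDNEigenvalue Ω a lam) ∧
    (∀ (lam : ℝ) (w : ℂ → ℂ),
      AharonovBohm.IsDNEigenfunction Ω a lam w →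
        AharonovBohm.IsABEigenfunction Ω lam
          (AharonovBohm.gaugeUp (AharonovBohm.symmExtension w)) ∧
        (AharonovBohm.IsRealValued (AharonovBohm.upperHalf Ω) w →
          AharonovBohm.IsKReal Ω (AharonovBohm.gaugeUp (AharonovBohm.symmExtension w)) ∧
          AharonovBohm.IsSigma₂cInvariant Ω
            (AharonovBohm.gaugeUp (AharonovBohm.symmExtension w)))) ∧
    (∀ lam : ℝ, AharonovBohm.IsDNEigenvalue Ω a lam → AharonovBohm.IsABEigenvalue Ω lam) := by
  have hΩ₁ := AharonovBohm.sigma_mem_of_image_punctured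
    (by apply Complex.ext <;> simp) hσ₁
  have hΩ₂ := AharonovBohm.sigma_mem_of_image_punctured
    (by apply Complex.ext <;> simp) hσ₂
  have := AharonovBohm.isFiniteMeasure_upperHalf hconv hΩ₁ hΩ₂ ha hb
  refine ⟨fun lam u hu hK hS => ⟨AharonovBohm.isRealValued_gaugeDown hK,
    AharonovBohm.isDNEigenfunction_gaugeDown hopen hconv h0 hΩ₂ ha hu
      (AharonovBohm.twistedReflection_eq_of_isKReal hK hS)⟩, ?_,
    fun lam w hw => ⟨AharonovBohm.isABEigenfunction_gaugeUp hopen hconv h0 hΩ₂ ha hw,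
      fun hr => ?_⟩, ?_⟩
  · rintro lam ⟨u, hu⟩
    obtain ⟨v, hv, hS⟩ := AharonovBohm.exists_fixed_eigenfunction hopen hΩ₁ hΩ₂ hu
    exact ⟨_, AharonovBohm.isDNEigenfunction_gaugeDown hopen hconv h0 hΩ₂ ha hv hS⟩
  · have hr' := AharonovBohm.ae_conj_symmExtension hopen hΩ₂ hr
    exact ⟨AharonovBohm.isKReal_gaugeUp hr', AharonovBohm.isSigma₂cInvariant_gaugeUp hr'
      (AharonovBohm.symmExtension_comp_sigma₂ w)⟩
  · rintro lam ⟨w, hw⟩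
    exact ⟨_, AharonovBohm.isABEigenfunction_gaugeUp hopen hconv h0 hΩ₂ ha hw⟩
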